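/- **Setting.** Let $0<m<n$, $A\in\mathbb R^{m\times n}$, $b\in\mathbb R^m$, $c\in\mathbb R^n$, and consider the linear programs $$\min\{\langle c,x\rangle: Ax=b,\ x\ge 0\},\qquad \max\{\langle b,y\rangle: s+A^Ty=c,\ s\ge 0\}.$$ Products, squares and inverses of vectors are componentwise, $e$ is the all-ones vector in $\mathbb R^n$, $\|\cdot\|$ is the Euclidean norm. Let $\mathcal F_0$ be the set of $u=(x,s,y)$ with $Ax=b$, $s+A^Ty=c$, $x,s>0$. For $w=(v^{0},v)\in\mathbb R\times\mathbb R^n$ put $\rho(w)=\frac{v^{0}-\|v\|^2}{n+1}$. A pair $z=(u,w)$ is *interior* if $u\in\mathcal F_0$, $v^0\ge 0$, $v^{0}>\|v\|^2$, $xs>v^2$ and $v^{0}>\langle c,x\rangle-\langle b,y\rangle$. For interior $z$ let $$F(z)=-\sum_{i=1}^n\ln(x_is_i-v_i^2)-\ln(v^{0}-\langle c,x\rangle+\langle b,y\rangle),\qquad \Psi(z)=F(z)+(n+1)\ln\rho(w),$$ $r_0(z)=v^{0}-\langle s,x\rangle$, $r_i(z)=x_is_i-v_i^2$ $(1\le i\le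 n)$, $\check r=(r_1,\dots,r_n)$, $$\chi_k(z)=\Big[\sum_{i=0}^n\frac{(r_i(z)-\rho(w))^2}{r_i(z)^k\rho(w)^{2-k}}\Big]^{1/2},\qquad \delta(z)=\chi_1(z)^2/\chi_2(z)\quad(\delta(z)=0\text{ if }\chi_2(z)=0).$$ For $d\in\mathbb R^n$ let $\Delta(d)=(\Delta^x,\Delta^s,\Delta^y)$ be the solution of $x\Delta^s+s\Delta^x=d$, $A\Delta^x=0$, $\Delta^s+A^T\Delta^y=0$. Let $\omega_*(\tau)=-\tau-\ln(1-\tau)$. **Methods.** Fix $r\in(0,1)$, $\beta=\frac r{2+r}$, $\underline\beta\in(0,\beta]$, and line-search accuracies $\eta\in[0,\frac12]$, $\theta\in(0,1]$ ($\eta=0$, $\theta=1$ is exact line search). Start from $u_0=(x_0,s_0,y_0)\in\mathcal F_0$, $\sigma_0=\min_i (x_0)_i(s_0)_i$, and $w_0=(\langle s_0,x_0\rangle+\sigma_0,\ \sqrt{x_0s_0-\sigma_0e})$. At $z_k=(u_k,w_k)$, with current $x,s,v,w$ and acceptance level $\beta_k$ (any $\beta_k\in[\underline\beta,\beta]$ for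 TPTFM, $\beta_k=\beta$ for ACPTFM and PTFM2): * *Predictor step*, if $\delta(z_k)\le\beta_k$. Put $z(\alpha)=(u(\alpha),(1-\alpha)w_k)$, where - TPTFM: $u(\alpha)=u_k+\alpha\Delta(d)$, $d=(\frac{\|v\|^2}{n+1}-\rho(w))e-2v^2$; - ACPTFM: $u(\alpha)=u_k+\alpha\tilde\Delta$, $\tilde\Delta=\Delta(\frac{\|v\|^2}{n+1}e-v^2-xs)$; - PTFM2: $u(\alpha)=u_k+\alpha\tilde\Delta+\alpha^2\Delta(\hat d)$ with the same $\tilde\Delta$ and $\hat d=v^2-\frac{\|v\|^2}{n+1}e-\tilde\Delta^x\tilde\Delta^s$. Take $z_{k+1}=z(\alpha_k)$ for any $\alpha_k\in(0,1)$ with $z(\alpha_k)$ interior and $|\Psi(z(\alpha_k))-\omega_*(r)|\le\eta\,\omega_*(r)$. If there is no such $\alpha_k$, take $\alpha_k=1$ and stop with output $u(1)$. * *Corrector step*, otherwise. Put $d=\rho(w)e-\check r(z_k)$, $z(\alpha)=(u_k+\alpha\Delta(d),w_k)$. Take $z_{k+1}=z(\alpha_k)$ for any $\alpha_k\ge0$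 with $z(\alpha_k)$ interior and $F(z_k)-F(z(\alpha_k))\ge\theta\,(F(z_k)-F(z(\alpha)))$ for all $\alpha\ge0$ with $z(\alpha)$ interior. **Termination test** (replacing the $\epsilon$-stopping rule). Fix one of the indicators $x$, $s^{-1}$, $xs^{-1}$. At the beginning of every iteration, let $B$ consist of the indices of the $m$ largest components of the indicator at $z_k$ (ties broken arbitrarily) and $N$ of the other indices. If the columns of $A$ with index in $B$ form a nonsingular matrix $A_B$, and the candidate $x_B=A_B^{-1}b$, $x_N=0$, $y=A_B^{-T}c_B$, $s_B=0$, $s_N=c_N-A_N^Ty$ satisfies $x\ge0$, $s\ge0$, the method stops with this candidate as output. Otherwise the iteration is carried out as above. **Statement.** For all $r\in(0,1)$, $\underline\beta\in(0,\frac r{2+r}]$, $\eta\in[0,\frac12]$, $\theta\in(0,1]$ there is a constant $C>0$, depending only on these four numbers, such that the following holds for all $0<m<n$, all $A,b,c$ and all $u_0\in\mathcal F_0$. Suppose that the pair of problems has a unique optimal primal-dual solution $u^*=(x^*,s^*,y^*)$ and that it satisfies $x^*+s^*>0$. Let $x^*_{\min}$ and $s^*_{\min}$ be the smallest positive components of $x^*$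 and $s^*$. Then for each of the methods TPTFM, ACPTFM, PTFM2, with each of the three indicators, the iterations of the method started at $u_0$ are well defined until it stops, and every run of the method stops with the exact optimal solution $u^*$ as output, after at most $$C\sqrt n\;\max\Big\{1,\ \ln\frac{(\langle s_0,x_0\rangle+\sigma_0)^2}{x^*_{\min}\,s^*_{\min}\,\sigma_0}\Big\}$$ iterations, predictor and corrector steps both being counted. -/

import Mathlib

open Matrix

namespace PTF

noncomputable section

/-- Data of the primal-dual pair of linear programs
`min {⟨c,x⟩ : A x = b, x ≥ 0}` and `max {⟨b,y⟩ : s + Aᵀ y = c, s ≥ 0}`. -/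
structure LP (m n : ℕ) where
  A : Matrix (Fin m) (Fin n) ℝ
  b : Fin m → ℝ
  c : Fin n → ℝ

/-- A primal-dual triple `u = (x, s, y)`; also used for directions in the space of such triples. -/
@[ext]
structure Point (m n : ℕ) where
  x : Fin n → ℝ
  s : Fin n → ℝ
  y : Fin m → ℝ

/-- The control variable `w = (v⁰, v)`. -/
@[ext]
structure Control (n : ℕ) where
  v0 : ℝ
  v : Fin n → ℝ

/-- The full vector of variables `z = (u, w)`. -/
@[ext]
structure State (m n : ℕ) where
  u : Point m n
  w : Control n

/-- `u + α D`. -/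
def Point.move {m n : ℕ} (u : Point m n) (α : ℝ) (D : Point m n) : Point m n :=
  ⟨u.x + α • D.x, u.s + α • D.s, u.y + α • D.y⟩

/-- `t w`. -/
def Control.scale {n : ℕ} (t : ℝ) (w : Control n) : Control n := ⟨t * w.v0, t • w.v⟩

/-! ### Linear programming -/

def LP.PrimalFeasible {m n : ℕ} (P : LP m n) (x : Fin n → ℝ) : Prop :=
  P.A *ᵥ x = P.b ∧ ∀ i, 0 ≤ x i

def LP.DualFeasible {m n : ℕ} (P : LP m n) (s : Fin n → ℝ) (y : Fin m → ℝ) : Prop :=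
  s + P.Aᵀ *ᵥ y = P.c ∧ ∀ i, 0 ≤ s i

/-- `x` solves the primal problem and `(s, y)` solves the dual problem. -/
def LP.IsOptimal {m n : ℕ} (P : LP m n) (u : Point m n) : Prop :=
  P.PrimalFeasible u.x ∧ P.DualFeasible u.s u.y ∧
    (∀ x, P.PrimalFeasible x → P.c ⬝ᵥ u.x ≤ P.c ⬝ᵥ x) ∧
    (∀ s y, P.DualFeasible s y → P.b ⬝ᵥ y ≤ P.b ⬝ᵥ u.y)

/-- The set `𝓕₀` of strictly feasible primal-dual triples. -/
def LP.StrictlyFeasible {m n : ℕ} (P : LP m n) (u : Point m n) : Prop :=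
  P.A *ᵥ u.x = P.b ∧ u.s + P.Aᵀ *ᵥ u.y = P.c ∧ (∀ i, 0 < u.x i) ∧ (∀ i, 0 < u.s i)

/-- The smallest positive component of a vector. -/
def minPos {n : ℕ} (a : Fin n → ℝ) : ℝ := sInf {t | ∃ i, 0 < a i ∧ t = a i}

/-! ### The parabolic target space -/

/-- `‖v‖²` (Euclidean norm). -/
def Control.sq {n : ℕ} (w : Control n) : ℝ := ∑ i, w.v i ^ 2

/-- `ρ(w) = (v⁰ - ‖v‖²) / (n + 1)`. -/
def Control.rho {n : ℕ} (w : Control n) : ℝ := (w.v0 - w.sq) / (n + 1)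

/-- The parabolic target set `𝓕ₚ`. -/
def Control.InTarget {n : ℕ} (w : Control n) : Prop := 0 ≤ w.v0 ∧ w.sq < w.v0

/-- The interior of the feasible set `𝓕`: the domain of the barrier. -/
def LP.Interior {m n : ℕ} (P : LP m n) (z : State m n) : Prop :=
  P.StrictlyFeasible z.u ∧ z.w.InTarget ∧
    (∀ i, z.w.v i ^ 2 < z.u.x i * z.u.s i) ∧ P.c ⬝ᵥ z.u.x - P.b ⬝ᵥ z.u.y < z.w.v0

/-- The barrier `F(u, w)`, meaningful at interior points. -/
def LP.barrier {m n : ℕ} (P : LP m n) (z : State m n) : ℝ :=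
  -(∑ i, Real.log (z.u.x i * z.u.s i - z.w.v i ^ 2))
    - Real.log (z.w.v0 - P.c ⬝ᵥ z.u.x + P.b ⬝ᵥ z.u.y)

/-- `φ(w) = -(n+1) ln ρ(w)`. -/
def Control.phi {n : ℕ} (w : Control n) : ℝ := -((n + 1 : ℝ) * Real.log w.rho)

/-- The functional proximity measure `Ψ(z) = F(z) - φ(w)`, meaningful at interior points. -/
def LP.Psi {m n : ℕ} (P : LP m n) (z : State m n) : ℝ := P.barrier z - z.w.phi

/-- The residual vector `r(z) ∈ ℝ^{n+1}`. -/
def State.res {m n : ℕ} (z : State m n) : Fin (n + 1) → ℝ :=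
  Fin.cons (z.w.v0 - z.u.s ⬝ᵥ z.u.x) (fun i => z.u.x i * z.u.s i - z.w.v i ^ 2)

/-- `χ_k(z)`, used for `k = 0, 1, 2`. -/
def State.chi {m n : ℕ} (k : ℕ) (z : State m n) : ℝ :=
  Real.sqrt (∑ i, (z.res i - z.w.rho) ^ 2 / (z.res i ^ k * z.w.rho ^ (2 - k)))

/-- `δ(z) = χ₁(z)² / χ₂(z)`, and `δ(z) = 0` if `χ₂(z) = 0`. -/
def State.delta {m n : ℕ} (z : State m n) : ℝ :=
  if z.chi 2 = 0 then 0 else z.chi 1 ^ 2 / z.chi 2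

/-- `σ(u) = min_i x_i s_i`. -/
def Point.sigma {m n : ℕ} (u : Point m n) : ℝ := ⨅ i, u.x i * u.s i

/-- The initial control variable `w_*(u)`. -/
def Point.startControl {m n : ℕ} (u : Point m n) : Control n :=
  ⟨u.s ⬝ᵥ u.x + u.sigma, fun i => Real.sqrt (u.x i * u.s i - u.sigma)⟩

/-- `ω_*(τ) = -τ - ln (1 - τ)`. -/
def omegaStar (t : ℝ) : ℝ := -t - Real.log (1 - t)

/-- `β = r / (2 + r)`. -/
def betaOf (r : ℝ) : ℝ := r / (2 + r)

/-! ### Directions -/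

/-- `D` is the universal tangent direction at `u` with right-hand side `d`:
`X Δˢ + S Δˣ = d`, `A Δˣ = 0`, `Δˢ + Aᵀ Δʸ = 0`. -/
def LP.IsTangent {m n : ℕ} (P : LP m n) (u : Point m n) (d : Fin n → ℝ) (D : Point m n) : Prop :=
  u.x * D.s + u.s * D.x = d ∧ P.A *ᵥ D.x = 0 ∧ D.s + P.Aᵀ *ᵥ D.y = 0

/-- Right-hand side of the predictor of TPTFM: `(‖v‖²/(n+1) - ρ(w)) e - 2 v²`. -/
def State.rhsTangential {m n : ℕ} (z : State m n) : Fin n → ℝ :=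
  fun i => (z.w.sq / (n + 1) - z.w.rho) - 2 * z.w.v i ^ 2

/-- Auto-correcting right-hand side (ACPTFM, PTFM2): `‖v‖²/(n+1) e - v² - x s`. -/
def State.rhsAuto {m n : ℕ} (z : State m n) : Fin n → ℝ :=
  fun i => z.w.sq / (n + 1) - z.w.v i ^ 2 - z.u.x i * z.u.s i

/-- Second-order right-hand side (PTFM2): `v² - ‖v‖²/(n+1) e - Δ̃ˣ Δ̃ˢ`. -/
def State.rhsSecond {m n : ℕ} (z : State m n) (D : Point m n) : Fin n → ℝ :=
  fun i => z.w.v i ^ 2 - z.w.sq / (n + 1) - D.x i * D.s i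

/-- Right-hand side of the corrector: `ρ(w) e - ř(z)`. -/
def State.rhsCorrector {m n : ℕ} (z : State m n) : Fin n → ℝ :=
  fun i => z.w.rho - (z.u.x i * z.u.s i - z.w.v i ^ 2)

/-! ### The three methods -/

inductive Method
  | TPTFM
  | ACPTFM
  | PTFM2

/-- Parameters of the methods. `r` is the parameter chosen at initialization; `betaLow` is a lower
bound for the acceptance levels of TPTFM; `eta` is the relative accuracy with which the equation
`ψ(α) = ω_*(r)` is solved at predictor steps (`0`: exactly); `theta` is the fraction of the largest
possible decrease of the barrier that the line search of a corrector step has to attain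
(`1`: exact minimization). -/
structure Params where
  r : ℝ
  betaLow : ℝ
  eta : ℝ
  theta : ℝ

/-- Admissible acceptance levels: `β_k ∈ [betaLow, β]` for TPTFM, and `β_k = β` for the others. -/
def Method.Accept (M : Method) (p : Params) (βk : ℝ) : Prop :=
  match M with
  | .TPTFM => p.betaLow ≤ βk ∧ βk ≤ betaOf p.r
  | .ACPTFM => βk = betaOf p.r
  | .PTFM2 => βk = betaOf p.r

/-- `path` is the search curve `α ↦ z(α)` of the predictor step at `z`. -/
def Method.IsPredictorPath {m n : ℕ} (M : Method) (P : LP m n) (z : State m n)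
    (path : ℝ → State m n) : Prop :=
  match M with
  | .TPTFM => ∃ D, P.IsTangent z.u z.rhsTangential D ∧
      ∀ α, path α = ⟨z.u.move α D, z.w.scale (1 - α)⟩
  | .ACPTFM => ∃ D, P.IsTangent z.u z.rhsAuto D ∧
      ∀ α, path α = ⟨z.u.move α D, z.w.scale (1 - α)⟩
  | .PTFM2 => ∃ D E, P.IsTangent z.u z.rhsAuto D ∧ P.IsTangent z.u (z.rhsSecond D) E ∧
      ∀ α, path α = ⟨(z.u.move α D).move (α ^ 2) E, z.w.scale (1 - α)⟩

/-- `α ∈ (0,1)` is an approximate solution of `Ψ(path α) = ω_*(r)`. -/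
def LP.ApproxRoot {m n : ℕ} (P : LP m n) (p : Params) (path : ℝ → State m n) (α : ℝ) : Prop :=
  0 < α ∧ α < 1 ∧ P.Interior (path α) ∧
    |P.Psi (path α) - omegaStar p.r| ≤ p.eta * omegaStar p.r

/-- `path` is the search ray `α ↦ (u + α Δ, w)` of the corrector step at `z`. -/
def LP.IsCorrectorPath {m n : ℕ} (P : LP m n) (z : State m n) (path : ℝ → State m n) : Prop :=
  ∃ D, P.IsTangent z.u z.rhsCorrector D ∧ ∀ α, path α = ⟨z.u.move α D, z.w⟩

/-- `α ≥ 0` is an approximate minimizer of the barrier along `path`. -/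
def LP.ApproxMin {m n : ℕ} (P : LP m n) (p : Params) (path : ℝ → State m n) (α : ℝ) : Prop :=
  0 ≤ α ∧ P.Interior (path α) ∧
    ∀ α', 0 ≤ α' → P.Interior (path α') →
      p.theta * (P.barrier (path 0) - P.barrier (path α'))
        ≤ P.barrier (path 0) - P.barrier (path α)

/-! ### The termination test -/

/-- The three indicator vectors `x`, `s⁻¹`, `x s⁻¹`. -/
inductive Indicator
  | primal
  | dual
  | primalDual

def Indicator.vec {m n : ℕ} (a : Indicator) (u : Point m n) : Fin n → ℝ :=
  match a with
  | .primal => u.x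
  | .dual => fun i => (u.s i)⁻¹
  | .primalDual => fun i => u.x i * (u.s i)⁻¹

/-- `τ` lists the components of `a` in decreasing order. -/
def IsDecreasingOrder {n : ℕ} (a : Fin n → ℝ) (τ : Equiv.Perm (Fin n)) : Prop :=
  Antitone fun i => a (τ i)

/-- The square matrix `A_B` of the trial basis `B = {τ 1, …, τ m}`. -/
def LP.basisMatrix {m n : ℕ} (P : LP m n) (hmn : m ≤ n) (τ : Equiv.Perm (Fin n)) :
    Matrix (Fin m) (Fin m) ℝ :=
  P.A.submatrix id fun i => τ (Fin.castLE hmn i)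

/-- `y = A_B^{-T} c_B`. -/
def LP.candY {m n : ℕ} (P : LP m n) (hmn : m ≤ n) (τ : Equiv.Perm (Fin n)) : Fin m → ℝ :=
  (P.basisMatrix hmn τ)ᵀ⁻¹ *ᵥ fun i => P.c (τ (Fin.castLE hmn i))

/-- The candidate: `x_B = A_B^{-1} b`, `x_N = 0`, `s_B = 0`, `s_N = c_N - A_Nᵀ y`. -/
def LP.candidate {m n : ℕ} (P : LP m n) (hmn : m ≤ n) (τ : Equiv.Perm (Fin n)) : Point m n where
  x := fun j =>
    if h : (τ.symm j : ℕ) < m then ((P.basisMatrix hmn τ)⁻¹ *ᵥ P.b) ⟨τ.symm j, h⟩ else 0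
  s := fun j =>
    if (τ.symm j : ℕ) < m then 0 else P.c j - (P.Aᵀ *ᵥ P.candY hmn τ) j
  y := P.candY hmn τ

/-- The test is successful: `A_B` is non-degenerate and the candidate is non-negative. -/
def LP.TestSucceeds {m n : ℕ} (P : LP m n) (hmn : m ≤ n) (τ : Equiv.Perm (Fin n)) : Prop :=
  IsUnit (P.basisMatrix hmn τ).det ∧
    (∀ j, 0 ≤ (P.candidate hmn τ).x j) ∧ (∀ j, 0 ≤ (P.candidate hmn τ).s j)

/-! ### The methods equipped with the termination test -/

/-- Configurations: still running at the iterate `z`, or stopped with output `u`. -/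
inductive Config (m n : ℕ)
  | running (z : State m n)
  | done (u : Point m n)

/-- One predictor or corrector iteration at `z`. -/
inductive Iterate {m n : ℕ} (M : Method) (p : Params) (P : LP m n) (z : State m n) :
    Config m n → Prop
  /-- Predictor step. -/
  | predictor (βk : ℝ) (path : ℝ → State m n) (α : ℝ) :
      M.Accept p βk → z.delta ≤ βk → M.IsPredictorPath P z path → P.ApproxRoot p path α →
      Iterate M p P z (.running (path α))
  /-- If the equation of the predictor step has no (approximate) root in `(0,1)`, the full step
  `α = 1` is made, where `w = 0`, and its end point is returned. -/
  | fullStep (βk : ℝ) (path : ℝ → State m n) :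
      M.Accept p βk → z.delta ≤ βk → M.IsPredictorPath P z path →
      (∀ α, ¬ P.ApproxRoot p path α) →
      Iterate M p P z (.done (path 1).u)
  /-- Corrector step. -/
  | corrector (βk : ℝ) (path : ℝ → State m n) (α : ℝ) :
      M.Accept p βk → ¬ z.delta ≤ βk → P.IsCorrectorPath z path → P.ApproxMin p path α →
      Iterate M p P z (.running (path α))

/-- One iteration of the method equipped with the termination test with indicator `a`:
first the test is run (for some decreasing ordering of the indicator vector); if it is successful,
the method stops and returns the candidate, otherwise it makes its predictor or corrector step. -/
inductive Step {m n : ℕ} (M : Method) (p : Params) (a : Indicator) (P : LP m n) (hmn : m ≤ n) :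
    Config m n → Config m n → Prop
  | terminate (z : State m n) (τ : Equiv.Perm (Fin n)) :
      IsDecreasingOrder (a.vec z.u) τ → P.TestSucceeds hmn τ →
      Step M p a P hmn (.running z) (.done (P.candidate hmn τ))
  | proceed (z : State m n) (τ : Equiv.Perm (Fin n)) (κ : Config m n) :
      IsDecreasingOrder (a.vec z.u) τ → ¬ P.TestSucceeds hmn τ → Iterate M p P z κ →
      Step M p a P hmn (.running z) κ
  | idle (u : Point m n) : Step M p a P hmn (.done u) (.done u)

/-- The initial configuration `z₀ = (u₀, w_*(u₀))`. -/
def initial {m n : ℕ} (u0 : Point m n) : Config m n := .running ⟨u0, u0.startControl⟩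

end

end PTF

namespace PTF

/-! ### Elementary estimates for the logarithm -/

/-! The `n + 1` residuals have mean `ρ(w)`, so the normalized residuals `t i = r i / ρ` have mean 1
and `Ψ = -∑ ln (t i) = ∑ (t i - 1 - ln (t i))` is a sum of nonnegative terms. A bound `Ψ ≤ K`
therefore confines every `t i` to an interval that does not depend on the dimension, and controls
`χ₁` and `χ₂` as well. All estimates below rest on this.

Two rates follow (`exists_rates`). If `δ` exceeds the acceptance level, a damped Newton step of
fixed length along the corrector ray lowers `Ψ` by a constant `d`; an approximate line search
achieves a fixed fraction of that (`psi_decrease`, `LP.Interior.corrector_step`). If `δ ≤ β`, then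
`Ψ ≤ r²/6`, while an accepted predictor root has `Ψ ≥ ω_*(r)/2 ≥ r²/4`. Steps with `α v⁰ ≤ c √(n+1)
ρ` raise `Ψ` by at most `r²/24` (`exists_short_step_const`), so the accepted step is longer than
that. Under `w ↦ (1-α) w` such a step raises the potential `ln (ρ / (v⁰)²)` by at least `c / (2
√(n+1))` (`Control.progress_scale`); correctors leave `w` alone. Since fewer than a constant number
of correctors can be paid for by one rise of `Ψ`, a single potential counts both kinds of steps
(`Invariant`).

The same quantity decides the termination test. At an iterate the gap is below `v⁰` and `x i * s i ≥
κ ρ`; by orthogonality of feasible differences, `(v⁰)² < κ ρ x*_min s*_min` forces every indicator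
to rank the support of `x*` first (`LP.UniqueSolution.separation`). Uniqueness makes this support a
nonsingular basis of size `m`, whose candidate is `u*`. So while the method runs, `ln (ρ / (v⁰)²)`
is bounded above; its initial value is `ln (σ₀ / (⟨s₀,x₀⟩ + σ₀)²)`, and the difference gives the
stated logarithm.

Exactness of the output is separate from the count: a successful test yields a complementary
feasible pair, and a predictor without a root stays interior up to `α = 1`, where `v⁰ = 0` closes
the gap. Both are optimal, hence equal to `u*`. The steps exist because uniqueness of `y*` makes
`Aᵀ` injective and because the barrier attains its minimum on the corrector ray. -/

theorem sq_sqrt_sub_one_le {t : ℝ} (ht : 0 < t) :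
    (Real.sqrt t - 1) ^ 2 ≤ t - 1 - Real.log t := by
  have h1 : Real.log (Real.sqrt t) ≤ Real.sqrt t - 1 :=
    Real.log_le_sub_one_of_pos (Real.sqrt_pos.2 ht)
  rw [Real.log_sqrt ht.le] at h1
  nlinarith [Real.sq_sqrt ht.le]

theorem sub_one_sub_log_nonneg {t : ℝ} (ht : 0 < t) : 0 ≤ t - 1 - Real.log t :=
  (sq_nonneg _).trans (sq_sqrt_sub_one_le ht)

/-- With `t = u²` the left side factors as `((1 + u) / u²)² (u - 1)²`; the first factor is bounded
by means of `κ`, the second by `sq_sqrt_sub_one_le`. Summed over the residuals, this controls `χ₂`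
by `Ψ`. -/
theorem sq_one_sub_div_le {t κ : ℝ} (hκ : 0 < κ) (hκ1 : κ ≤ 1) (ht : κ ≤ t) :
    ((1 - t) / t) ^ 2 ≤ 4 / κ ^ 2 * (t - 1 - Real.log t) := by
  have ht0 : 0 < t := hκ.trans_le ht
  refine le_trans ?_ (mul_le_mul_of_nonneg_left (sq_sqrt_sub_one_le ht0) (by positivity))
  obtain ⟨u, hu, rfl⟩ : ∃ u : ℝ, 0 < u ∧ t = u ^ 2 :=
    ⟨Real.sqrt t, Real.sqrt_pos.2 ht0, (Real.sq_sqrt ht0.le).symm⟩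
  rw [Real.sqrt_sq hu.le]
  have hκu : κ ≤ u := by
    by_contra! h
    nlinarith
  have h2 : κ * (1 + u) ≤ 2 * u ^ 2 := by nlinarith
  have h3 : (1 + u) / u ^ 2 ≤ 2 / κ := by
    rw [div_le_div_iff₀ (by positivity) hκ]
    linarith
  have h4 : ((1 + u) / u ^ 2) ^ 2 ≤ (2 / κ) ^ 2 := pow_le_pow_left₀ (by positivity) h3 2
  calc ((1 - u ^ 2) / u ^ 2) ^ 2 = ((1 + u) / u ^ 2) ^ 2 * (u - 1) ^ 2 := by
        field_simp; ring
    _ ≤ (2 / κ) ^ 2 * (u - 1) ^ 2 := mul_le_mul_of_nonneg_right h4 (sq_nonneg _)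
    _ = _ := by rw [div_pow]; norm_num

theorem half_sq_le_omegaStar {r : ℝ} (h0 : 0 ≤ r) (h1 : r < 1) : r ^ 2 / 2 ≤ omegaStar r := by
  have h := Real.hasSum_pow_div_log_of_abs_lt_one (x := r) (by rwa [abs_of_nonneg h0])
  have h2 := sum_le_hasSum (Finset.range 2) (fun i _ => by positivity) h
  simp only [Finset.sum_range_succ, Finset.sum_range_zero] at h2
  norm_num at h2
  unfold omegaStar
  linarith

theorem log_le_half_sub_inv {u : ℝ} (hu : 1 ≤ u) : Real.log u ≤ (u - u⁻¹) / 2 := by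
  have h := Real.self_le_sinh_iff.2 (Real.log_nonneg hu)
  rwa [Real.sinh_log (by linarith)] at h

/-- For `a ≥ 0` this is `ln u ≤ sinh (ln u)`, for `a < 0` the first two terms of the logarithmic
series. The denominator is uniform in `a`, so that the bound can be summed over components. -/
theorem log_one_add_le {a N : ℝ} (ha : -1 < a) (hN : 0 ≤ N) (haN : a ≤ N) :
    Real.log (1 + a) ≤ a - a ^ 2 / (2 * (1 + N)) := by
  rcases le_or_gt 0 a with h | h
  · have h1 := log_le_half_sub_inv (u := 1 + a) (by linarith)
    have h2 : ((1 + a) - (1 + a)⁻¹) / 2 = a - a ^ 2 / (2 * (1 + a)) := by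
      field_simp; ring
    have h3 : a ^ 2 / (2 * (1 + N)) ≤ a ^ 2 / (2 * (1 + a)) := by gcongr
    linarith
  · have h1 := half_sq_le_omegaStar (r := -a) (by linarith) (by linarith)
    unfold omegaStar at h1
    rw [sub_neg_eq_add] at h1
    have h3 : a ^ 2 / (2 * (1 + N)) ≤ a ^ 2 / 2 := by gcongr; linarith
    nlinarith

theorem sub_two_sq_le_log {y : ℝ} (hy : -(1 / 2) ≤ y) : y - 2 * y ^ 2 ≤ Real.log (1 + y) := by
  have h0 : 0 < 1 + y := by linarith
  refine le_trans ?_ (Real.one_sub_inv_le_log_of_pos h0)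
  have : 1 - (1 + y)⁻¹ = y - y ^ 2 / (1 + y) := by field_simp; ring
  rw [this]
  have : y ^ 2 / (1 + y) ≤ 2 * y ^ 2 := by
    rw [div_le_iff₀ h0]
    nlinarith [sq_nonneg y]
  linarith

/-! ### The functional proximity measure in normalized residuals -/

/-- The logarithmic barrier of a vector of positive numbers. -/
noncomputable def psi {ι : Type*} [Fintype ι] (t : ι → ℝ) : ℝ := -∑ i, Real.log (t i)

section Normalized

variable {ι : Type*} [Fintype ι] {t : ι → ℝ}

theorem psi_eq_sum (hs : ∑ i, (t i - 1) = 0) : psi t = ∑ i, (t i - 1 - Real.log (t i)) := by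
  rw [Finset.sum_sub_distrib, hs, psi, zero_sub]

theorem le_psi (ht : ∀ i, 0 < t i) (hs : ∑ i, (t i - 1) = 0) (i : ι) :
    t i - 1 - Real.log (t i) ≤ psi t := by
  rw [psi_eq_sum hs]
  exact Finset.single_le_sum (f := fun i => t i - 1 - Real.log (t i))
    (fun j _ => sub_one_sub_log_nonneg (ht j)) (Finset.mem_univ i)

theorem psi_nonneg (ht : ∀ i, 0 < t i) (hs : ∑ i, (t i - 1) = 0) : 0 ≤ psi t := by
  rw [psi_eq_sum hs]
  exact Finset.sum_nonneg fun j _ => sub_one_sub_log_nonneg (ht j)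

theorem exp_le_of_psi_le {K : ℝ} (ht : ∀ i, 0 < t i) (hs : ∑ i, (t i - 1) = 0)
    (hK : psi t ≤ K) (i : ι) : Real.exp (-(K + 1)) ≤ t i := by
  rw [← Real.le_log_iff_exp_le (ht i)]
  linarith [le_psi ht hs i, ht i]

/-- Applying `ln z ≤ z - 1` at `z = t/2` leaves half of the linear growth of `t - 1 - ln t`. -/
theorem le_of_psi_le {K : ℝ} (ht : ∀ i, 0 < t i) (hs : ∑ i, (t i - 1) = 0)
    (hK : psi t ≤ K) (i : ι) : t i ≤ 2 * (K + 1) := by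
  have h1 := Real.log_le_sub_one_of_pos (half_pos (ht i))
  rw [Real.log_div (ht i).ne' two_ne_zero] at h1
  have h2 := Real.log_two_lt_d9
  linarith [le_psi ht hs i]

theorem sum_sq_one_sub_div_le {κ : ℝ} (hκ : 0 < κ) (hκ1 : κ ≤ 1) (ht : ∀ i, κ ≤ t i)
    (hs : ∑ i, (t i - 1) = 0) : ∑ i, ((1 - t i) / t i) ^ 2 ≤ 4 / κ ^ 2 * psi t := by
  rw [psi_eq_sum hs, Finset.mul_sum]
  exact Finset.sum_le_sum fun i _ => sq_one_sub_div_le hκ hκ1 (ht i)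

/-- Termwise the two sides differ by `1 - t i`, which sums to zero. Thus the directional derivative
of the barrier along the Newton direction is `-χ₁²`. -/
theorem sum_one_sub_div (ht : ∀ i, 0 < t i) (hs : ∑ i, (t i - 1) = 0) :
    ∑ i, (1 - t i) / t i = ∑ i, (1 - t i) ^ 2 / t i := by
  rw [← add_zero (∑ i, (1 - t i) / t i), ← hs, ← Finset.sum_add_distrib]
  refine Finset.sum_congr rfl fun i _ => ?_
  have := (ht i).ne'
  field_simp
  ring

theorem abs_le_sqrt_sum_sq (a : ι → ℝ) (i : ι) : |a i| ≤ Real.sqrt (∑ j, a j ^ 2) := by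
  rw [← Real.sqrt_sq_eq_abs]
  exact Real.sqrt_le_sqrt (Finset.single_le_sum (f := fun j => a j ^ 2)
    (fun j _ => sq_nonneg _) (Finset.mem_univ i))

/-- A small Newton decrement forces a small value of the barrier. -/
theorem psi_le_of_decrement {β : ℝ} (hβ1 : β < 1 / 2) (ht : ∀ i, 0 < t i)
    (hs : ∑ i, (t i - 1) = 0)
    (h : ∑ i, (1 - t i) ^ 2 / t i ≤ β * Real.sqrt (∑ i, ((1 - t i) / t i) ^ 2)) :
    psi t ≤ β ^ 2 / (2 * (1 - 2 * β)) := by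
  set N := Real.sqrt (∑ i, ((1 - t i) / t i) ^ 2) with hN
  have hN0 : 0 ≤ N := Real.sqrt_nonneg _
  have hN2 : N ^ 2 = ∑ i, ((1 - t i) / t i) ^ 2 :=
    Real.sq_sqrt (Finset.sum_nonneg fun _ _ => sq_nonneg _)
  -- Here `-ln (t i) = ln (1 + a i)` with `a i = (1 - t i) / t i`, and `N = χ₂` dominates every `a
  -- i`.
  have h1 : psi t ≤ ∑ i, ((1 - t i) / t i - ((1 - t i) / t i) ^ 2 / (2 * (1 + N))) := by
    rw [psi, ← Finset.sum_neg_distrib]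
    refine Finset.sum_le_sum fun i _ => ?_
    have e : 1 + (1 - t i) / t i = (t i)⁻¹ := by
      have := (ht i).ne'
      field_simp; ring
    have hpos : 0 < (t i)⁻¹ := inv_pos.2 (ht i)
    have := log_one_add_le (a := (1 - t i) / t i) (N := N) (by linarith) hN0
      ((le_abs_self _).trans (abs_le_sqrt_sum_sq (fun i => (1 - t i) / t i) i))
    rwa [e, Real.log_inv] at this
  rw [Finset.sum_sub_distrib, ← Finset.sum_div, ← hN2, sum_one_sub_div ht hs] at h1
  -- Nothing is known about `N`, so the bound has to hold for all `N ≥ 0`; the difference of the two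
  -- sides is a manifestly nonnegative fraction.
  have h2 : β * N - N ^ 2 / (2 * (1 + N)) ≤ β ^ 2 / (2 * (1 - 2 * β)) := by
    obtain ⟨c, hc⟩ : ∃ c, c = 1 - 2 * β := ⟨_, rfl⟩
    have hb : 0 < c := by linarith
    rw [← hc, ← sub_nonneg]
    have : β ^ 2 / (2 * c) - (β * N - N ^ 2 / (2 * (1 + N)))
        = ((β - N * c) ^ 2 + β ^ 2 * N) / (2 * c * (1 + N)) := by
      field_simp
      rw [hc]
      ring
    rw [this]
    positivity
  linarith

/-- Both vectors have mean 1, so the gradient `-1/t` may be shifted by a constant to `-(1 - t)/t`.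
Its norm is then at most `X`, and Cauchy–Schwarz gives a first-order change free of the dimension.
-/
theorem psi_le_add_of_close {t' : ι → ℝ} {κ ε X : ℝ} (hκ : 0 < κ) (ht : ∀ i, κ ≤ t i)
    (hs : ∑ i, (t i - 1) = 0) (hs' : ∑ i, (t' i - 1) = 0)
    (hX : ∑ i, ((1 - t i) / t i) ^ 2 ≤ X ^ 2) (hX0 : 0 ≤ X) (hε0 : 0 ≤ ε) (hε : 2 * ε ≤ κ)
    (hd : ∑ i, (t' i - t i) ^ 2 ≤ ε ^ 2) :
    psi t' ≤ psi t + (ε * X + 2 * ε ^ 2 / κ ^ 2) := by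
  have ht0 : ∀ i, 0 < t i := fun i => hκ.trans_le (ht i)
  have hy : ∀ i, |t' i - t i| ≤ ε := fun i =>
    (abs_le_sqrt_sum_sq (fun i => t' i - t i) i).trans (Real.sqrt_le_iff.2 ⟨hε0, hd⟩)
  have hle : ∀ i, Real.log (t i) + ((t' i - t i) / t i - 2 * ((t' i - t i) / t i) ^ 2)
      ≤ Real.log (t' i) := by
    intro i
    have h1 : -(1 / 2) ≤ (t' i - t i) / t i := by
      rw [le_div_iff₀ (ht0 i)]
      linarith [neg_abs_le (t' i - t i), hy i, ht i]
    have h2 := sub_two_sq_le_log h1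
    have e : t' i = t i * (1 + (t' i - t i) / t i) := by
      have := (ht0 i).ne'
      field_simp; ring
    conv_rhs => rw [e, Real.log_mul (ht0 i).ne' (by linarith)]
    linarith
  have hsum := Finset.sum_le_sum fun i (_ : i ∈ Finset.univ) => hle i
  rw [Finset.sum_add_distrib, Finset.sum_sub_distrib] at hsum
  have hlin : -∑ i, (t' i - t i) / t i ≤ ε * X := by
    have e : -∑ i, (t' i - t i) / t i = ∑ i, (t i - t' i) * ((1 - t i) / t i) := by
      have h0 : ∑ i, (t i - t' i) = 0 := by
        have : ∑ i, (t i - t' i) = ∑ i, (t i - 1) - ∑ i, (t' i - 1) := by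
          rw [← Finset.sum_sub_distrib]
          exact Finset.sum_congr rfl fun i _ => by ring
        rw [this, hs, hs', sub_zero]
      rw [← sub_zero (-∑ i, (t' i - t i) / t i), ← h0, ← Finset.sum_neg_distrib,
        ← Finset.sum_sub_distrib]
      refine Finset.sum_congr rfl fun i _ => ?_
      have := (ht0 i).ne'
      field_simp; ring
    rw [e]
    have hcs := Finset.sum_mul_sq_le_sq_mul_sq Finset.univ (fun i => t i - t' i)
      (fun i => (1 - t i) / t i)
    refine abs_le_of_sq_le_sq' (hcs.trans ?_) (by positivity) |>.2
    rw [mul_pow]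
    refine mul_le_mul ?_ hX (Finset.sum_nonneg fun _ _ => sq_nonneg _) (sq_nonneg _)
    refine le_trans (le_of_eq (Finset.sum_congr rfl fun i _ => ?_)) hd
    ring
  have hquad : ∑ i, 2 * ((t' i - t i) / t i) ^ 2 ≤ 2 * ε ^ 2 / κ ^ 2 := by
    rw [← Finset.mul_sum, mul_div_assoc]
    refine mul_le_mul_of_nonneg_left ?_ zero_le_two
    calc ∑ i, ((t' i - t i) / t i) ^ 2 ≤ ∑ i, (t' i - t i) ^ 2 / κ ^ 2 := by
          refine Finset.sum_le_sum fun i _ => ?_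
          rw [div_pow]
          have := ht i
          gcongr
      _ ≤ _ := by rw [← Finset.sum_div]; gcongr
  unfold psi
  linarith

/-- The damped Newton step towards the center decreases the barrier, even in the presence
of a second-order perturbation `α² p`. -/
theorem psi_decrease {p : ι → ℝ} {κ α : ℝ} (hκ : 0 < κ) (ht : ∀ i, κ ≤ t i)
    (hs : ∑ i, (t i - 1) = 0) (hp : ∑ i, |p i| ≤ ∑ i, (1 - t i) ^ 2 / t i)
    (hα : 0 ≤ α) (hα1 : 12 * α ≤ κ) (hα2 : 16 * (α ^ 2 * ∑ i, ((1 - t i) / t i) ^ 2) ≤ 1)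
    (hα3 : 4 * (α ^ 2 * ∑ i, (1 - t i) ^ 2 / t i) ≤ κ) :
    (∀ i, 0 < t i + α * (1 - t i) + α ^ 2 * p i) ∧
      α / 2 * ∑ i, (1 - t i) ^ 2 / t i
        ≤ psi t - psi (fun i => t i + α * (1 - t i) + α ^ 2 * p i) := by
  have ht0 : ∀ i, 0 < t i := fun i => hκ.trans_le (ht i)
  set A := ∑ i, (1 - t i) ^ 2 / t i with hA
  set A2 := ∑ i, ((1 - t i) / t i) ^ 2 with hA2
  have hA0 : 0 ≤ A := Finset.sum_nonneg fun i _ => div_nonneg (sq_nonneg _) (ht0 i).le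
  have hA2A : A2 ≤ A / κ := by
    rw [hA, Finset.sum_div]
    refine Finset.sum_le_sum fun i _ => ?_
    rw [div_pow, div_div, sq (t i)]
    have := ht i
    have := ht0 i
    gcongr
  have hq : ∑ i, |p i / t i| ≤ A / κ := by
    refine le_trans ?_ (div_le_div_of_nonneg_right hp hκ.le)
    rw [Finset.sum_div]
    refine Finset.sum_le_sum fun i _ => ?_
    rw [abs_div, abs_of_pos (ht0 i)]
    have := ht i
    gcongr
  have hqi : ∀ i, |p i / t i| ≤ A / κ := fun i =>
    (Finset.single_le_sum (f := fun i => |p i / t i|) (fun _ _ => abs_nonneg _)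
      (Finset.mem_univ i)).trans hq
  have hAκ : α ^ 2 * (A / κ) ≤ 1 / 4 := by
    rw [← mul_div_assoc, div_le_iff₀ hκ]; linarith
  set y : ι → ℝ := fun i => α * ((1 - t i) / t i) + α ^ 2 * (p i / t i) with hy
  -- The bounds `hα2` and `hα3` each keep one summand of `y i` below `1/4` in absolute value.
  have hyl : ∀ i, -(1 / 2) ≤ y i := by
    intro i
    have h1 : |α * ((1 - t i) / t i)| ≤ 1 / 4 := by
      apply abs_le_of_sq_le_sq _ (by norm_num)
      have : ((1 - t i) / t i) ^ 2 ≤ A2 := Finset.single_le_sum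
        (f := fun i => ((1 - t i) / t i) ^ 2) (fun _ _ => sq_nonneg _) (Finset.mem_univ i)
      rw [mul_pow]
      nlinarith [mul_le_mul_of_nonneg_left this (sq_nonneg α)]
    have h2 : |α ^ 2 * (p i / t i)| ≤ 1 / 4 := by
      rw [abs_mul, abs_of_nonneg (sq_nonneg α)]
      exact (mul_le_mul_of_nonneg_left (hqi i) (sq_nonneg α)).trans hAκ
    have := neg_abs_le (α * ((1 - t i) / t i))
    have := neg_abs_le (α ^ 2 * (p i / t i))
    simp only [hy]
    linarith
  have he : ∀ i, t i + α * (1 - t i) + α ^ 2 * p i = t i * (1 + y i) := by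
    intro i
    have := (ht0 i).ne'
    simp only [hy]
    field_simp; ring
  refine ⟨fun i => ?_, ?_⟩
  · rw [he i]
    exact mul_pos (ht0 i) (by linarith [hyl i])
  have hle : ∑ i, (y i - 2 * y i ^ 2)
      ≤ psi t - psi (fun i => t i + α * (1 - t i) + α ^ 2 * p i) := by
    unfold psi
    rw [sub_neg_eq_add, neg_add_eq_sub, ← Finset.sum_sub_distrib]
    refine Finset.sum_le_sum fun i _ => ?_
    beta_reduce
    rw [he i, Real.log_mul (ht0 i).ne' (by linarith [hyl i])]
    linarith [sub_two_sq_le_log (hyl i)]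
  have hlin : α * A - α ^ 2 * (A / κ) ≤ ∑ i, y i := by
    simp only [hy]
    rw [Finset.sum_add_distrib, ← Finset.mul_sum, ← Finset.mul_sum, sum_one_sub_div ht0 hs]
    have := (abs_le.1 ((Finset.abs_sum_le_sum_abs (fun i => p i / t i) Finset.univ).trans hq)).1
    nlinarith [mul_le_mul_of_nonneg_left this (sq_nonneg α)]
  have hsq : ∑ i, 2 * y i ^ 2 ≤ 5 * (α ^ 2 * (A / κ)) := by
    have h1 : ∑ i, 2 * y i ^ 2 ≤ ∑ i, (4 * α ^ 2 * ((1 - t i) / t i) ^ 2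
        + 4 * α ^ 4 * ((A / κ) * |p i / t i|)) := by
      refine Finset.sum_le_sum fun i _ => ?_
      have h2 : (p i / t i) ^ 2 ≤ (A / κ) * |p i / t i| := by
        rw [← sq_abs, sq]
        exact mul_le_mul_of_nonneg_right (hqi i) (abs_nonneg _)
      have h3 := mul_le_mul_of_nonneg_left h2 (by positivity : 0 ≤ 4 * α ^ 4)
      simp only [hy]
      nlinarith [sq_nonneg (α * ((1 - t i) / t i) - α ^ 2 * (p i / t i))]
    rw [Finset.sum_add_distrib] at h1
    simp only [← Finset.mul_sum] at h1 ⊢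
    have h4 : 4 * α ^ 2 * A2 ≤ 4 * α ^ 2 * (A / κ) := by gcongr
    have h5 : 4 * α ^ 4 * (A / κ * ∑ i, |p i / t i|) ≤ 4 * α ^ 4 * (A / κ * (A / κ)) := by gcongr
    have h6 : 4 * α ^ 4 * (A / κ * (A / κ)) = 4 * (α ^ 2 * (A / κ)) * (α ^ 2 * (A / κ)) := by ring
    have h7 : 0 ≤ α ^ 2 * (A / κ) := by positivity
    nlinarith
  rw [Finset.sum_sub_distrib] at hle
  -- One unit of `α² A / κ` is lost in the linear term and five in the quadratic one; `12 α ≤ κ`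
  -- makes their sum at most half of the gain `α A`.
  have h8 : 6 * (α ^ 2 * (A / κ)) ≤ α / 2 * A := by
    have : 6 * (α ^ 2 * (A / κ)) = α * A * (6 * α / κ) := by ring
    rw [this]
    have : 6 * α / κ ≤ 1 / 2 := by rw [div_le_iff₀ hκ]; linarith
    nlinarith [mul_nonneg hα hA0]
  linarith

/-- Converts the test `δ > b` into a lower bound for `χ₁²`, the guaranteed gain of a corrector: from
`b χ₂ < χ₁²` and `χ₁² ≤ T χ₂²` the unknown `χ₂` is eliminated. -/
theorem sq_div_le_of_lt_decrement {b T : ℝ} (hb : 0 < b) (hT : 0 < T) (ht : ∀ i, 0 < t i)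
    (htT : ∀ i, t i ≤ T)
    (h : b * Real.sqrt (∑ i, ((1 - t i) / t i) ^ 2) < ∑ i, (1 - t i) ^ 2 / t i) :
    b ^ 2 / T ≤ ∑ i, (1 - t i) ^ 2 / t i := by
  set A := ∑ i, (1 - t i) ^ 2 / t i with hA
  set A2 := ∑ i, ((1 - t i) / t i) ^ 2 with hA2
  have hA20 : 0 ≤ A2 := Finset.sum_nonneg fun _ _ => sq_nonneg _
  have h1 : A ≤ T * A2 := by
    rw [hA, hA2, Finset.mul_sum]
    refine Finset.sum_le_sum fun i _ => ?_
    have : (1 - t i) ^ 2 / t i = t i * ((1 - t i) / t i) ^ 2 := by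
      have := (ht i).ne'
      field_simp
    rw [this]
    exact mul_le_mul_of_nonneg_right (htT i) (sq_nonneg _)
  have hs := Real.sqrt_nonneg A2
  have hA0 : 0 < A := lt_of_le_of_lt (by positivity) h
  have h2 : b ^ 2 * A2 ≤ A ^ 2 := by
    rw [← Real.sq_sqrt hA20, ← mul_pow]
    exact pow_le_pow_left₀ (by positivity) h.le 2
  rw [div_le_iff₀ hT]
  have h3 : b ^ 2 * A ≤ T * A ^ 2 := by nlinarith [sq_nonneg b]
  nlinarith

end Normalized

variable {m n : ℕ} {P : LP m n}

/-! ### Residuals and proximity measures -/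

theorem Control.rho_pos {w : Control n} (hw : w.InTarget) : 0 < w.rho :=
  div_pos (sub_pos.2 hw.2) (by positivity)

theorem Control.sq_nonneg (w : Control n) : 0 ≤ w.sq :=
  Finset.sum_nonneg fun _ _ => _root_.sq_nonneg _

theorem Control.v0_eq (w : Control n) : w.v0 = (n + 1) * w.rho + w.sq := by
  have : (n + 1 : ℝ) ≠ 0 := by positivity
  unfold Control.rho
  field_simp
  ring

theorem dotProduct_comm_sum (x s : Fin n → ℝ) : s ⬝ᵥ x = ∑ i, x i * s i :=
  Finset.sum_congr rfl fun _ _ => mul_comm _ _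

theorem LP.gap_eq {u : Point m n} (hx : P.A *ᵥ u.x = P.b) (hs : u.s + P.Aᵀ *ᵥ u.y = P.c) :
    P.c ⬝ᵥ u.x - P.b ⬝ᵥ u.y = u.s ⬝ᵥ u.x := by
  rw [← hx, ← hs, add_dotProduct, mulVec_transpose, ← dotProduct_mulVec,
    dotProduct_comm u.y, add_sub_cancel_right]

theorem LP.dotProduct_eq_zero {f h : Fin n → ℝ} {g : Fin m → ℝ} (hf : P.A *ᵥ f = 0)
    (hh : h + P.Aᵀ *ᵥ g = 0) : ∑ i, f i * h i = 0 := by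
  have : h = -(P.Aᵀ *ᵥ g) := eq_neg_of_add_eq_zero_left hh
  rw [← dotProduct_comm_sum, this, neg_dotProduct, mulVec_transpose, ← dotProduct_mulVec, hf,
    dotProduct_zero, neg_zero]

theorem State.res_zero (z : State m n) : z.res 0 = z.w.v0 - z.u.s ⬝ᵥ z.u.x := rfl

theorem State.res_succ (z : State m n) (i : Fin n) :
    z.res i.succ = z.u.x i * z.u.s i - z.w.v i ^ 2 := rfl

/-- The products `x i * s i` cancel against the gap in the zeroth residual. This is why `ρ` is the
right normalization and depends on `w` only. -/
theorem State.sum_res (z : State m n) : ∑ i, z.res i = (n + 1) * z.w.rho := by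
  rw [Fin.sum_univ_succ]
  simp only [State.res_zero, State.res_succ, Finset.sum_sub_distrib]
  rw [dotProduct_comm_sum, Control.v0_eq, Control.sq]
  ring

theorem LP.Interior.res_pos {z : State m n} (hz : P.Interior z) (i : Fin (n + 1)) :
    0 < z.res i := by
  obtain ⟨⟨h1, h2, -, -⟩, -, h5, h6⟩ := hz
  refine Fin.cases ?_ (fun i => ?_) i
  · rw [State.res_zero, ← LP.gap_eq h1 h2]
    linarith
  · rw [State.res_succ]
    linarith [h5 i]

theorem LP.Interior.rho_pos {z : State m n} (hz : P.Interior z) : 0 < z.w.rho :=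
  Control.rho_pos hz.2.1

theorem LP.Interior.v0_pos {z : State m n} (hz : P.Interior z) : 0 < z.w.v0 :=
  (z.w.sq_nonneg).trans_lt hz.2.1.2

theorem LP.Interior.gap_lt {z : State m n} (hz : P.Interior z) : z.u.s ⬝ᵥ z.u.x < z.w.v0 := by
  have := hz.res_pos 0
  rw [State.res_zero] at this
  linarith

/-- The residuals, normalized by their mean. -/
noncomputable def State.nres (z : State m n) (i : Fin (n + 1)) : ℝ := z.res i / z.w.rho

theorem LP.Interior.nres_pos {z : State m n} (hz : P.Interior z) (i : Fin (n + 1)) :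
    0 < z.nres i := div_pos (hz.res_pos i) hz.rho_pos

theorem State.sum_nres {z : State m n} (hz : 0 < z.w.rho) : ∑ i, (z.nres i - 1) = 0 := by
  unfold State.nres
  rw [Finset.sum_sub_distrib, ← Finset.sum_div, State.sum_res]
  simp [hz.ne']

theorem LP.Interior.Psi_eq {z : State m n} (hz : P.Interior z) : P.Psi z = psi z.nres := by
  have h0 : z.w.v0 - P.c ⬝ᵥ z.u.x + P.b ⬝ᵥ z.u.y = z.res 0 := by
    rw [State.res_zero, ← LP.gap_eq hz.1.1 hz.1.2.1]; ring
  have h : psi z.nres = -∑ i, (Real.log (z.res i) - Real.log z.w.rho) := by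
    unfold psi State.nres
    congr 1
    exact Finset.sum_congr rfl fun i _ => Real.log_div (hz.res_pos i).ne' hz.rho_pos.ne'
  rw [h, Finset.sum_sub_distrib, Fin.sum_univ_succ]
  unfold LP.Psi LP.barrier Control.phi
  rw [h0]
  simp only [State.res_succ, Finset.sum_const, Finset.card_univ, Fintype.card_fin, nsmul_eq_mul]
  push_cast
  ring

theorem LP.Interior.chi_one_sq {z : State m n} (hz : P.Interior z) :
    z.chi 1 ^ 2 = ∑ i, (1 - z.nres i) ^ 2 / z.nres i := by
  have h : ∀ i, (z.res i - z.w.rho) ^ 2 / (z.res i ^ 1 * z.w.rho ^ (2 - 1))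
      = (1 - z.nres i) ^ 2 / z.nres i := by
    intro i
    have h1 := (hz.res_pos i).ne'
    have h2 := hz.rho_pos.ne'
    unfold State.nres
    norm_num
    field_simp
    ring
  unfold State.chi
  simp only [h]
  exact Real.sq_sqrt (Finset.sum_nonneg fun i _ => div_nonneg (sq_nonneg _) (hz.nres_pos i).le)

theorem LP.Interior.chi_two {z : State m n} (hz : P.Interior z) :
    z.chi 2 = Real.sqrt (∑ i, ((1 - z.nres i) / z.nres i) ^ 2) := by
  have h : ∀ i, (z.res i - z.w.rho) ^ 2 / (z.res i ^ 2 * z.w.rho ^ (2 - 2))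
      = ((1 - z.nres i) / z.nres i) ^ 2 := by
    intro i
    have h1 := (hz.res_pos i).ne'
    have h2 := hz.rho_pos.ne'
    unfold State.nres
    norm_num
    field_simp
    ring
  unfold State.chi
  simp only [h]

/-- The product form covers the convention `δ = 0` at the center: if `χ₂ = 0`, all normalized
residuals are 1 and `χ₁ = 0` too. -/
theorem LP.Interior.decrement_le {z : State m n} (hz : P.Interior z) {β : ℝ}
    (h : z.delta ≤ β) :
    ∑ i, (1 - z.nres i) ^ 2 / z.nres i
      ≤ β * Real.sqrt (∑ i, ((1 - z.nres i) / z.nres i) ^ 2) := by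
  rw [← hz.chi_one_sq, ← hz.chi_two]
  unfold State.delta at h
  split_ifs at h with h0
  · have h1 : z.chi 1 ^ 2 = 0 := by
      rw [hz.chi_two, Real.sqrt_eq_zero (Finset.sum_nonneg fun _ _ => sq_nonneg _),
        Finset.sum_eq_zero_iff_of_nonneg fun _ _ => sq_nonneg _] at h0
      rw [hz.chi_one_sq]
      refine Finset.sum_eq_zero fun i hi => ?_
      have h2 := h0 i hi
      have := (hz.nres_pos i).ne'
      rw [sq_eq_zero_iff, div_eq_zero_iff] at h2
      simp_all
    rw [h1, h0, mul_zero]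
  · have : 0 < z.chi 2 := lt_of_le_of_ne (Real.sqrt_nonneg _) (Ne.symm h0)
    rwa [div_le_iff₀ this] at h

theorem LP.Interior.lt_decrement {z : State m n} (hz : P.Interior z) {β : ℝ} (hβ : 0 ≤ β)
    (h : ¬ z.delta ≤ β) :
    β * Real.sqrt (∑ i, ((1 - z.nres i) / z.nres i) ^ 2)
      < ∑ i, (1 - z.nres i) ^ 2 / z.nres i := by
  rw [← hz.chi_one_sq, ← hz.chi_two]
  unfold State.delta at h
  split_ifs at h with h0
  · exact absurd hβ h
  · have : 0 < z.chi 2 := lt_of_le_of_ne (Real.sqrt_nonneg _) (Ne.symm h0)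
    rwa [not_le, lt_div_iff₀ this] at h

theorem LP.interior_of_pos {z : State m n} (h1 : P.A *ᵥ z.u.x = P.b)
    (h2 : z.u.s + P.Aᵀ *ᵥ z.u.y = P.c) (hw : z.w.InTarget) (hx : ∀ i, 0 < z.u.x i)
    (hs : ∀ i, 0 < z.u.s i) (hr : ∀ i, 0 < z.res i) : P.Interior z := by
  refine ⟨⟨h1, h2, hx, hs⟩, hw, fun i => ?_, ?_⟩
  · have := hr i.succ
    rw [State.res_succ] at this
    linarith
  · have := hr 0
    rw [State.res_zero] at this
    rw [LP.gap_eq h1 h2]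
    linarith

/-! ### Tangent directions -/

/-- Eliminating the `x` and `s` parts leaves normal equations with the matrix `A diag(x/s) Aᵀ`,
which is positive definite since `Aᵀ` is injective. -/
theorem LP.exists_isTangent (hinj : ∀ g, P.Aᵀ *ᵥ g = 0 → g = 0) {u : Point m n}
    (hx : ∀ i, 0 < u.x i) (hs : ∀ i, 0 < u.s i) (d : Fin n → ℝ) : ∃ D, P.IsTangent u d D := by
  set M : Matrix (Fin m) (Fin m) ℝ := P.A * diagonal (u.x / u.s) * P.Aᵀ with hM
  have hMv : ∀ g, M *ᵥ g = P.A *ᵥ (u.x / u.s * (P.Aᵀ *ᵥ g)) := by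
    intro g
    rw [hM, ← mulVec_mulVec, ← mulVec_mulVec]
    congr 1
    ext i
    rw [mulVec_diagonal]
    rfl
  have hMinj : Function.Injective M.mulVecLin := by
    rw [injective_iff_map_eq_zero]
    intro g hg
    rw [mulVecLin_apply, hMv] at hg
    have h1 : ∑ i, (u.x i / u.s i * (P.Aᵀ *ᵥ g) i) * (P.Aᵀ *ᵥ g) i = 0 :=
      P.dotProduct_eq_zero (g := -g) hg (by rw [mulVec_neg, add_neg_cancel])
    rw [Finset.sum_eq_zero_iff_of_nonneg] at h1
    · refine hinj g (funext fun i => ?_)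
      have h2 := h1 i (Finset.mem_univ i)
      have := (hx i).ne'
      have := (hs i).ne'
      simp_all
    · intro i _
      rw [mul_assoc]
      have := hx i
      have := hs i
      exact mul_nonneg (by positivity) (mul_self_nonneg _)
  obtain ⟨g, hg⟩ := LinearMap.injective_iff_surjective.1 hMinj (-(P.A *ᵥ (d / u.s)))
  rw [mulVecLin_apply, hMv] at hg
  refine ⟨⟨d / u.s + u.x / u.s * (P.Aᵀ *ᵥ g), -(P.Aᵀ *ᵥ g), g⟩, ?_, ?_, neg_add_cancel _⟩
  · ext i
    have := (hs i).ne'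
    simp
    field_simp
    ring
  · simp only [mulVec_add, hg, add_neg_cancel]

/-- The squared local norm `∑ dᵢ² / (xᵢ sᵢ)` of a right-hand side. -/
noncomputable def Point.normSq (u : Point m n) (d : Fin n → ℝ) : ℝ :=
  ∑ i, d i ^ 2 / (u.x i * u.s i)

/-- In the square of `d = x Δˢ + s Δˣ` divided by `x s`, the cross terms sum to `2 ⟨Δˣ, Δˢ⟩ = 0`,
since null space and row space of `A` are orthogonal. -/
theorem LP.IsTangent.sum_eq {u D : Point m n} {d : Fin n → ℝ} (h : P.IsTangent u d D)
    (hx : ∀ i, 0 < u.x i) (hs : ∀ i, 0 < u.s i) :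
    ∑ i, u.s i / u.x i * D.x i ^ 2 + ∑ i, u.x i / u.s i * D.s i ^ 2 = u.normSq d := by
  have h0 := P.dotProduct_eq_zero h.2.1 h.2.2
  have h1 : u.normSq d = ∑ i, (u.s i / u.x i * D.x i ^ 2 + u.x i / u.s i * D.s i ^ 2
      + 2 * (D.x i * D.s i)) := by
    refine Finset.sum_congr rfl fun i _ => ?_
    rw [← h.1]
    have := (hx i).ne'
    have := (hs i).ne'
    simp
    field_simp
    ring
  rw [h1, Finset.sum_add_distrib, Finset.sum_add_distrib, ← Finset.mul_sum, h0]
  ring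

theorem LP.IsTangent.x_le {u D : Point m n} {d : Fin n → ℝ} (h : P.IsTangent u d D)
    (hx : ∀ i, 0 < u.x i) (hs : ∀ i, 0 < u.s i) :
    ∑ i, u.s i / u.x i * D.x i ^ 2 ≤ u.normSq d := by
  rw [← h.sum_eq hx hs, le_add_iff_nonneg_right]
  exact Finset.sum_nonneg fun i _ => mul_nonneg (div_pos (hx i) (hs i)).le (sq_nonneg _)

theorem LP.IsTangent.s_le {u D : Point m n} {d : Fin n → ℝ} (h : P.IsTangent u d D)
    (hx : ∀ i, 0 < u.x i) (hs : ∀ i, 0 < u.s i) :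
    ∑ i, u.x i / u.s i * D.s i ^ 2 ≤ u.normSq d := by
  rw [← h.sum_eq hx hs, le_add_iff_nonneg_left]
  exact Finset.sum_nonneg fun i _ => mul_nonneg (div_pos (hs i) (hx i)).le (sq_nonneg _)

theorem Point.normSq_nonneg {u : Point m n} (hx : ∀ i, 0 < u.x i) (hs : ∀ i, 0 < u.s i)
    (d : Fin n → ℝ) : 0 ≤ u.normSq d :=
  Finset.sum_nonneg fun i _ => div_nonneg (sq_nonneg _) (mul_pos (hx i) (hs i)).le

/-- Cauchy–Schwarz with the reciprocal weights `s/x` and `x/s`. The result is an `ℓ₁` bound on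
second-order terms, which is what keeps the estimates dimension-free. -/
theorem LP.IsTangent.sq_sum_abs_mul_le {u D E : Point m n} {d e : Fin n → ℝ}
    (hD : P.IsTangent u d D) (hE : P.IsTangent u e E)
    (hx : ∀ i, 0 < u.x i) (hs : ∀ i, 0 < u.s i) :
    (∑ i, |D.x i * E.s i|) ^ 2 ≤ u.normSq d * u.normSq e := by
  have h := Finset.sum_sq_le_sum_mul_sum_of_sq_le_mul Finset.univ
    (r := fun i => |D.x i * E.s i|) (f := fun i => u.s i / u.x i * D.x i ^ 2)
    (g := fun i => u.x i / u.s i * E.s i ^ 2)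
    (fun i _ => mul_nonneg (div_pos (hs i) (hx i)).le (sq_nonneg _))
    (fun i _ => mul_nonneg (div_pos (hx i) (hs i)).le (sq_nonneg _))
    (fun i _ => by
      have := (hx i).ne'
      have := (hs i).ne'
      rw [sq_abs]
      refine le_of_eq ?_
      field_simp)
  exact h.trans (mul_le_mul (hD.x_le hx hs) (hE.s_le hx hs)
    (Finset.sum_nonneg fun i _ => mul_nonneg (div_pos (hx i) (hs i)).le (sq_nonneg _))
    (Point.normSq_nonneg hx hs _))

theorem LP.IsTangent.sum_abs_mul_le {u D : Point m n} {d : Fin n → ℝ}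
    (hD : P.IsTangent u d D) (hx : ∀ i, 0 < u.x i) (hs : ∀ i, 0 < u.s i) :
    ∑ i, |D.x i * D.s i| ≤ u.normSq d := by
  refine abs_le_of_sq_le_sq' ?_ (Point.normSq_nonneg hx hs _) |>.2
  rw [sq (u.normSq d)]
  exact hD.sq_sum_abs_mul_le hD hx hs

theorem pos_add_of_sq_lt {x a : ℝ} (hx : 0 < x) (h : a ^ 2 < x ^ 2) : 0 < x + a := by
  have := abs_lt_of_sq_lt_sq h hx.le
  linarith [neg_abs_le a]

/-- A step whose local norm is small keeps `x` and `s` positive. -/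
theorem LP.IsTangent.move_pos {u D : Point m n} {d : Fin n → ℝ} (hD : P.IsTangent u d D)
    (hx : ∀ i, 0 < u.x i) (hs : ∀ i, 0 < u.s i) {α : ℝ}
    (h : ∀ i, α ^ 2 * u.normSq d < u.x i * u.s i) :
    (∀ i, 0 < (u.move α D).x i) ∧ ∀ i, 0 < (u.move α D).s i := by
  constructor <;> intro i
  · have h1 : u.s i / u.x i * D.x i ^ 2 ≤ u.normSq d :=
      (Finset.single_le_sum (f := fun i => u.s i / u.x i * D.x i ^ 2)
        (fun i _ => mul_nonneg (div_pos (hs i) (hx i)).le (sq_nonneg _))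
        (Finset.mem_univ i)).trans (hD.x_le hx hs)
    refine pos_add_of_sq_lt (a := α * D.x i) (hx i) ?_
    have h2 := (mul_le_mul_of_nonneg_left h1 (sq_nonneg α)).trans_lt (h i)
    have h3 : α ^ 2 * (u.s i / u.x i * D.x i ^ 2) = (α * D.x i) ^ 2 * u.s i / u.x i := by ring
    rw [h3, div_lt_iff₀ (hx i)] at h2
    have := hs i
    nlinarith
  · have h1 : u.x i / u.s i * D.s i ^ 2 ≤ u.normSq d :=
      (Finset.single_le_sum (f := fun i => u.x i / u.s i * D.s i ^ 2)
        (fun i _ => mul_nonneg (div_pos (hx i) (hs i)).le (sq_nonneg _))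
        (Finset.mem_univ i)).trans (hD.s_le hx hs)
    refine pos_add_of_sq_lt (a := α * D.s i) (hs i) ?_
    have h2 := (mul_le_mul_of_nonneg_left h1 (sq_nonneg α)).trans_lt (h i)
    have h3 : α ^ 2 * (u.x i / u.s i * D.s i ^ 2) = (α * D.s i) ^ 2 * u.x i / u.s i := by ring
    rw [h3, div_lt_iff₀ (hs i)] at h2
    have := hx i
    nlinarith

theorem LP.IsTangent.move_feasible {u v D : Point m n} {d : Fin n → ℝ}
    (hD : P.IsTangent v d D) (h1 : P.A *ᵥ u.x = P.b) (h2 : u.s + P.Aᵀ *ᵥ u.y = P.c) (α : ℝ) :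
    P.A *ᵥ (u.move α D).x = P.b ∧ (u.move α D).s + P.Aᵀ *ᵥ (u.move α D).y = P.c := by
  simp only [Point.move, mulVec_add, mulVec_smul, hD.2.1, h1, smul_zero, add_zero, true_and]
  rw [← h2, add_add_add_comm, ← smul_add, hD.2.2, smul_zero, add_zero]

theorem LP.IsTangent.move_mul {u D : Point m n} {d : Fin n → ℝ} (hD : P.IsTangent u d D)
    (α : ℝ) (i : Fin n) : (u.move α D).x i * (u.move α D).s i
      = u.x i * u.s i + α * d i + α ^ 2 * (D.x i * D.s i) := by
  rw [← hD.1]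
  simp [Point.move]
  ring

/-! ### The corrector step -/

theorem State.nres_mul {z : State m n} (hz : 0 < z.w.rho) (i : Fin (n + 1)) :
    z.nres i * z.w.rho = z.res i := div_mul_cancel₀ _ hz.ne'

/-- The normalized second-order term of a tangent step. -/
noncomputable def State.secondOrder (z : State m n) (D : Point m n) : Fin (n + 1) → ℝ :=
  Fin.cons 0 fun i => D.x i * D.s i / z.w.rho

/-- The right-hand side only prescribes the residuals `1, …, n`. The zeroth one follows because the
residuals have fixed mean, and it has no quadratic term because `⟨Δˣ, Δˢ⟩ = 0`. -/
theorem LP.corrector_nres {z : State m n} (hz : 0 < z.w.rho) {D : Point m n}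
    (hD : P.IsTangent z.u z.rhsCorrector D) (α : ℝ) :
    State.nres ⟨z.u.move α D, z.w⟩ = fun i =>
      z.nres i + α * (1 - z.nres i) + α ^ 2 * z.secondOrder D i := by
  have hsum := z.sum_res
  rw [Fin.sum_univ_succ] at hsum
  ext i
  unfold State.nres
  rw [div_eq_iff hz.ne']
  refine Fin.cases ?_ (fun i => ?_) i
  · rw [State.res_zero, State.secondOrder, Fin.cons_zero]
    simp only [dotProduct_comm_sum, hD.move_mul, Finset.sum_add_distrib, ← Finset.mul_sum,
      P.dotProduct_eq_zero hD.2.1 hD.2.2]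
    have h1 : ∑ i, z.rhsCorrector i = z.res 0 - z.w.rho := by
      have : ∀ i, z.rhsCorrector i = z.w.rho - z.res i.succ := fun i => rfl
      simp only [this, Finset.sum_sub_distrib, Finset.sum_const, Finset.card_univ,
        Fintype.card_fin, nsmul_eq_mul]
      linarith
    rw [h1, ← dotProduct_comm_sum, State.res_zero]
    field_simp
    ring
  · rw [State.res_succ, State.secondOrder, Fin.cons_succ, hD.move_mul, State.rhsCorrector,
      State.res_succ]
    field_simp
    ring

theorem LP.Interior.normSq_rhsCorrector_le {z : State m n} (hz : P.Interior z) :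
    z.u.normSq z.rhsCorrector ≤ z.w.rho * ∑ i, (1 - z.nres i) ^ 2 / z.nres i := by
  have hρ := hz.rho_pos
  rw [Fin.sum_univ_succ, mul_add, Finset.mul_sum]
  refine le_add_of_nonneg_of_le (mul_nonneg hρ.le
    (div_nonneg (sq_nonneg _) (hz.nres_pos 0).le)) (Finset.sum_le_sum fun i _ => ?_)
  have hr := hz.res_pos i.succ
  have h1 : z.w.rho * ((1 - z.nres i.succ) ^ 2 / z.nres i.succ)
      = z.rhsCorrector i ^ 2 / z.res i.succ := by
    unfold State.nres
    change _ = (z.w.rho - z.res i.succ) ^ 2 / _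
    field_simp
  rw [h1]
  have h2 : z.res i.succ ≤ z.u.x i * z.u.s i := by
    rw [State.res_succ]
    linarith [sq_nonneg (z.w.v i)]
  exact div_le_div_of_nonneg_left (sq_nonneg _) hr h2

theorem LP.Interior.corrector_decrease {z : State m n} (hz : P.Interior z) {D : Point m n}
    (hD : P.IsTangent z.u z.rhsCorrector D) {κ α : ℝ} (hκ : 0 < κ) (ht : ∀ i, κ ≤ z.nres i)
    (hα : 0 ≤ α) (hα1 : 12 * α ≤ κ)
    (hα2 : 16 * (α ^ 2 * ∑ i, ((1 - z.nres i) / z.nres i) ^ 2) ≤ 1)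
    (hα3 : 4 * (α ^ 2 * ∑ i, (1 - z.nres i) ^ 2 / z.nres i) ≤ κ) :
    P.Interior ⟨z.u.move α D, z.w⟩ ∧ α / 2 * ∑ i, (1 - z.nres i) ^ 2 / z.nres i
      ≤ P.Psi z - P.Psi ⟨z.u.move α D, z.w⟩ := by
  have hρ := hz.rho_pos
  obtain ⟨⟨hf1, hf2, hx, hs⟩, hw, -, -⟩ := id hz
  have hN := hz.normSq_rhsCorrector_le
  have hp : ∑ i, |z.secondOrder D i| ≤ ∑ i, (1 - z.nres i) ^ 2 / z.nres i := by
    rw [Fin.sum_univ_succ, State.secondOrder]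
    simp only [Fin.cons_zero, Fin.cons_succ, abs_zero, zero_add, abs_div, abs_of_pos hρ]
    rw [← Finset.sum_div, div_le_iff₀' hρ]
    exact (hD.sum_abs_mul_le hx hs).trans hN
  obtain ⟨hpos, hdec⟩ := psi_decrease hκ ht (State.sum_nres hρ) hp hα hα1 hα2 hα3
  have hmv := hD.move_pos hx hs (α := α) fun i => by
    have h1 : α ^ 2 * z.u.normSq z.rhsCorrector ≤ z.w.rho * (κ / 4) := by
      have := mul_le_mul_of_nonneg_left hN (sq_nonneg α)
      nlinarith
    have h2 : z.w.rho * κ ≤ z.res i.succ := by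
      rw [← State.nres_mul hρ, mul_comm]
      exact mul_le_mul_of_nonneg_right (ht _) hρ.le
    rw [State.res_succ] at h2
    nlinarith [sq_nonneg (z.w.v i), mul_pos hρ hκ]
  have hint : P.Interior ⟨z.u.move α D, z.w⟩ := by
    obtain ⟨g1, g2⟩ := hD.move_feasible hf1 hf2 α
    refine LP.interior_of_pos g1 g2 hw hmv.1 hmv.2 fun i => ?_
    rw [← State.nres_mul (z := ⟨z.u.move α D, z.w⟩) hρ, LP.corrector_nres hρ hD]
    exact mul_pos (hpos i) hρ
  refine ⟨hint, ?_⟩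
  rw [hz.Psi_eq, hint.Psi_eq, LP.corrector_nres hρ hD]
  exact hdec

/-- Points with bounded gap that are feasible and differ by a feasible direction are bounded. -/
theorem LP.IsTangent.move_bounded {u D : Point m n} {d : Fin n → ℝ} (hD : P.IsTangent u d D)
    (hx : ∀ i, 0 < u.x i) (hs : ∀ i, 0 < u.s i) {α G : ℝ}
    (hxα : ∀ i, 0 ≤ (u.move α D).x i) (hsα : ∀ i, 0 ≤ (u.move α D).s i)
    (hG : (u.move α D).s ⬝ᵥ (u.move α D).x ≤ G) (i : Fin n) :
    u.s i * (u.move α D).x i ≤ G + u.s ⬝ᵥ u.x ∧ u.x i * (u.move α D).s i ≤ G + u.s ⬝ᵥ u.x := by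
  have h0 := P.dotProduct_eq_zero hD.2.1 hD.2.2
  -- The mixed products equal the sum of the two gaps, because the differences of the `x` and `s`
  -- parts are orthogonal.
  have key : ∑ i, (u.s i * (u.move α D).x i + u.x i * (u.move α D).s i) ≤ G + u.s ⬝ᵥ u.x := by
    refine le_trans (le_of_eq ?_) (add_le_add_left hG _)
    rw [dotProduct_comm_sum, dotProduct_comm_sum, ← Finset.sum_add_distrib,
      ← sub_eq_zero, ← Finset.sum_sub_distrib, ← neg_eq_zero,
      ← mul_zero (α ^ 2), ← h0, Finset.mul_sum, ← Finset.sum_neg_distrib]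
    refine Finset.sum_congr rfl fun i _ => ?_
    simp [Point.move]
    ring
  have hnn : ∀ j ∈ Finset.univ, 0 ≤ u.s j * (u.move α D).x j + u.x j * (u.move α D).s j :=
    fun j _ => add_nonneg (mul_nonneg (hs j).le (hxα j)) (mul_nonneg (hx j).le (hsα j))
  have h1 := (Finset.single_le_sum hnn (Finset.mem_univ i)).trans key
  have h2 := mul_nonneg (hs i).le (hxα i)
  have h3 := mul_nonneg (hx i).le (hsα i)
  constructor <;> linarith

theorem Point.move_zero (u D : Point m n) : u.move 0 D = u := by
  ext <;> simp [Point.move]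

theorem exists_bound_of_abs_add_mul_le {a b M : ℝ} (hb : b ≠ 0) :
    ∃ B, ∀ α, |a + α * b| ≤ M → α ≤ B := by
  refine ⟨(M + |a|) / |b|, fun α h => ?_⟩
  rw [le_div_iff₀ (abs_pos.2 hb)]
  have h1 : |α * b| ≤ |a + α * b| + |a| := by
    have := abs_sub (a + α * b) a
    rwa [add_sub_cancel_left] at this
  rw [abs_mul] at h1
  nlinarith [le_abs_self α, abs_nonneg b]

/-- The points of the ray with `Ψ` no larger than at `z` lie in a compact set of interior points:
their normalized residuals stay above a positive `κ`, and the bounded gap bounds `x` and `s`. Since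
`D ≠ 0`, `α` is bounded as well. -/
theorem LP.Interior.exists_barrier_min {z : State m n} (hz : P.Interior z) {D : Point m n}
    (hD : P.IsTangent z.u z.rhsCorrector D) (hd : z.rhsCorrector ≠ 0) :
    ∃ α, 0 ≤ α ∧ P.Interior ⟨z.u.move α D, z.w⟩ ∧
      ∀ α', 0 ≤ α' → P.Interior ⟨z.u.move α' D, z.w⟩ →
        P.Psi ⟨z.u.move α D, z.w⟩ ≤ P.Psi ⟨z.u.move α' D, z.w⟩ := by
  have hρ := hz.rho_pos
  have hv0 := hz.v0_pos
  have hgap := hz.gap_lt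
  obtain ⟨⟨hf1, hf2, hx, hs⟩, hw, -, -⟩ := id hz
  set κ := Real.exp (-(P.Psi z + 1)) with hκ
  have hκ0 : 0 < κ := Real.exp_pos _
  set t : ℝ → Fin (n + 1) → ℝ := fun α i =>
    z.nres i + α * (1 - z.nres i) + α ^ 2 * z.secondOrder D i with ht
  have htα : ∀ α, State.nres ⟨z.u.move α D, z.w⟩ = t α := fun α => P.corrector_nres hρ hD α
  have htc : ∀ i, Continuous fun α => t α i := fun i => by simp only [ht]; fun_prop
  -- Only weak positivity of `x` and `s` is required, so that the set is closed; the residual bound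
  -- makes the products `x i * s i` positive and restores strictness.
  set S : Set ℝ := {α | 0 ≤ α ∧ (∀ i, 0 ≤ z.u.x i + α * D.x i) ∧
    (∀ i, 0 ≤ z.u.s i + α * D.s i) ∧ ∀ i, κ ≤ t α i} with hS
  have hint : ∀ α ∈ S, P.Interior ⟨z.u.move α D, z.w⟩ := by
    rintro α ⟨-, h1, h2, h3⟩
    obtain ⟨g1, g2⟩ := hD.move_feasible hf1 hf2 α
    have hr : ∀ i, 0 < State.res ⟨z.u.move α D, z.w⟩ i := fun i => by
      rw [← State.nres_mul (z := ⟨z.u.move α D, z.w⟩) hρ, htα]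
      exact mul_pos (hκ0.trans_le (h3 i)) hρ
    have hxs : ∀ i, 0 < (z.u.move α D).x i * (z.u.move α D).s i := fun i => by
      have := hr i.succ
      rw [State.res_succ] at this
      exact (sq_nonneg (z.w.v i)).trans_lt (by linarith)
    exact LP.interior_of_pos g1 g2 hw
      (fun i => lt_of_le_of_ne (h1 i) (Ne.symm (left_ne_zero_of_mul (hxs i).ne')))
      (fun i => lt_of_le_of_ne (h2 i) (Ne.symm (right_ne_zero_of_mul (hxs i).ne'))) hr
  have hmem : ∀ α, 0 ≤ α → P.Interior ⟨z.u.move α D, z.w⟩ →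
      P.Psi ⟨z.u.move α D, z.w⟩ ≤ P.Psi z → α ∈ S := by
    intro α h0 hα hle
    refine ⟨h0, fun i => (hα.1.2.2.1 i).le, fun i => (hα.1.2.2.2 i).le, fun i => ?_⟩
    rw [← htα]
    rw [hα.Psi_eq] at hle
    exact exp_le_of_psi_le hα.nres_pos (State.sum_nres hρ) hle i
  have h0 : (⟨z.u.move 0 D, z.w⟩ : State m n) = z := by rw [Point.move_zero]
  have h0S : (0 : ℝ) ∈ S := hmem 0 le_rfl (by rw [h0]; exact hz) (by rw [h0])
  have hbdd : ∃ B, ∀ α ∈ S, α ≤ B := by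
    have hb : ∀ α ∈ S, ∀ i, z.u.s i * (z.u.move α D).x i ≤ z.w.v0 + z.w.v0 ∧
        z.u.x i * (z.u.move α D).s i ≤ z.w.v0 + z.w.v0 := by
      intro α hα i
      have := hD.move_bounded hx hs hα.2.1 hα.2.2.1 (hint α hα).gap_lt.le i
      constructor <;> linarith [this.1, this.2]
    by_contra! hcon
    apply hd
    rw [← hD.1]
    have hz0 : ∀ i, D.x i = 0 ∧ D.s i = 0 := by
      intro i
      by_contra hne
      rw [not_and_or] at hne
      rcases hne with hne | hne
      · obtain ⟨B, hB⟩ := exists_bound_of_abs_add_mul_le (a := z.u.x i)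
          (M := (z.w.v0 + z.w.v0) / z.u.s i) hne
        obtain ⟨α, hα, hlt⟩ := hcon B
        refine absurd (hB α ?_) (not_le.2 hlt)
        rw [abs_of_nonneg (hα.2.1 i), le_div_iff₀' (hs i)]
        exact (hb α hα i).1
      · obtain ⟨B, hB⟩ := exists_bound_of_abs_add_mul_le (a := z.u.s i)
          (M := (z.w.v0 + z.w.v0) / z.u.x i) hne
        obtain ⟨α, hα, hlt⟩ := hcon B
        refine absurd (hB α ?_) (not_le.2 hlt)
        rw [abs_of_nonneg (hα.2.2.1 i), le_div_iff₀' (hx i)]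
        exact (hb α hα i).2
    ext i
    simp [hz0 i]
  have hclosed : IsClosed S := by
    have : S = {α | 0 ≤ α} ∩ ((⋂ i, {α | 0 ≤ z.u.x i + α * D.x i}) ∩
        ((⋂ i, {α | 0 ≤ z.u.s i + α * D.s i}) ∩ ⋂ i, {α | κ ≤ t α i})) := by
      ext α
      simp [hS]
    rw [this]
    refine (isClosed_le continuous_const continuous_id).inter
      ((isClosed_iInter fun i => isClosed_le continuous_const (by fun_prop)).inter
      ((isClosed_iInter fun i => isClosed_le continuous_const (by fun_prop)).inter
      (isClosed_iInter fun i => isClosed_le continuous_const (htc i))))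
  obtain ⟨B, hB⟩ := hbdd
  have hcomp : IsCompact S := isCompact_Icc.of_isClosed_subset hclosed
    (fun α hα => ⟨hα.1, hB α hα⟩)
  have hcont : ContinuousOn (fun α => psi (t α)) S := by
    unfold psi
    refine ContinuousOn.neg (continuousOn_finsetSum _ fun i _ => ?_)
    exact ContinuousOn.log (htc i).continuousOn fun α hα => (hκ0.trans_le (hα.2.2.2 i)).ne'
  obtain ⟨α, hα, hmin⟩ := hcomp.exists_isMinOn ⟨0, h0S⟩ hcont
  have hminP : ∀ α' ∈ S, P.Psi ⟨z.u.move α D, z.w⟩ ≤ P.Psi ⟨z.u.move α' D, z.w⟩ := by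
    intro α' hα'
    rw [(hint α hα).Psi_eq, (hint α' hα').Psi_eq, htα, htα]
    exact hmin hα'
  refine ⟨α, hα.1, hint α hα, fun α' h0' hi' => ?_⟩
  by_cases h : P.Psi ⟨z.u.move α' D, z.w⟩ ≤ P.Psi z
  · exact hminP α' (hmem α' h0' hi' h)
  · have := hminP 0 h0S
    rw [h0] at this
    exact this.trans (not_le.1 h).le

theorem LP.Interior.rhsCorrector_ne_zero {z : State m n} (hz : P.Interior z) {β : ℝ}
    (hβ : 0 ≤ β) (h : ¬ z.delta ≤ β) : z.rhsCorrector ≠ 0 := by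
  intro h0
  have hρ := hz.rho_pos
  have h1 : ∀ i : Fin n, z.res i.succ = z.w.rho := fun i => by
    have : z.w.rho - z.res i.succ = 0 := congrFun h0 i
    linarith
  have h2 := z.sum_res
  rw [Fin.sum_univ_succ] at h2
  simp only [h1, Finset.sum_const, Finset.card_univ, Fintype.card_fin, nsmul_eq_mul] at h2
  have h3 : ∀ i, z.nres i = 1 := by
    intro i
    rw [State.nres, div_eq_one_iff_eq hρ.ne']
    refine Fin.cases ?_ h1 i
    linarith
  have := hz.lt_decrement hβ h
  simp [h3] at this

theorem LP.Interior.exists_approxMin {z : State m n} (hz : P.Interior z) {p : Params}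
    (hθ0 : 0 ≤ p.theta) (hθ1 : p.theta ≤ 1) {β : ℝ} (hβ : 0 ≤ β) (h : ¬ z.delta ≤ β)
    {path : ℝ → State m n} (hp : P.IsCorrectorPath z path) : ∃ α, P.ApproxMin p path α := by
  obtain ⟨D, hD, hpath⟩ := hp
  obtain ⟨α, h0, hα, hmin⟩ := hz.exists_barrier_min hD (hz.rhsCorrector_ne_zero hβ h)
  have hw : ∀ α, (path α).w = z.w := fun α => by rw [hpath]
  have e0 : path 0 = z := by rw [hpath, Point.move_zero]
  refine ⟨α, h0, by rw [hpath]; exact hα, fun α' h0' hα' => ?_⟩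
  have key : ∀ α', 0 ≤ α' → P.Interior (path α') → P.barrier (path α) ≤ P.barrier (path α') := by
    intro α' h1 h2
    have := hmin α' h1 (by rwa [hpath] at h2)
    rw [← hpath, ← hpath] at this
    unfold LP.Psi at this
    rw [hw, hw] at this
    linarith
  have h1 := key α' h0' hα'
  have h2 := key 0 le_rfl (by rw [e0]; exact hz)
  nlinarith

/-- An approximate line search at a point away from the center decreases the proximity measure. -/
theorem LP.Interior.corrector_step {z : State m n} (hz : P.Interior z) {p : Params}
    (hθ0 : 0 ≤ p.theta) {path : ℝ → State m n} (hp : P.IsCorrectorPath z path) {α : ℝ}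
    (hα : P.ApproxMin p path α) {κ α₀ : ℝ} (hκ : 0 < κ) (ht : ∀ i, κ ≤ z.nres i)
    (h0 : 0 ≤ α₀) (h1 : 12 * α₀ ≤ κ)
    (h2 : 16 * (α₀ ^ 2 * ∑ i, ((1 - z.nres i) / z.nres i) ^ 2) ≤ 1)
    (h3 : 4 * (α₀ ^ 2 * ∑ i, (1 - z.nres i) ^ 2 / z.nres i) ≤ κ) :
    (path α).w = z.w ∧
    P.Psi (path α) ≤ P.Psi z - p.theta * (α₀ / 2 * ∑ i, (1 - z.nres i) ^ 2 / z.nres i) := by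
  obtain ⟨D, hD, hpath⟩ := hp
  have hw : ∀ α, (path α).w = z.w := fun α => by rw [hpath]
  have e0 : path 0 = z := by rw [hpath, Point.move_zero]
  obtain ⟨hint, hdec⟩ := hz.corrector_decrease hD hκ ht h0 h1 h2 h3
  rw [← hpath] at hint hdec
  have h4 := hα.2.2 α₀ h0 hint
  refine ⟨hw α, ?_⟩
  have h5 := mul_le_mul_of_nonneg_left hdec hθ0
  unfold LP.Psi at h5 ⊢
  rw [e0] at h4
  rw [hw] at h5 ⊢
  have : p.theta * (P.barrier z - z.w.phi - (P.barrier (path α₀) - z.w.phi))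
    = p.theta * (P.barrier z - P.barrier (path α₀)) := by ring
  linarith

/-! ### The predictor step -/

/-- Scaling shrinks `v⁰` linearly but `‖v‖²` quadratically. The extra summand `α ‖v‖²/(n+1)` enters
the gain in `Control.progress_scale`. -/
theorem Control.rho_scale (w : Control n) (α : ℝ) :
    (w.scale (1 - α)).rho = (1 - α) * (w.rho + α * (w.sq / (n + 1))) := by
  have h1 : (w.scale (1 - α)).sq = (1 - α) ^ 2 * w.sq := by
    simp [Control.sq, Control.scale, mul_pow, Finset.mul_sum]
  have : (n + 1 : ℝ) ≠ 0 := by positivity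
  rw [Control.rho, h1, Control.rho]
  simp only [Control.scale]
  field_simp
  ring

/-- Consequences of the bound `α v⁰ ≤ c √(n+1) ρ` on the step size. -/
theorem short_step_bounds {α c ρ V q v0 : ℝ} (hα : 0 ≤ α) (hρ : 0 < ρ) (hV : 0 ≤ V)
    (hq : 1 ≤ q) (hv0 : v0 = q ^ 2 * ρ + V) (h : α * v0 ≤ c * q * ρ) :
    α * q ≤ c ∧ α * V ≤ c * q * ρ ∧ α ^ 2 * V ≤ c ^ 2 * ρ := by
  subst hv0
  have hq0 : 0 < q := by linarith
  have hαV : 0 ≤ α * V := mul_nonneg hα hV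
  have h1 : α * q ≤ c := by
    have h2 : (q * ρ) * (α * q) ≤ (q * ρ) * c := by nlinarith
    exact le_of_mul_le_mul_left h2 (by positivity)
  have h2 : α * V ≤ c * q * ρ := by
    have : 0 ≤ α * (q ^ 2 * ρ) := by positivity
    linarith
  refine ⟨h1, h2, ?_⟩
  have hc : 0 ≤ c := (by positivity : 0 ≤ α * q).trans h1
  calc α ^ 2 * V = α * (α * V) := by ring
    _ ≤ α * (c * q * ρ) := by gcongr
    _ = (α * q) * (c * ρ) := by ring
    _ ≤ c * (c * ρ) := by gcongr
    _ = c ^ 2 * ρ := by ring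

/-- The local norm of right-hand sides that are dominated by the control variable. -/
theorem weighted_norm_le {w f h v : Fin n → ℝ} {α c ρ κ V q : ℝ} (hα : 0 ≤ α) (hρ : 0 < ρ)
    (hκ : 0 < κ) (hV : ∑ i, v i ^ 2 = V) (hq : 1 ≤ q) (hqn : q ^ 2 = n + 1)
    (hstep : α * (q ^ 2 * ρ + V) ≤ c * q * ρ) (hw : ∀ i, κ * ρ ≤ w i) (hv : ∀ i, v i ^ 2 ≤ w i)
    (hf : ∀ i, |f i| ≤ V / q ^ 2 + 2 * v i ^ 2 + h i) :
    α ^ 2 * ∑ i, f i ^ 2 / w i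
      ≤ 3 * (1 / κ + 4) * (c ^ 2 * ρ) + 3 * (α ^ 2 * ∑ i, h i ^ 2) / (κ * ρ) := by
  have hV0 : 0 ≤ V := hV ▸ Finset.sum_nonneg fun _ _ => sq_nonneg _
  obtain ⟨-, h2, h3⟩ := short_step_bounds hα hρ hV0 hq rfl hstep
  have hq0 : 0 < q := by linarith
  have hκρ : 0 < κ * ρ := mul_pos hκ hρ
  -- The constant and `h` parts use `w ≥ κ ρ`, but the `v²` part uses `v² ≤ w`. Its total is then
  -- `12 V` instead of a quantity of order `V²/(κ ρ)`.
  have hi : ∀ i, f i ^ 2 / w i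
      ≤ 3 * ((V / q ^ 2) ^ 2 / (κ * ρ)) + 12 * v i ^ 2 + 3 / (κ * ρ) * h i ^ 2 := by
    intro i
    have hwi : 0 < w i := hκρ.trans_le (hw i)
    have e1 : f i ^ 2 ≤ 3 * (V / q ^ 2) ^ 2 + 12 * (v i ^ 2 * v i ^ 2) + 3 * h i ^ 2 := by
      have h4 : f i ^ 2 ≤ (V / q ^ 2 + 2 * v i ^ 2 + h i) ^ 2 :=
        sq_le_sq' (by linarith [neg_abs_le (f i), hf i]) ((le_abs_self _).trans (hf i))
      nlinarith [sq_nonneg (V / q ^ 2 - 2 * v i ^ 2), sq_nonneg (V / q ^ 2 - h i),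
        sq_nonneg (2 * v i ^ 2 - h i)]
    have e2 : (V / q ^ 2) ^ 2 / w i ≤ (V / q ^ 2) ^ 2 / (κ * ρ) :=
      div_le_div_of_nonneg_left (sq_nonneg _) hκρ (hw i)
    have e3 : h i ^ 2 / w i ≤ h i ^ 2 / (κ * ρ) :=
      div_le_div_of_nonneg_left (sq_nonneg _) hκρ (hw i)
    have e4 : v i ^ 2 * v i ^ 2 / w i ≤ v i ^ 2 := by
      rw [div_le_iff₀ hwi]
      exact mul_le_mul_of_nonneg_left (hv i) (sq_nonneg _)
    calc f i ^ 2 / w i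
        ≤ (3 * (V / q ^ 2) ^ 2 + 12 * (v i ^ 2 * v i ^ 2) + 3 * h i ^ 2) / w i := by gcongr
      _ = 3 * ((V / q ^ 2) ^ 2 / w i) + 12 * (v i ^ 2 * v i ^ 2 / w i)
          + 3 * (h i ^ 2 / w i) := by ring
      _ ≤ 3 * ((V / q ^ 2) ^ 2 / (κ * ρ)) + 12 * v i ^ 2 + 3 * (h i ^ 2 / (κ * ρ)) := by
          linarith
      _ = _ := by ring
  have hsum : ∑ i, f i ^ 2 / w i ≤ 3 * (n * ((V / q ^ 2) ^ 2 / (κ * ρ))) + 12 * V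
      + 3 / (κ * ρ) * ∑ i, h i ^ 2 := by
    refine (Finset.sum_le_sum fun i _ => hi i).trans (le_of_eq ?_)
    rw [Finset.sum_add_distrib, Finset.sum_add_distrib, ← Finset.mul_sum, ← Finset.mul_sum, hV,
      ← Finset.mul_sum]
    simp only [Finset.sum_const, Finset.card_univ, Fintype.card_fin, nsmul_eq_mul]
  have hfirst : α ^ 2 * (n * ((V / q ^ 2) ^ 2 / (κ * ρ))) ≤ c ^ 2 * ρ / κ := by
    have h5 : (α * V) ^ 2 ≤ (c * q * ρ) ^ 2 := pow_le_pow_left₀ (by positivity) h2 2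
    have hn : (n : ℝ) ≤ q ^ 2 := by linarith
    calc α ^ 2 * (n * ((V / q ^ 2) ^ 2 / (κ * ρ)))
        = n * (α * V) ^ 2 / (q ^ 4 * (κ * ρ)) := by field_simp
      _ ≤ q ^ 2 * (c * q * ρ) ^ 2 / (q ^ 4 * (κ * ρ)) := by gcongr
      _ = c ^ 2 * ρ / κ := by field_simp
  calc α ^ 2 * ∑ i, f i ^ 2 / w i ≤ α ^ 2 * (3 * (n * ((V / q ^ 2) ^ 2 / (κ * ρ))) + 12 * V
      + 3 / (κ * ρ) * ∑ i, h i ^ 2) := by gcongr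
    _ = 3 * (α ^ 2 * (n * ((V / q ^ 2) ^ 2 / (κ * ρ)))) + 12 * (α ^ 2 * V)
        + 3 * (α ^ 2 * ∑ i, h i ^ 2) / (κ * ρ) := by ring
    _ ≤ 3 * (c ^ 2 * ρ / κ) + 12 * (c ^ 2 * ρ) + 3 * (α ^ 2 * ∑ i, h i ^ 2) / (κ * ρ) := by
        gcongr
    _ = _ := by ring

/-- Closeness of the normalized residuals at two points whose residuals are related by
`r' - ρ' = μ (r - ρ) + f`. -/
theorem State.sum_sq_nres_sub_le {z z' : State m n} {μ E lam Y : ℝ} {f : Fin n → ℝ}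
    (hρ : 0 < z.w.rho) (hρ' : 0 < z'.w.rho)
    (hf : ∀ i : Fin n, z'.res i.succ - z'.w.rho = μ * (z.res i.succ - z.w.rho) + f i)
    (hE : ∑ i, |f i| ≤ E * z'.w.rho)
    (hμ : |μ * z.w.rho - z'.w.rho| ≤ lam * z'.w.rho)
    (hY : ∑ i, (z.nres i - 1) ^ 2 ≤ Y) :
    ∑ i, (z'.nres i - z.nres i) ^ 2 ≤ 2 * lam ^ 2 * Y + 2 * (2 * E) ^ 2 := by
  set ρ := z.w.rho
  set ρ' := z'.w.rho
  -- Deviations from the mean sum to zero, so the perturbation of the zeroth residual is forced; it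
  -- at most doubles the `ℓ₁` norm.
  set e : Fin (n + 1) → ℝ := Fin.cons (-∑ i, f i) f with he
  have hsum0 : ∑ i : Fin (n + 1), (z.res i - ρ) = 0 := by
    rw [Finset.sum_sub_distrib, State.sum_res]; simp [ρ]
  have hsum0' : ∑ i : Fin (n + 1), (z'.res i - ρ') = 0 := by
    rw [Finset.sum_sub_distrib, State.sum_res]; simp [ρ']
  have hres : ∀ i, z'.res i - ρ' = μ * (z.res i - ρ) + e i := by
    intro i
    refine Fin.cases ?_ hf i
    rw [Fin.sum_univ_succ] at hsum0 hsum0'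
    rw [he, Fin.cons_zero, eq_neg_of_add_eq_zero_left hsum0, eq_neg_of_add_eq_zero_left hsum0']
    simp only [hf, Finset.sum_add_distrib, ← Finset.mul_sum]
    ring
  have heabs : ∑ i, |e i| ≤ 2 * E * ρ' := by
    rw [Fin.sum_univ_succ, he]
    simp only [Fin.cons_zero, Fin.cons_succ, abs_neg]
    linarith [Finset.abs_sum_le_sum_abs f Finset.univ]
  have hesq : ∑ i, e i ^ 2 ≤ (2 * E * ρ') ^ 2 := by
    have h1 : ∑ i, |e i| ^ 2 ≤ (∑ i, |e i|) ^ 2 :=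
      Finset.sum_sq_le_sq_sum_of_nonneg fun i _ => abs_nonneg _
    simp only [sq_abs] at h1
    exact h1.trans (pow_le_pow_left₀ (Finset.sum_nonneg fun _ _ => abs_nonneg _) heabs 2)
  have hlam : (μ * ρ / ρ' - 1) ^ 2 ≤ lam ^ 2 := by
    have : |μ * ρ / ρ' - 1| ≤ lam := by
      have h1 : μ * ρ / ρ' - 1 = (μ * ρ - ρ') / ρ' := by field_simp
      rw [h1, abs_div, abs_of_pos hρ', div_le_iff₀ hρ']
      exact hμ
    rw [← sq_abs]
    exact pow_le_pow_left₀ (abs_nonneg _) this 2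
  have hdiff : ∀ i, z'.nres i - z.nres i = (μ * ρ / ρ' - 1) * (z.nres i - 1) + e i / ρ' := by
    intro i
    have h1 : z'.nres i = z'.res i / ρ' := rfl
    have h2 : z.res i = z.nres i * ρ := (State.nres_mul hρ i).symm
    rw [h1, eq_add_of_sub_eq (hres i), h2]
    field_simp
    ring
  have hterm : ∀ i, (z'.nres i - z.nres i) ^ 2
      ≤ 2 * lam ^ 2 * (z.nres i - 1) ^ 2 + 2 / ρ' ^ 2 * e i ^ 2 := by
    intro i
    rw [hdiff]
    have h1 := mul_le_mul_of_nonneg_right hlam (sq_nonneg (z.nres i - 1))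
    have h2 : 2 / ρ' ^ 2 * e i ^ 2 = 2 * (e i / ρ') ^ 2 := by ring
    rw [h2]
    nlinarith [sq_nonneg ((μ * ρ / ρ' - 1) * (z.nres i - 1) - e i / ρ')]
  calc ∑ i, (z'.nres i - z.nres i) ^ 2
      ≤ ∑ i, (2 * lam ^ 2 * (z.nres i - 1) ^ 2 + 2 / ρ' ^ 2 * e i ^ 2) :=
        Finset.sum_le_sum fun i _ => hterm i
    _ = 2 * lam ^ 2 * ∑ i, (z.nres i - 1) ^ 2 + 2 / ρ' ^ 2 * ∑ i, e i ^ 2 := by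
        rw [Finset.sum_add_distrib, ← Finset.mul_sum, ← Finset.mul_sum]
    _ ≤ 2 * lam ^ 2 * Y + 2 / ρ' ^ 2 * (2 * E * ρ') ^ 2 := by gcongr
    _ = _ := by field_simp

/-! ### Exact residual identities along the three predictor curves. -/

theorem Control.scale_v (w : Control n) (t : ℝ) (i : Fin n) : (w.scale t).v i = t * w.v i := rfl

/-- The right-hand side makes residual and mean change at the same rate in `α`, so the deviation is
preserved to first order. -/
theorem LP.IsTangent.res_tangential {z : State m n} {D : Point m n}
    (hD : P.IsTangent z.u z.rhsTangential D) (α : ℝ) (i : Fin n) :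
    State.res ⟨z.u.move α D, z.w.scale (1 - α)⟩ i.succ - (z.w.scale (1 - α)).rho
      = 1 * (z.res i.succ - z.w.rho)
        + α ^ 2 * (D.x i * D.s i - z.w.v i ^ 2 + z.w.sq / (n + 1)) := by
  rw [State.res_succ, State.res_succ, hD.move_mul, Control.rho_scale, Control.scale_v,
    State.rhsTangential]
  ring

/-- The summand `-x s` of the right-hand side contracts the deviation by `1 - α`. -/
theorem LP.IsTangent.res_auto {z : State m n} {D : Point m n}
    (hD : P.IsTangent z.u z.rhsAuto D) (α : ℝ) (i : Fin n) :
    State.res ⟨z.u.move α D, z.w.scale (1 - α)⟩ i.succ - (z.w.scale (1 - α)).rho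
      = (1 - α) * (z.res i.succ - z.w.rho)
        + α ^ 2 * (D.x i * D.s i - z.w.v i ^ 2 + z.w.sq / (n + 1)) := by
  rw [State.res_succ, State.res_succ, hD.move_mul, Control.rho_scale, Control.scale_v,
    State.rhsAuto]
  ring

/-- The direction `E` is designed to cancel the `α²` perturbation of `LP.IsTangent.res_auto`,
leaving orders three and four. -/
theorem LP.IsTangent.res_second {z : State m n} {D E : Point m n}
    (hD : P.IsTangent z.u z.rhsAuto D) (hE : P.IsTangent z.u (z.rhsSecond D) E)
    (α : ℝ) (i : Fin n) :
    State.res ⟨(z.u.move α D).move (α ^ 2) E, z.w.scale (1 - α)⟩ i.succ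
        - (z.w.scale (1 - α)).rho
      = (1 - α) * (z.res i.succ - z.w.rho)
        + (α ^ 3 * (D.x i * E.s i + E.x i * D.s i) + α ^ 4 * (E.x i * E.s i)) := by
  have h1 : z.u.x i * D.s i + z.u.s i * D.x i = z.rhsAuto i := congrFun hD.1 i
  have h2 : z.u.x i * E.s i + z.u.s i * E.x i = z.rhsSecond D i := congrFun hE.1 i
  rw [State.res_succ, State.res_succ, Control.rho_scale, Control.scale_v]
  have h3 : ((z.u.move α D).move (α ^ 2) E).x i * ((z.u.move α D).move (α ^ 2) E).s i
      = z.u.x i * z.u.s i + α * z.rhsAuto i + α ^ 2 * (D.x i * D.s i + z.rhsSecond D i)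
        + (α ^ 3 * (D.x i * E.s i + E.x i * D.s i) + α ^ 4 * (E.x i * E.s i)) := by
    rw [← h1, ← h2]
    simp [Point.move]
    ring
  rw [h3, State.rhsAuto, State.rhsSecond]
  ring

/-- The situation at a predictor step: an interior point with bounded normalized residuals,
and a step size `α` with `α v⁰ ≤ c √(n+1) ρ`. -/
structure ShortStep (P : LP m n) (z : State m n) (κ T c α : ℝ) : Prop where
  interior : P.Interior z
  κ_pos : 0 < κ
  κ_le : ∀ i, κ ≤ z.nres i
  le_T : ∀ i, z.nres i ≤ T
  one_le_T : 1 ≤ T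
  α_nonneg : 0 ≤ α
  c_nonneg : 0 ≤ c
  c_le : c ≤ 1 / 2
  step : α * z.w.v0 ≤ c * Real.sqrt (n + 1) * z.w.rho

/-! ### Size of the predictor directions and of the residual perturbations for short steps. -/

namespace ShortStep

variable {z : State m n} {κ T c α : ℝ}

theorem one_le_sqrt : 1 ≤ Real.sqrt ((n : ℝ) + 1) :=
  Real.one_le_sqrt.2 (by linarith [Nat.cast_nonneg (α := ℝ) n])

theorem sq_sqrt : Real.sqrt ((n : ℝ) + 1) ^ 2 = n + 1 := Real.sq_sqrt (by positivity)

theorem bounds (h : ShortStep P z κ T c α) : α * Real.sqrt (n + 1) ≤ c ∧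
    α * z.w.sq ≤ c * Real.sqrt (n + 1) * z.w.rho ∧ α ^ 2 * z.w.sq ≤ c ^ 2 * z.w.rho :=
  short_step_bounds h.α_nonneg h.interior.rho_pos z.w.sq_nonneg one_le_sqrt
    (by rw [sq_sqrt]; exact z.w.v0_eq) h.step

theorem α_le (h : ShortStep P z κ T c α) : α ≤ c := by
  have := h.bounds.1
  have h1 := one_le_sqrt (n := n)
  nlinarith [h.α_nonneg]

theorem x_pos (h : ShortStep P z κ T c α) : ∀ i, 0 < z.u.x i := h.interior.1.2.2.1

theorem s_pos (h : ShortStep P z κ T c α) : ∀ i, 0 < z.u.s i := h.interior.1.2.2.2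

theorem res_bounds (h : ShortStep P z κ T c α) (i : Fin n) :
    κ * z.w.rho ≤ z.u.x i * z.u.s i - z.w.v i ^ 2 ∧
      z.u.x i * z.u.s i - z.w.v i ^ 2 ≤ T * z.w.rho := by
  have hρ := h.interior.rho_pos
  rw [← State.res_succ, ← State.nres_mul hρ]
  exact ⟨mul_le_mul_of_nonneg_right (h.κ_le _) hρ.le,
    mul_le_mul_of_nonneg_right (h.le_T _) hρ.le⟩

theorem normSq_le' (h : ShortStep P z κ T c α) {f g : Fin n → ℝ}
    (hf : ∀ i, |f i| ≤ z.w.sq / (n + 1) + 2 * z.w.v i ^ 2 + g i) :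
    α ^ 2 * z.u.normSq f ≤ 3 * (1 / κ + 4) * (c ^ 2 * z.w.rho)
      + 3 * (α ^ 2 * ∑ i, g i ^ 2) / (κ * z.w.rho) := by
  have hρ := h.interior.rho_pos
  refine weighted_norm_le (w := fun i => z.u.x i * z.u.s i) (v := z.w.v) h.α_nonneg hρ h.κ_pos
    rfl one_le_sqrt sq_sqrt ?_ (fun i => ?_) (fun i => ?_) ?_
  · rw [sq_sqrt]
    have := h.step
    rwa [z.w.v0_eq] at this
  · linarith [(h.res_bounds i).1, sq_nonneg (z.w.v i)]
  · linarith [(h.res_bounds i).1, mul_pos h.κ_pos hρ]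
  · rw [sq_sqrt]
    exact hf

/-- The constant part `T ρ` occurs `n` times, which is harmless because `α² (n + 1) ≤ c²`. -/
theorem normSq_le (h : ShortStep P z κ T c α) {f : Fin n → ℝ}
    (hf : ∀ i, |f i| ≤ z.w.sq / (n + 1) + 2 * z.w.v i ^ 2 + T * z.w.rho) :
    α ^ 2 * z.u.normSq f ≤ 3 * (1 / κ + 4 + T ^ 2 / κ) * (c ^ 2 * z.w.rho) := by
  have hρ := h.interior.rho_pos
  have hκ := h.κ_pos
  refine (h.normSq_le' hf).trans ?_
  have h1 : α ^ 2 * n ≤ c ^ 2 := by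
    have h2 := pow_le_pow_left₀ (mul_nonneg h.α_nonneg (Real.sqrt_nonneg _)) h.bounds.1 2
    rw [mul_pow, sq_sqrt] at h2
    nlinarith [sq_nonneg α]
  have h2 : 3 * (α ^ 2 * ∑ i : Fin n, (T * z.w.rho) ^ 2) / (κ * z.w.rho)
      = (α ^ 2 * n) * (3 * T ^ 2 / κ * z.w.rho) := by
    simp only [Finset.sum_const, Finset.card_univ, Fintype.card_fin, nsmul_eq_mul]
    field_simp
  rw [h2]
  have h3 := mul_le_mul_of_nonneg_right h1 (by positivity : 0 ≤ 3 * T ^ 2 / κ * z.w.rho)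
  refine (add_le_add_right h3 _).trans (le_of_eq ?_)
  ring

theorem sq_div_nonneg (z : State m n) : 0 ≤ z.w.sq / ((n : ℝ) + 1) :=
  div_nonneg z.w.sq_nonneg (by positivity)

theorem normSq_tangential_le (h : ShortStep P z κ T c α) :
    α ^ 2 * z.u.normSq z.rhsTangential ≤ 3 * (1 / κ + 4 + T ^ 2 / κ) * (c ^ 2 * z.w.rho) := by
  refine h.normSq_le fun i => ?_
  have h1 := sq_div_nonneg z
  have hρ := h.interior.rho_pos
  have hT := h.one_le_T
  have h2 := sq_nonneg (z.w.v i)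
  rw [State.rhsTangential, abs_le]
  constructor <;> nlinarith

theorem normSq_auto_le (h : ShortStep P z κ T c α) :
    α ^ 2 * z.u.normSq z.rhsAuto ≤ 3 * (1 / κ + 4 + T ^ 2 / κ) * (c ^ 2 * z.w.rho) := by
  refine h.normSq_le fun i => ?_
  have h1 := sq_div_nonneg z
  have hρ := h.interior.rho_pos
  have hT := h.one_le_T
  have h2 := sq_nonneg (z.w.v i)
  have h3 := h.res_bounds i
  have h4 := mul_pos h.κ_pos hρ
  rw [State.rhsAuto, abs_le]
  constructor <;> nlinarith

theorem sum_abs_first_le (h : ShortStep P z κ T c α) {D : Point m n} {d : Fin n → ℝ} {C : ℝ}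
    (hD : P.IsTangent z.u d D) (hd : α ^ 2 * z.u.normSq d ≤ C * (c ^ 2 * z.w.rho)) :
    ∑ i, |α ^ 2 * (D.x i * D.s i - z.w.v i ^ 2 + z.w.sq / (n + 1))|
      ≤ (C + 2) * (c ^ 2 * z.w.rho) := by
  have h0 := sq_div_nonneg z
  have h1 : ∀ i, |α ^ 2 * (D.x i * D.s i - z.w.v i ^ 2 + z.w.sq / (n + 1))|
      ≤ α ^ 2 * |D.x i * D.s i| + α ^ 2 * z.w.v i ^ 2 + α ^ 2 * (z.w.sq / (n + 1)) := by
    intro i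
    rw [abs_mul, abs_of_nonneg (sq_nonneg α), ← mul_add, ← mul_add]
    refine mul_le_mul_of_nonneg_left ?_ (sq_nonneg α)
    have := le_abs_self (D.x i * D.s i)
    have := neg_abs_le (D.x i * D.s i)
    have := sq_nonneg (z.w.v i)
    rw [abs_le]
    constructor <;> linarith
  refine (Finset.sum_le_sum fun i _ => h1 i).trans ?_
  rw [Finset.sum_add_distrib, Finset.sum_add_distrib, ← Finset.mul_sum, ← Finset.mul_sum]
  simp only [Finset.sum_const, Finset.card_univ, Fintype.card_fin, nsmul_eq_mul]
  have h2 := mul_le_mul_of_nonneg_left (hD.sum_abs_mul_le h.x_pos h.s_pos) (sq_nonneg α)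
  have h3 : n * (α ^ 2 * (z.w.sq / (n + 1))) ≤ α ^ 2 * z.w.sq := by
    have : n * (α ^ 2 * (z.w.sq / (n + 1))) = α ^ 2 * z.w.sq * (n / (n + 1)) := by ring
    rw [this]
    refine mul_le_of_le_one_right (mul_nonneg (sq_nonneg _) z.w.sq_nonneg) ?_
    rw [div_le_one (by positivity)]
    linarith
  have h4 := h.bounds.2.2
  have h5 : ∑ i, z.w.v i ^ 2 = z.w.sq := rfl
  rw [h5]
  linarith

/-- The term `Δ̃ˣ Δ̃ˢ` is small in `ℓ₁`, hence in `ℓ₂`; its squared size is of order `(c² ρ)²`, and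
dividing by `κ ρ` returns to the scale `c² ρ`. -/
theorem normSq_second_le (h : ShortStep P z κ T c α) {D : Point m n} {d : Fin n → ℝ} {C : ℝ}
    (hD : P.IsTangent z.u d D)
    (hd : α ^ 2 * z.u.normSq d ≤ C * (c ^ 2 * z.w.rho)) :
    α ^ 4 * z.u.normSq (z.rhsSecond D)
      ≤ (3 * (1 / κ + 4) + 3 * C ^ 2 / κ) * (c ^ 2 * z.w.rho) := by
  have hρ := h.interior.rho_pos
  have hκ := h.κ_pos
  have h1 := h.normSq_le' (f := z.rhsSecond D) (g := fun i => |D.x i * D.s i|) fun i => by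
    have := sq_div_nonneg z
    have := le_abs_self (D.x i * D.s i)
    have := neg_abs_le (D.x i * D.s i)
    have := sq_nonneg (z.w.v i)
    rw [State.rhsSecond, abs_le]
    constructor <;> linarith
  have hα1 : α ^ 2 ≤ 1 := by nlinarith [h.α_le, h.c_le, h.α_nonneg]
  have hc1 : c ^ 2 ≤ 1 := by nlinarith [h.c_nonneg, h.c_le]
  have h2 : (α ^ 2) ^ 2 * ∑ i, |D.x i * D.s i| ^ 2 ≤ (C * (c ^ 2 * z.w.rho)) ^ 2 := by
    have h3 : ∑ i, |D.x i * D.s i| ^ 2 ≤ (∑ i, |D.x i * D.s i|) ^ 2 :=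
      Finset.sum_sq_le_sq_sum_of_nonneg fun i _ => abs_nonneg _
    have h4 : α ^ 2 * ∑ i, |D.x i * D.s i| ≤ C * (c ^ 2 * z.w.rho) :=
      (mul_le_mul_of_nonneg_left (hD.sum_abs_mul_le h.x_pos h.s_pos) (sq_nonneg α)).trans hd
    calc (α ^ 2) ^ 2 * ∑ i, |D.x i * D.s i| ^ 2
        ≤ (α ^ 2) ^ 2 * (∑ i, |D.x i * D.s i|) ^ 2 := by gcongr
      _ = (α ^ 2 * ∑ i, |D.x i * D.s i|) ^ 2 := by ring
      _ ≤ _ := pow_le_pow_left₀ (mul_nonneg (sq_nonneg _)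
          (Finset.sum_nonneg fun _ _ => abs_nonneg _)) h4 2
  have hB : 0 ≤ 3 * (1 / κ + 4) * (c ^ 2 * z.w.rho) := by positivity
  calc α ^ 4 * z.u.normSq (z.rhsSecond D) = α ^ 2 * (α ^ 2 * z.u.normSq (z.rhsSecond D)) := by
        ring
    _ ≤ α ^ 2 * (3 * (1 / κ + 4) * (c ^ 2 * z.w.rho)
        + 3 * (α ^ 2 * ∑ i, |D.x i * D.s i| ^ 2) / (κ * z.w.rho)) := by gcongr
    _ = α ^ 2 * (3 * (1 / κ + 4) * (c ^ 2 * z.w.rho))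
        + 3 * ((α ^ 2) ^ 2 * ∑ i, |D.x i * D.s i| ^ 2) / (κ * z.w.rho) := by ring
    _ ≤ 1 * (3 * (1 / κ + 4) * (c ^ 2 * z.w.rho))
        + 3 * ((C * (c ^ 2 * z.w.rho)) ^ 2) / (κ * z.w.rho) := by gcongr
    _ = 3 * (1 / κ + 4) * (c ^ 2 * z.w.rho)
        + c ^ 2 * (3 * C ^ 2 / κ * (c ^ 2 * z.w.rho)) := by field_simp
    _ ≤ 3 * (1 / κ + 4) * (c ^ 2 * z.w.rho)
        + 1 * (3 * C ^ 2 / κ * (c ^ 2 * z.w.rho)) := by gcongr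
    _ = _ := by ring

theorem sum_abs_second_le (h : ShortStep P z κ T c α) {D E : Point m n} {d e : Fin n → ℝ}
    {C₁ C₂ : ℝ} (h₁ : 0 ≤ C₁) (h₂ : 0 ≤ C₂)
    (hD : P.IsTangent z.u d D) (hd : α ^ 2 * z.u.normSq d ≤ C₁ * (c ^ 2 * z.w.rho))
    (hE : P.IsTangent z.u e E) (he : α ^ 4 * z.u.normSq e ≤ C₂ * (c ^ 2 * z.w.rho)) :
    ∑ i, |α ^ 3 * (D.x i * E.s i + E.x i * D.s i) + α ^ 4 * (E.x i * E.s i)|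
      ≤ (2 * (C₁ + C₂) + C₂) * (c ^ 2 * z.w.rho) := by
  have hα := h.α_nonneg
  have hρ := h.interior.rho_pos
  have hdn := Point.normSq_nonneg h.x_pos h.s_pos d
  have hen := Point.normSq_nonneg h.x_pos h.s_pos e
  have hprod : α ^ 6 * (z.u.normSq d * z.u.normSq e)
      ≤ ((C₁ + C₂) * (c ^ 2 * z.w.rho)) ^ 2 := by
    have h1 := mul_le_mul hd he (by positivity) (by positivity)
    have h2 : α ^ 6 * (z.u.normSq d * z.u.normSq e)
      = α ^ 2 * z.u.normSq d * (α ^ 4 * z.u.normSq e) := by ring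
    rw [h2]
    refine h1.trans ?_
    have h3 : C₁ * C₂ ≤ (C₁ + C₂) ^ 2 := by nlinarith
    have h4 := mul_le_mul_of_nonneg_right h3 (sq_nonneg (c ^ 2 * z.w.rho))
    nlinarith
  have hDE : α ^ 3 * ∑ i, |D.x i * E.s i| ≤ (C₁ + C₂) * (c ^ 2 * z.w.rho) := by
    refine abs_le_of_sq_le_sq' ?_ (by positivity) |>.2
    refine le_trans (le_of_eq_of_le ?_ (mul_le_mul_of_nonneg_left
      (hD.sq_sum_abs_mul_le hE h.x_pos h.s_pos) (by positivity : 0 ≤ α ^ 6))) hprod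
    ring
  have hED : α ^ 3 * ∑ i, |E.x i * D.s i| ≤ (C₁ + C₂) * (c ^ 2 * z.w.rho) := by
    refine abs_le_of_sq_le_sq' ?_ (by positivity) |>.2
    refine le_trans (le_of_eq_of_le ?_ (mul_le_mul_of_nonneg_left
      (hE.sq_sum_abs_mul_le hD h.x_pos h.s_pos) (by positivity : 0 ≤ α ^ 6)))
      (by rwa [mul_comm (z.u.normSq e)])
    ring
  have hEE : α ^ 4 * ∑ i, |E.x i * E.s i| ≤ C₂ * (c ^ 2 * z.w.rho) :=
    (mul_le_mul_of_nonneg_left (hE.sum_abs_mul_le h.x_pos h.s_pos) (by positivity)).trans he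
  have h1 : ∀ i, |α ^ 3 * (D.x i * E.s i + E.x i * D.s i) + α ^ 4 * (E.x i * E.s i)|
      ≤ α ^ 3 * |D.x i * E.s i| + α ^ 3 * |E.x i * D.s i| + α ^ 4 * |E.x i * E.s i| := by
    intro i
    refine (abs_add_le _ _).trans ?_
    rw [abs_mul, abs_mul, abs_of_nonneg (by positivity : 0 ≤ α ^ 3),
      abs_of_nonneg (by positivity : 0 ≤ α ^ 4), ← mul_add]
    gcongr
    exact abs_add_le _ _
  refine (Finset.sum_le_sum fun i _ => h1 i).trans ?_
  rw [Finset.sum_add_distrib, Finset.sum_add_distrib, ← Finset.mul_sum, ← Finset.mul_sum,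
    ← Finset.mul_sum]
  linarith

end ShortStep

theorem Method.predictorPath_w {M : Method} {z : State m n} {path : ℝ → State m n}
    (hp : M.IsPredictorPath P z path) (α : ℝ) : (path α).w = z.w.scale (1 - α) := by
  cases M
  · obtain ⟨D, -, h⟩ := hp
    rw [h]
  · obtain ⟨D, -, h⟩ := hp
    rw [h]
  · obtain ⟨D, E, -, -, h⟩ := hp
    rw [h]

/-- A constant bounding the residual perturbation of short predictor steps. -/
noncomputable def perturbConst (κ T : ℝ) : ℝ :=
  3 * (3 * (1 / κ + 4 + T ^ 2 / κ))
    + 3 * (3 * (1 / κ + 4) + 3 * (3 * (1 / κ + 4 + T ^ 2 / κ)) ^ 2 / κ) + 2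

/-- For all three methods, residuals along a short predictor step are contracted towards their
mean, up to a perturbation that is small in the `ℓ₁`-norm. -/
theorem ShortStep.exists_res_eq {M : Method} {z : State m n} {path : ℝ → State m n}
    {κ T c α : ℝ} (h : ShortStep P z κ T c α) (hp : M.IsPredictorPath P z path) :
    ∃ (μ : ℝ) (f : Fin n → ℝ), (μ = 1 ∨ μ = 1 - α) ∧
      (∀ i : Fin n, (path α).res i.succ - (path α).w.rho
        = μ * (z.res i.succ - z.w.rho) + f i) ∧
      ∑ i, |f i| ≤ perturbConst κ T * (c ^ 2 * z.w.rho) := by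
  have hρ := h.interior.rho_pos
  have hκ := h.κ_pos
  have hcρ : 0 ≤ c ^ 2 * z.w.rho := by positivity
  have hC1 : 0 ≤ 3 * (1 / κ + 4 + T ^ 2 / κ) := by positivity
  have hC2 : 0 ≤ 3 * (1 / κ + 4) + 3 * (3 * (1 / κ + 4 + T ^ 2 / κ)) ^ 2 / κ := by positivity
  rw [perturbConst]
  set C₁ := 3 * (1 / κ + 4 + T ^ 2 / κ)
  set C₂ := 3 * (1 / κ + 4) + 3 * C₁ ^ 2 / κ
  cases M
  · obtain ⟨D, hD, hpath⟩ := hp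
    refine ⟨1, _, Or.inl rfl, fun i => by rw [hpath]; exact hD.res_tangential α i,
      (h.sum_abs_first_le hD h.normSq_tangential_le).trans
        (mul_le_mul_of_nonneg_right ?_ hcρ)⟩
    linarith
  · obtain ⟨D, hD, hpath⟩ := hp
    refine ⟨1 - α, _, Or.inr rfl, fun i => by rw [hpath]; exact hD.res_auto α i,
      (h.sum_abs_first_le hD h.normSq_auto_le).trans
        (mul_le_mul_of_nonneg_right ?_ hcρ)⟩
    linarith
  · obtain ⟨D, E, hD, hE, hpath⟩ := hp
    refine ⟨1 - α, _, Or.inr rfl, fun i => by rw [hpath]; exact hD.res_second hE α i,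
      (h.sum_abs_second_le hC1 hC2 hD h.normSq_auto_le hE
        (h.normSq_second_le hD h.normSq_auto_le)).trans
        (mul_le_mul_of_nonneg_right ?_ hcρ)⟩
    linarith

/-- Short predictor steps barely increase the proximity measure. -/
theorem exists_short_step_const {K γ : ℝ} (hK : 0 < K) (hγ : 0 < γ) :
    ∃ c : ℝ, 0 < c ∧ c ≤ 1 / 2 ∧ ∀ (M : Method) (m n : ℕ) (P : LP m n) (z : State m n)
      (path : ℝ → State m n) (α : ℝ), P.Interior z → P.Psi z ≤ K →
      M.IsPredictorPath P z path → 0 ≤ α → α * z.w.v0 ≤ c * Real.sqrt (n + 1) * z.w.rho →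
      P.Interior (path α) → P.Psi (path α) ≤ P.Psi z + γ := by
  set κ := Real.exp (-(K + 1)) with hκ
  have hκ0 : 0 < κ := Real.exp_pos _
  have hκ1 : κ ≤ 1 := Real.exp_le_one_iff.2 (by linarith)
  set T := 2 * (K + 1) with hT
  set X := Real.sqrt (4 / κ ^ 2 * K) with hX
  have hX2 : X ^ 2 = 4 / κ ^ 2 * K := Real.sq_sqrt (by positivity)
  have hX0 : 0 ≤ X := Real.sqrt_nonneg _
  set C := perturbConst κ T with hC
  have hC0 : 0 < C := by rw [hC, perturbConst]; positivity
  -- Chosen so that the normalized residuals move by at most `c C₄` in `ℓ₂`: the `T X` part bounds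
  -- the rescaling of deviations, the `C` part the perturbation. The three bounds on `c` then meet
  -- the hypotheses of `psi_le_add_of_close` and keep its increase below `γ`.
  set C₄ := 3 * T * X + 6 * C with hC4
  have hT0 : 0 < T := by positivity
  have hC40 : 0 < C₄ := by positivity
  set c := min (1 / 2) (min (κ / (2 * C₄)) (γ / (C₄ * X + 2 * C₄ ^ 2 / κ ^ 2))) with hc
  have hB : 0 < C₄ * X + 2 * C₄ ^ 2 / κ ^ 2 := by positivity
  have hc0 : 0 < c := by
    rw [hc]
    refine lt_min (by norm_num) (lt_min (by positivity) (by positivity))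
  have hc1 : c ≤ 1 / 2 := min_le_left _ _
  have hc2 : c * (2 * C₄) ≤ κ := by
    rw [← le_div_iff₀ (by positivity)]
    exact (min_le_right _ _).trans (min_le_left _ _)
  have hc3 : c * (C₄ * X + 2 * C₄ ^ 2 / κ ^ 2) ≤ γ := by
    rw [← le_div_iff₀ hB]
    exact (min_le_right _ _).trans (min_le_right _ _)
  refine ⟨c, hc0, hc1, fun M m n P z path α hz hΨ hp hα hstep hzα => ?_⟩
  have hρ := hz.rho_pos
  have hs := State.sum_nres hρ
  have hΨ' := hΨ
  rw [hz.Psi_eq] at hΨ'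
  have hlow := exp_le_of_psi_le hz.nres_pos hs hΨ'
  have hup := le_of_psi_le hz.nres_pos hs hΨ'
  have h : ShortStep P z κ T c α :=
    ⟨hz, hκ0, hlow, hup, by rw [hT]; linarith, hα, hc0.le, hc1, hstep⟩
  obtain ⟨μ, f, hμ, hf, hfE⟩ := h.exists_res_eq hp
  have hχ : ∑ i, ((1 - z.nres i) / z.nres i) ^ 2 ≤ X ^ 2 := by
    rw [hX2]
    refine (sum_sq_one_sub_div_le hκ0 hκ1 hlow hs).trans ?_
    gcongr
  have hY : ∑ i, (z.nres i - 1) ^ 2 ≤ T ^ 2 * X ^ 2 := by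
    refine le_trans ?_ (mul_le_mul_of_nonneg_left hχ (sq_nonneg T))
    rw [Finset.mul_sum]
    refine Finset.sum_le_sum fun i _ => ?_
    have h1 : (z.nres i - 1) ^ 2 = z.nres i ^ 2 * ((1 - z.nres i) / z.nres i) ^ 2 := by
      have := (hz.nres_pos i).ne'
      field_simp
      ring
    rw [h1]
    exact mul_le_mul_of_nonneg_right
      (pow_le_pow_left₀ (hz.nres_pos i).le (hup i) 2) (sq_nonneg _)
  have hαc := h.α_le
  have hρα : (path α).w.rho = (1 - α) * (z.w.rho + α * (z.w.sq / (n + 1))) := by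
    rw [Method.predictorPath_w hp, Control.rho_scale]
  have hg : 0 ≤ α * (z.w.sq / (n + 1)) := mul_nonneg hα (ShortStep.sq_div_nonneg z)
  have hg2 : α * (z.w.sq / (n + 1)) ≤ c * z.w.rho := by
    have h1 := h.bounds.2.1
    have h2 : Real.sqrt ((n : ℝ) + 1) ≤ n + 1 := by
      rw [Real.sqrt_le_iff]
      constructor
      · positivity
      · nlinarith [Nat.cast_nonneg (α := ℝ) n]
    rw [← mul_div_assoc, div_le_iff₀ (by positivity)]
    refine h1.trans ?_
    rw [mul_right_comm]
    gcongr
  have hρ1 : z.w.rho / 2 ≤ (path α).w.rho := by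
    rw [hρα]
    nlinarith only [hρ, hg, hαc, hc1]
  have hρα0 : 0 < (path α).w.rho := by linarith
  have hlam : |μ * z.w.rho - (path α).w.rho| ≤ 2 * c * (path α).w.rho := by
    rw [hρα]
    generalize α * (z.w.sq / (n + 1)) = g at hg hg2
    have p1 : 0 ≤ c * (z.w.rho + g) * (1 - 2 * α) :=
      mul_nonneg (mul_nonneg hc0.le (add_nonneg hρ.le hg)) (by linarith)
    have p2 := mul_le_mul_of_nonneg_right hαc (add_nonneg hρ.le hg)
    have p3 := mul_nonneg hα hg
    have p4 := mul_nonneg hc0.le hg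
    have p5 := mul_nonneg hα hρ.le
    rw [abs_le]
    rcases hμ with rfl | rfl <;> constructor <;> linarith
  -- The factor 2 in `E` comes from measuring the perturbation by the new mean, which is at least
  -- half of the old one.
  have hsum := State.sum_sq_nres_sub_le (μ := μ) (E := 2 * C * c ^ 2) (lam := 2 * c) hρ hρα0 hf
    (hfE.trans (by
      have : 2 * C * c ^ 2 * (path α).w.rho = C * (c ^ 2 * (2 * (path α).w.rho)) := by ring
      rw [this]
      gcongr
      linarith)) hlam hY
  have hε : ∑ i, ((path α).nres i - z.nres i) ^ 2 ≤ (c * C₄) ^ 2 := by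
    refine hsum.trans ?_
    have e1 : (2 * (2 * C * c ^ 2)) ^ 2 ≤ 16 * C ^ 2 * c ^ 2 := by
      have : c ^ 2 ≤ 1 := pow_le_one₀ hc0.le (by linarith only [hc1])
      have h2 : (2 * (2 * C * c ^ 2)) ^ 2 = 16 * C ^ 2 * c ^ 2 * c ^ 2 := by ring
      rw [h2]
      exact mul_le_of_le_one_right (by positivity) this
    have e2 : (c * C₄) ^ 2 = c ^ 2 * (9 * (T ^ 2 * X ^ 2) + 36 * C ^ 2 + 36 * (T * X * C)) := by
      rw [hC4]; ring
    have e3 : 0 ≤ c ^ 2 * (T * X * C) := by positivity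
    have e4 : 0 ≤ c ^ 2 * (T ^ 2 * X ^ 2) := by positivity
    have e5 : 0 ≤ c ^ 2 * C ^ 2 := by positivity
    rw [e2]
    linarith only [e1, e3, e4, e5]
  rw [hz.Psi_eq, hzα.Psi_eq]
  refine (psi_le_add_of_close (ε := c * C₄) (X := X) hκ0 hlow hs (State.sum_nres hρα0) hχ hX0
    (by positivity) (by linarith) hε).trans ?_
  have e6 : c * C₄ * X + 2 * (c * C₄) ^ 2 / κ ^ 2 ≤ c * (C₄ * X + 2 * C₄ ^ 2 / κ ^ 2) := by
    have h1 : 2 * (c * C₄) ^ 2 / κ ^ 2 = c * (c * (2 * C₄ ^ 2 / κ ^ 2)) := by ring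
    have h2 : c * (2 * C₄ ^ 2 / κ ^ 2) ≤ 1 * (2 * C₄ ^ 2 / κ ^ 2) := by
      gcongr
      linarith
    rw [h1, mul_add]
    have := mul_le_mul_of_nonneg_left h2 hc0.le
    linarith
  linarith

/-! ### Optimality and the full predictor step -/

theorem LP.isOptimal_of_gap_nonpos {u : Point m n} (hx : P.PrimalFeasible u.x)
    (hs : P.DualFeasible u.s u.y) (hgap : u.s ⬝ᵥ u.x ≤ 0) : P.IsOptimal u := by
  have h0 := LP.gap_eq hx.1 hs.1
  refine ⟨hx, hs, fun x hx' => ?_, fun s y hs' => ?_⟩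
  · have h1 := LP.gap_eq (u := ⟨x, u.s, u.y⟩) hx'.1 hs.1
    have h2 : 0 ≤ u.s ⬝ᵥ x := Finset.sum_nonneg fun i _ => mul_nonneg (hs.2 i) (hx'.2 i)
    simp only at h1
    linarith
  · have h1 := LP.gap_eq (u := ⟨u.x, s, y⟩) hx.1 hs'.1
    have h2 : 0 ≤ s ⬝ᵥ u.x := Finset.sum_nonneg fun i _ => mul_nonneg (hs'.2 i) (hx.2 i)
    simp only at h1
    linarith

theorem Control.InTarget.scale {w : Control n} (hw : w.InTarget) {α : ℝ} (h0 : 0 ≤ α)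
    (h1 : α < 1) : (w.scale (1 - α)).InTarget := by
  have h2 : (w.scale (1 - α)).sq = (1 - α) ^ 2 * w.sq := by
    simp [Control.sq, Control.scale, mul_pow, Finset.mul_sum]
  have h3 : 0 < 1 - α := by linarith
  refine ⟨mul_nonneg h3.le hw.1, ?_⟩
  rw [h2, pow_two, mul_assoc]
  refine mul_lt_mul_of_pos_left ?_ h3
  have h4 : (1 - α) * w.sq ≤ 1 * w.sq :=
    mul_le_mul_of_nonneg_right (by linarith) w.sq_nonneg
  linarith [hw.2]

theorem Control.scale_one (w : Control n) : w.scale (1 - 0) = w := by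
  ext <;> simp [Control.scale]

theorem Point.continuous_move_x {u D : ℝ → Point m n} {f : ℝ → ℝ} (hf : Continuous f)
    (hu : ∀ i, Continuous fun α => (u α).x i) (hD : ∀ i, Continuous fun α => (D α).x i)
    (i : Fin n) : Continuous fun α => ((u α).move (f α) (D α)).x i :=
  (hu i).add (hf.mul (hD i))

theorem Point.continuous_move_s {u D : ℝ → Point m n} {f : ℝ → ℝ} (hf : Continuous f)
    (hu : ∀ i, Continuous fun α => (u α).s i) (hD : ∀ i, Continuous fun α => (D α).s i)
    (i : Fin n) : Continuous fun α => ((u α).move (f α) (D α)).s i :=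
  (hu i).add (hf.mul (hD i))

theorem Method.predictorPath_props {M : Method} {z : State m n} {path : ℝ → State m n}
    (hp : M.IsPredictorPath P z path) (hf1 : P.A *ᵥ z.u.x = P.b)
    (hf2 : z.u.s + P.Aᵀ *ᵥ z.u.y = P.c) :
    path 0 = z ∧ (∀ α, P.A *ᵥ (path α).u.x = P.b ∧
      (path α).u.s + P.Aᵀ *ᵥ (path α).u.y = P.c) ∧
      (∀ i, Continuous fun α => (path α).u.x i) ∧ ∀ i, Continuous fun α => (path α).u.s i := by
  have hone : ∀ D : Point m n, (∀ i, Continuous fun α => (z.u.move α D).x i) ∧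
      ∀ i, Continuous fun α => (z.u.move α D).s i := fun D =>
    ⟨Point.continuous_move_x (u := fun _ => z.u) (D := fun _ => D) continuous_id
      (fun _ => continuous_const) fun _ => continuous_const,
    Point.continuous_move_s (u := fun _ => z.u) (D := fun _ => D) continuous_id
      (fun _ => continuous_const) fun _ => continuous_const⟩
  cases M
  · obtain ⟨D, hD, h⟩ := hp
    simp only [h]
    exact ⟨by rw [Point.move_zero, Control.scale_one], fun α => hD.move_feasible hf1 hf2 α,
      hone D⟩
  · obtain ⟨D, hD, h⟩ := hp
    simp only [h]
    exact ⟨by rw [Point.move_zero, Control.scale_one], fun α => hD.move_feasible hf1 hf2 α,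
      hone D⟩
  · obtain ⟨D, E, hD, hE, h⟩ := hp
    simp only [h]
    refine ⟨?_, fun α => ?_, ?_, ?_⟩
    · rw [Control.scale_one, zero_pow two_ne_zero, Point.move_zero, Point.move_zero]
    · obtain ⟨g1, g2⟩ := hD.move_feasible hf1 hf2 α
      exact hE.move_feasible g1 g2 _
    · exact Point.continuous_move_x (u := fun α => z.u.move α D) (D := fun _ => E)
        (continuous_pow 2) (hone D).1 fun _ => continuous_const
    · exact Point.continuous_move_s (u := fun α => z.u.move α D) (D := fun _ => E)
        (continuous_pow 2) (hone D).2 fun _ => continuous_const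

theorem nonneg_at_right_end {f : ℝ → ℝ} (hf : Continuous f) {a b : ℝ} (hab : a < b)
    (h : ∀ x, a ≤ x → x < b → 0 ≤ f x) : 0 ≤ f b := by
  have h1 : closure (Set.Ico a b) ⊆ {x | 0 ≤ f x} :=
    closure_minimal (fun x hx => h x hx.1 hx.2) (isClosed_le continuous_const hf)
  rw [closure_Ico hab.ne] at h1
  exact h1 ⟨hab.le, le_rfl⟩

theorem Method.continuous_res {M : Method} {z : State m n} {path : ℝ → State m n}
    (hp : M.IsPredictorPath P z path)
    (hcx : ∀ i, Continuous fun α => (path α).u.x i)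
    (hcs : ∀ i, Continuous fun α => (path α).u.s i) (i : Fin (n + 1)) :
    Continuous fun α => (path α).res i := by
  refine Fin.cases ?_ (fun i => ?_) i
  · simp only [State.res_zero, dotProduct_comm_sum, Method.predictorPath_w hp, Control.scale]
    exact ((continuous_const.sub continuous_id).mul continuous_const).sub
      (continuous_finsetSum _ fun i _ => (hcx i).mul (hcs i))
  · simp only [State.res_succ, Method.predictorPath_w hp, Control.scale_v]
    exact ((hcx i).mul (hcs i)).sub
      (((continuous_const.sub continuous_id).mul continuous_const).pow 2)

/-- If the predictor equation has no root, the whole predictor path is interior. -/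
theorem LP.Interior.predictorPath_interior {M : Method} {z : State m n} (hz : P.Interior z)
    {p : Params} (hη : 0 ≤ p.eta) (hω : 0 ≤ omegaStar p.r) (hΨ : P.Psi z < omegaStar p.r)
    {path : ℝ → State m n} (hp : M.IsPredictorPath P z path)
    (hroot : ∀ α, ¬ P.ApproxRoot p path α) {α₁ : ℝ} (h0 : 0 ≤ α₁) (h1 : α₁ < 1) :
    P.Interior (path α₁) := by
  obtain ⟨e0, hfeas, hcx, hcs⟩ := Method.predictorPath_props hp hz.1.1 hz.1.2.1
  have hcr := Method.continuous_res hp hcx hcs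
  have htarget : ∀ α, 0 ≤ α → α < 1 → (path α).w.InTarget := fun α h h' => by
    rw [Method.predictorPath_w hp]
    exact hz.2.1.scale h h'
  have hmk : ∀ α, 0 ≤ α → α < 1 → (∀ i, 0 < (path α).u.x i) → (∀ i, 0 < (path α).u.s i) →
      (∀ i, 0 < (path α).res i) → P.Interior (path α) := fun α h h' hx hs hr =>
    LP.interior_of_pos (hfeas α).1 (hfeas α).2 (htarget α h h') hx hs hr
  set bad : Set ℝ := Set.Icc 0 α₁ ∩ ((⋃ i, {α | (path α).u.x i ≤ 0}) ∪
    ((⋃ i, {α | (path α).u.s i ≤ 0}) ∪ ⋃ i, {α | (path α).res i ≤ 0})) with hbad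
  have hgood : ∀ α ∈ Set.Icc 0 α₁, α ∉ bad → P.Interior (path α) := by
    intro α hα hnb
    simp only [hbad, Set.mem_inter_iff, hα, true_and, Set.mem_union, Set.mem_iUnion,
      Set.mem_ofPred_eq, not_or, not_exists, not_le] at hnb
    exact hmk α hα.1 (hα.2.trans_lt h1) hnb.1 hnb.2.1 hnb.2.2
  by_contra hcon
  have hne : bad.Nonempty := ⟨α₁, by
    by_contra h
    exact hcon (hgood α₁ ⟨h0, le_rfl⟩ h)⟩
  have hclosed : IsClosed ((⋃ i, {α | (path α).u.x i ≤ 0}) ∪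
      ((⋃ i, {α | (path α).u.s i ≤ 0}) ∪ ⋃ i, {α | (path α).res i ≤ 0})) :=
    (isClosed_iUnion_of_finite fun i => isClosed_le (hcx i) continuous_const).union
      ((isClosed_iUnion_of_finite fun i => isClosed_le (hcs i) continuous_const).union
      (isClosed_iUnion_of_finite fun i => isClosed_le (hcr i) continuous_const))
  -- `a` is the first exit from the interior. Some residual vanishes there, since positive residuals
  -- would keep every `x i * s i`, and hence `x` and `s`, positive.
  obtain ⟨a, ⟨ha, ha'⟩, hleast⟩ := (isCompact_Icc.inter_right hclosed).exists_isLeast hne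
  have hbelow : ∀ α, 0 ≤ α → α < a → P.Interior (path α) := fun α h h' =>
    hgood α ⟨h, h'.le.trans ha.2⟩ fun hb => absurd (hleast hb) (not_le.2 h')
  have ha0 : 0 < a := by
    refine lt_of_le_of_ne ha.1 fun h => ?_
    rw [← h] at ha'
    simp only [Set.mem_union, Set.mem_iUnion, Set.mem_ofPred_eq, e0] at ha'
    rcases ha' with ⟨i, hi⟩ | ⟨i, hi⟩ | ⟨i, hi⟩
    · exact absurd (hz.1.2.2.1 i) (not_lt.2 hi)
    · exact absurd (hz.1.2.2.2 i) (not_lt.2 hi)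
    · exact absurd (hz.res_pos i) (not_lt.2 hi)
  have ha1 : a < 1 := ha.2.trans_lt h1
  have hxa : ∀ i, 0 ≤ (path a).u.x i := fun i =>
    nonneg_at_right_end (hcx i) ha0 fun α h h' => ((hbelow α h h').1.2.2.1 i).le
  have hsa : ∀ i, 0 ≤ (path a).u.s i := fun i =>
    nonneg_at_right_end (hcs i) ha0 fun α h h' => ((hbelow α h h').1.2.2.2 i).le
  have hra : ∃ i, (path a).res i ≤ 0 := by
    by_contra! hr
    have hxs : ∀ i, 0 < (path a).u.x i * (path a).u.s i := fun i => by
      have := hr i.succ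
      rw [State.res_succ] at this
      exact (sq_nonneg ((path a).w.v i)).trans_lt (by linarith)
    simp only [Set.mem_union, Set.mem_iUnion, Set.mem_ofPred_eq] at ha'
    rcases ha' with ⟨i, hi⟩ | ⟨i, hi⟩ | ⟨i, hi⟩
    · have := le_antisymm hi (hxa i)
      exact absurd (hxs i) (by rw [this, zero_mul]; exact lt_irrefl 0)
    · have := le_antisymm hi (hsa i)
      exact absurd (hxs i) (by rw [this, mul_zero]; exact lt_irrefl 0)
    · exact absurd (hr i) (not_lt.2 hi)
  obtain ⟨i₀, hi₀⟩ := hra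
  have hi₀' : (path a).res i₀ = 0 := le_antisymm hi₀
    (nonneg_at_right_end (hcr i₀) ha0 fun α h h' => ((hbelow α h h').res_pos i₀).le)
  have hρc : Continuous fun α => (path α).w.rho := by
    simp only [Method.predictorPath_w hp, Control.rho_scale]
    fun_prop
  -- The product is `exp (-Ψ)` at interior points and extends continuously by 0 to the exit point,
  -- where `Ψ` blows up. The intermediate value theorem applied to it produces an exact root of the
  -- predictor equation, a contradiction.
  have hcont : ContinuousOn (fun α => ∏ i, (path α).nres i) (Set.Icc 0 a) := by
    refine continuousOn_finsetProd _ fun i _ => ?_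
    exact (hcr i).continuousOn.div hρc.continuousOn fun α hα =>
      (Control.rho_pos (htarget α hα.1 (hα.2.trans_lt ha1))).ne'
  have hprod : ∀ α, P.Interior (path α) →
      Real.log (∏ i, (path α).nres i) = -P.Psi (path α) := by
    intro α hα
    rw [hα.Psi_eq, psi, neg_neg, Real.log_prod fun i _ => (hα.nres_pos i).ne']
  have hend : ∏ i, (path a).nres i = 0 := Finset.prod_eq_zero (Finset.mem_univ i₀) (by
    rw [State.nres, hi₀', zero_div])
  have hstart : Real.exp (-omegaStar p.r) ≤ ∏ i, (path 0).nres i := by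
    rw [e0]
    have hpos : 0 < ∏ i, z.nres i := Finset.prod_pos fun i _ => hz.nres_pos i
    rw [← Real.le_log_iff_exp_le hpos]
    have := hprod 0 (by rw [e0]; exact hz)
    rw [e0] at this
    rw [this]
    linarith
  obtain ⟨α, hα, hαe⟩ := intermediate_value_Icc' ha.1 hcont
    (show Real.exp (-omegaStar p.r) ∈ Set.Icc _ _ from ⟨by
      simp only [hend]; exact (Real.exp_pos _).le, hstart⟩)
  simp only at hαe
  have hαa : α < a := by
    refine lt_of_le_of_ne hα.2 fun h => ?_
    rw [h, hend] at hαe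
    exact absurd hαe (Real.exp_pos _).ne
  have hint := hbelow α hα.1 hαa
  have hΨα : P.Psi (path α) = omegaStar p.r := by
    have := hprod α hint
    rw [hαe, Real.log_exp] at this
    linarith
  have hα0 : 0 < α := by
    refine lt_of_le_of_ne hα.1 fun h => ?_
    rw [← h, e0] at hΨα
    linarith
  refine hroot α ⟨hα0, hαa.trans ha1, hint, ?_⟩
  rw [hΨα, sub_self, abs_zero]
  positivity

/-- If the predictor equation has no root, the full predictor step ends at an optimal solution. -/
theorem LP.Interior.fullStep_isOptimal {M : Method} {z : State m n} (hz : P.Interior z)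
    {p : Params} (hη : 0 ≤ p.eta) (hω : 0 ≤ omegaStar p.r) (hΨ : P.Psi z < omegaStar p.r)
    {path : ℝ → State m n} (hp : M.IsPredictorPath P z path)
    (hroot : ∀ α, ¬ P.ApproxRoot p path α) : P.IsOptimal (path 1).u := by
  obtain ⟨-, hfeas, hcx, hcs⟩ := Method.predictorPath_props hp hz.1.1 hz.1.2.1
  have hint : ∀ α, 0 ≤ α → α < 1 → P.Interior (path α) := fun α h h' =>
    hz.predictorPath_interior hη hω hΨ hp hroot h h'
  have hgap := nonneg_at_right_end (Method.continuous_res hp hcx hcs 0) one_pos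
    fun α h h' => ((hint α h h').res_pos 0).le
  rw [State.res_zero, Method.predictorPath_w hp] at hgap
  simp only [Control.scale, sub_self, zero_mul, zero_sub, Left.nonneg_neg_iff] at hgap
  exact LP.isOptimal_of_gap_nonpos
    ⟨(hfeas 1).1, fun i => nonneg_at_right_end (hcx i) one_pos fun α h h' =>
      ((hint α h h').1.2.2.1 i).le⟩
    ⟨(hfeas 1).2, fun i => nonneg_at_right_end (hcs i) one_pos fun α h h' =>
      ((hint α h h').1.2.2.2 i).le⟩ hgap

/-! ### Duality, complementarity and the optimal basis -/

section Duality

variable {u0 u : Point m n}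

/-- Adding a null vector of `Aᵀ` to `y` changes neither the dual slack nor the dual objective, so
uniqueness of `y` excludes it. -/
theorem LP.IsOptimal.transpose_injective (hopt : P.IsOptimal u)
    (huniq : ∀ u', P.IsOptimal u' → u' = u) (g : Fin m → ℝ) (hg : P.Aᵀ *ᵥ g = 0) : g = 0 := by
  obtain ⟨hx, hs, hxo, hso⟩ := hopt
  have hb : P.b ⬝ᵥ (u.y + g) = P.b ⬝ᵥ u.y := by
    rw [dotProduct_add, ← hx.1, dotProduct_comm _ g, dotProduct_mulVec, ← mulVec_transpose, hg,
      zero_dotProduct, add_zero]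
  have h := huniq ⟨u.x, u.s, u.y + g⟩ ⟨hx, ⟨by simp only [mulVec_add, hg, add_zero, hs.1], hs.2⟩,
    hxo, fun s y h => by simp only [hb]; exact hso s y h⟩
  have := congrArg Point.y h
  simpa using this

theorem exists_pos_forall_le {ι : Type*} [Finite ι] (f : ι → ℝ) (hf : ∀ i, 0 < f i) :
    ∃ c : ℝ, 0 < c ∧ ∀ i, c ≤ f i := by
  rcases isEmpty_or_nonempty ι with h | h
  · exact ⟨1, one_pos, fun i => h.elim i⟩
  · obtain ⟨i, hi⟩ := Finite.exists_min f
    exact ⟨f i, hf i, hi⟩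

theorem exists_small_multiple_le (a b : Fin n → ℝ) :
    ∃ ε : ℝ, 0 < ε ∧ ∀ i, 0 < a i → ε * |b i| ≤ a i := by
  obtain ⟨c, hc, h⟩ := exists_pos_forall_le (fun i : {i // 0 < a i} => a i / (|b i| + 1))
    fun i => div_pos i.2 (by positivity)
  refine ⟨c, hc, fun i hi => ?_⟩
  have h1 := h ⟨i, hi⟩
  simp only at h1
  rw [le_div_iff₀ (by positivity)] at h1
  linarith

/-- The pair of problems has no duality gap. -/
theorem LP.IsOptimal.gap_eq_zero (hu0 : P.StrictlyFeasible u0) (hopt : P.IsOptimal u)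
    (huniq : ∀ u', P.IsOptimal u' → u' = u) (hsc : ∀ i, 0 < u.x i + u.s i) :
    u.s ⬝ᵥ u.x = 0 := by
  have hinj := hopt.transpose_injective huniq
  obtain ⟨hx, hs, hxo, hso⟩ := hopt
  obtain ⟨h01, h02, hx0, hs0⟩ := hu0
  have hG : 0 ≤ u.s ⬝ᵥ u.x := Finset.sum_nonneg fun i _ => mul_nonneg (hs.2 i) (hx.2 i)
  by_contra hne
  have hGpos : 0 < u.s ⬝ᵥ u.x := lt_of_le_of_ne hG (Ne.symm hne)
  have hG0 : 0 ≤ u0.s ⬝ᵥ u0.x :=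
    Finset.sum_nonneg fun i _ => mul_nonneg (hs0 i).le (hx0 i).le
  obtain ⟨c, hc, hcσ⟩ := exists_pos_forall_le (fun i => u.x i * u0.s i + u.s i * u0.x i) (by
    intro i
    have h1 := mul_nonneg (hx.2 i) (hs0 i).le
    have h2 := mul_nonneg (hs.2 i) (hx0 i).le
    rcases (hx.2 i).lt_or_eq with h | h
    · have := mul_pos h (hs0 i)
      linarith
    · have h3 : 0 < u.s i := by
        have := hsc i
        rwa [← h, zero_add] at this
      have := mul_pos h3 (hx0 i)
      linarith)
  set G := u.s ⬝ᵥ u.x with hGdef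
  set G0 := u0.s ⬝ᵥ u0.x with hG0def
  set G1 := G + G0 with hG1
  -- Mixing in a fraction `ε` of order `α²` of the strictly feasible point costs `O(α²)` in the gap,
  -- yet raises the products `x i * s i` enough for an affine scaling step of length `α`. That step
  -- gains a multiple `α` of the gap, which wins for small `α` if the optimal gap `G` is positive.
  obtain ⟨α, hα0, hα1, hα2, hα3⟩ : ∃ α : ℝ, 0 < α ∧ α < 1 ∧ 4 * α ^ 2 * G1 / c < 1 / 2 ∧
      4 * α * G1 * G0 / c < G := by
    have h1 : ∀ᶠ α in nhdsWithin (0 : ℝ) (Set.Ioi 0), α < 1 :=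
      nhdsWithin_le_nhds (gt_mem_nhds one_pos)
    have h2 : ∀ᶠ α in nhdsWithin (0 : ℝ) (Set.Ioi 0), 4 * α ^ 2 * G1 / c < 1 / 2 :=
      nhdsWithin_le_nhds ((by fun_prop : Continuous fun α : ℝ => 4 * α ^ 2 * G1 / c).tendsto 0
        |>.eventually (gt_mem_nhds (by norm_num)))
    have h3 : ∀ᶠ α in nhdsWithin (0 : ℝ) (Set.Ioi 0), 4 * α * G1 * G0 / c < G :=
      nhdsWithin_le_nhds ((by fun_prop : Continuous fun α : ℝ => 4 * α * G1 * G0 / c).tendsto 0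
        |>.eventually (gt_mem_nhds (by simpa using hGpos)))
    have h4 : ∀ᶠ α in nhdsWithin (0 : ℝ) (Set.Ioi 0), 0 < α := self_mem_nhdsWithin
    obtain ⟨α, h⟩ := (h4.and (h1.and (h2.and h3))).exists
    exact ⟨α, h.1, h.2.1, h.2.2.1, h.2.2.2⟩
  set ε := 4 * α ^ 2 * G1 / c with hε
  have hG1pos : 0 < G1 := by linarith
  have hε0 : 0 < ε := by positivity
  have hεc : ε * c = 4 * α ^ 2 * G1 := by rw [hε]; field_simp
  -- a strictly feasible point close to the optimal one
  set N : Point m n := ⟨u0.x - u.x, u0.s - u.s, u0.y - u.y⟩ with hN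
  have hN1 : P.A *ᵥ N.x = 0 := by simp only [hN, mulVec_sub, h01, hx.1, sub_self]
  have hN2 : N.s + P.Aᵀ *ᵥ N.y = 0 := by
    simp only [hN, mulVec_sub]
    rw [← sub_self P.c]
    nth_rw 1 [← h02]
    rw [← hs.1]
    abel
  have hNt : P.IsTangent u (u.x * N.s + u.s * N.x) N := ⟨rfl, hN1, hN2⟩
  obtain ⟨f1, f2⟩ := hNt.move_feasible hx.1 hs.1 ε
  set v := u.move ε N with hv
  have hvx : ∀ i, v.x i = (1 - ε) * u.x i + ε * u0.x i := fun i => by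
    simp [hv, hN, Point.move]; ring
  have hvs : ∀ i, v.s i = (1 - ε) * u.s i + ε * u0.s i := fun i => by
    simp [hv, hN, Point.move]; ring
  have hε1 : 0 ≤ 1 - ε := by linarith
  have hvx0 : ∀ i, 0 < v.x i := fun i => by
    rw [hvx]
    exact add_pos_of_nonneg_of_pos (mul_nonneg hε1 (hx.2 i)) (mul_pos hε0 (hx0 i))
  have hvs0 : ∀ i, 0 < v.s i := fun i => by
    rw [hvs]
    exact add_pos_of_nonneg_of_pos (mul_nonneg hε1 (hs.2 i)) (mul_pos hε0 (hs0 i))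
  have hvprod : ∀ i, ε * c / 2 ≤ v.x i * v.s i := by
    intro i
    have h1 : v.x i * v.s i = (1 - ε) ^ 2 * (u.x i * u.s i) + ε ^ 2 * (u0.x i * u0.s i)
        + (1 - ε) * ε * (u.x i * u0.s i + u.s i * u0.x i) := by
      rw [hvx, hvs]; ring
    have h2 : 0 ≤ (1 - ε) ^ 2 * (u.x i * u.s i) :=
      mul_nonneg (sq_nonneg _) (mul_nonneg (hx.2 i) (hs.2 i))
    have h3 : 0 ≤ ε ^ 2 * (u0.x i * u0.s i) :=
      mul_nonneg (sq_nonneg _) (mul_nonneg (hx0 i).le (hs0 i).le)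
    have h4 : (1 - ε) * ε * c ≤ (1 - ε) * ε * (u.x i * u0.s i + u.s i * u0.x i) :=
      mul_le_mul_of_nonneg_left (hcσ i) (mul_nonneg hε1 hε0.le)
    have h5 : ε * c / 2 ≤ (1 - ε) * ε * c := by
      have := mul_pos hε0 hc
      nlinarith
    linarith
  have hvgap : v.s ⬝ᵥ v.x = (1 - ε) * G + ε * G0 := by
    have h1 := LP.gap_eq hx.1 hs.1
    have h2 := LP.gap_eq h01 h02
    rw [← LP.gap_eq f1 f2, hGdef, hG0def, ← h1, ← h2]
    have e1 : v.x = (1 - ε) • u.x + ε • u0.x := by ext i; simp [hvx]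
    have e2 : v.y = (1 - ε) • u.y + ε • u0.y := by
      ext i; simp [hv, hN, Point.move]; ring
    rw [e1, e2]
    simp only [dotProduct_add, dotProduct_smul, smul_eq_mul]
    ring
  -- an affine scaling step from there
  obtain ⟨D, hD⟩ := LP.exists_isTangent hinj hvx0 hvs0 (fun i => -(v.x i * v.s i))
  have hnorm : v.normSq (fun i => -(v.x i * v.s i)) = v.s ⬝ᵥ v.x := by
    rw [Point.normSq, dotProduct_comm_sum]
    refine Finset.sum_congr rfl fun i _ => ?_
    have := (mul_pos (hvx0 i) (hvs0 i)).ne'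
    rw [neg_sq, sq, mul_div_assoc, div_self this, mul_one]
  have hmv := hD.move_pos hvx0 hvs0 (α := α) fun i => by
    refine lt_of_lt_of_le ?_ (hvprod i)
    rw [hnorm, hvgap, hεc]
    have h1 : (1 - ε) * G + ε * G0 ≤ G1 := by
      have := mul_nonneg hε0.le hGpos.le
      have : ε * G0 ≤ 1 * G0 := mul_le_mul_of_nonneg_right (by linarith) hG0
      linarith
    have h2 : α ^ 2 * ((1 - ε) * G + ε * G0) ≤ α ^ 2 * G1 :=
      mul_le_mul_of_nonneg_left h1 (sq_nonneg α)
    have h3 : 0 < α ^ 2 * G1 := by positivity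
    linarith
  obtain ⟨k1, k2⟩ := hD.move_feasible f1 f2 α
  have hgap' : (v.move α D).s ⬝ᵥ (v.move α D).x = (1 - α) * (v.s ⬝ᵥ v.x) := by
    simp only [dotProduct_comm_sum, hD.move_mul, Finset.sum_add_distrib, ← Finset.mul_sum,
      P.dotProduct_eq_zero hD.2.1 hD.2.2, Finset.sum_neg_distrib]
    ring
  have hge : G ≤ (v.move α D).s ⬝ᵥ (v.move α D).x := by
    rw [← LP.gap_eq k1 k2, hGdef, ← LP.gap_eq hx.1 hs.1]
    have := hxo _ ⟨k1, fun i => (hmv.1 i).le⟩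
    have := hso _ _ ⟨k2, fun i => (hmv.2 i).le⟩
    linarith
  rw [hgap', hvgap] at hge
  have h5 : α * G ≤ ε * G0 := by
    have h6 := mul_nonneg hε0.le hGpos.le
    have h7 := mul_nonneg hε0.le hG0
    nlinarith [mul_nonneg hα0.le h7, mul_nonneg (by linarith : 0 ≤ 1 - α) h6]
  have h8 : ε * G0 = α * (4 * α * G1 * G0 / c) := by rw [hε]; ring
  rw [h8] at h5
  exact absurd (le_of_mul_le_mul_left h5 hα0) (not_le.2 hα3)

/-- `u` is a strictly complementary solution that is the only optimal one. -/
structure LP.UniqueSolution (P : LP m n) (u : Point m n) : Prop where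
  optimal : P.IsOptimal u
  unique : ∀ u', P.IsOptimal u' → u' = u
  comp : ∀ i, 0 < u.x i ∧ u.s i = 0 ∨ u.x i = 0 ∧ 0 < u.s i

theorem LP.IsOptimal.uniqueSolution (hu0 : P.StrictlyFeasible u0) (hopt : P.IsOptimal u)
    (huniq : ∀ u', P.IsOptimal u' → u' = u) (hsc : ∀ i, 0 < u.x i + u.s i) :
    P.UniqueSolution u := by
  refine ⟨hopt, huniq, fun i => ?_⟩
  have h := hopt.gap_eq_zero hu0 huniq hsc
  have hx := hopt.1.2
  have hs := hopt.2.1.2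
  have h1 : u.s i * u.x i = 0 :=
    (Finset.sum_eq_zero_iff_of_nonneg fun i _ => mul_nonneg (hs i) (hx i)).1 h i
      (Finset.mem_univ i)
  have h2 := hsc i
  rcases mul_eq_zero.1 h1 with h3 | h3
  · left
    rw [h3, add_zero] at h2
    exact ⟨h2, h3⟩
  · right
    rw [h3, zero_add] at h2
    exact ⟨h3, h2⟩

/-! ### Uniqueness makes the support of `x*` a nonsingular basis. -/

namespace LP.UniqueSolution

/-- Moving `y` a little along `g` keeps `s` zero on the support of `x` and positive elsewhere, so a
nonzero `g` would give a second complementary solution. -/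
theorem row_injective (h : P.UniqueSolution u) {g : Fin m → ℝ}
    (hg : ∀ i, 0 < u.x i → (P.Aᵀ *ᵥ g) i = 0) : g = 0 := by
  obtain ⟨ε, hε, hle⟩ := exists_small_multiple_le u.s (P.Aᵀ *ᵥ g)
  have hopt : P.IsOptimal ⟨u.x, u.s - ε • (P.Aᵀ *ᵥ g), u.y + ε • g⟩ := by
    refine LP.isOptimal_of_gap_nonpos h.optimal.1 ⟨?_, fun i => ?_⟩ ?_
    · rw [← h.optimal.2.1.1, mulVec_add, mulVec_smul]
      simp only
      abel
    · simp only [Pi.sub_apply, Pi.smul_apply, smul_eq_mul]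
      rcases h.comp i with ⟨hx, hs⟩ | ⟨-, hs⟩
      · rw [hg i hx, hs]; simp
      · have h1 := mul_le_mul_of_nonneg_left (le_abs_self ((P.Aᵀ *ᵥ g) i)) hε.le
        linarith [hle i hs]
    · refine le_of_eq (Finset.sum_eq_zero fun i _ => ?_)
      simp only [Pi.sub_apply, Pi.smul_apply, smul_eq_mul]
      rcases h.comp i with ⟨hx, hs⟩ | ⟨hx, -⟩
      · rw [hg i hx, hs]; simp
      · rw [hx, mul_zero]
  have h1 := congrArg Point.y (h.unique _ hopt)
  simp only [add_eq_left, smul_eq_zero] at h1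
  exact h1.resolve_left hε.ne'

theorem col_injective (h : P.UniqueSolution u) {f : Fin n → ℝ} (hA : P.A *ᵥ f = 0)
    (hf : ∀ i, u.x i = 0 → f i = 0) : f = 0 := by
  obtain ⟨ε, hε, hle⟩ := exists_small_multiple_le u.x f
  have hopt : P.IsOptimal ⟨u.x + ε • f, u.s, u.y⟩ := by
    refine LP.isOptimal_of_gap_nonpos ⟨?_, fun i => ?_⟩ h.optimal.2.1 ?_
    · rw [← h.optimal.1.1, mulVec_add, mulVec_smul, hA, smul_zero, add_zero]
    · simp only [Pi.add_apply, Pi.smul_apply, smul_eq_mul]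
      rcases h.comp i with ⟨hx, -⟩ | ⟨hx, -⟩
      · have h1 := mul_le_mul_of_nonneg_left (neg_abs_le (f i)) hε.le
        linarith [hle i hx]
      · rw [hf i hx, hx]; simp
    · refine le_of_eq (Finset.sum_eq_zero fun i _ => ?_)
      simp only [Pi.add_apply, Pi.smul_apply, smul_eq_mul]
      rcases h.comp i with ⟨-, hs⟩ | ⟨hx, -⟩
      · rw [hs, zero_mul]
      · rw [hf i hx, hx]; simp
  have h1 := congrArg Point.x (h.unique _ hopt)
  simp only [add_eq_left, smul_eq_zero] at h1
  exact h1.resolve_left hε.ne'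

/-- The columns of `A` on the support are independent by `col_injective`, and they span by
`row_injective`. -/
theorem card_basis (h : P.UniqueSolution u) : Fintype.card {i // 0 < u.x i} = m := by
  set M : Matrix (Fin m) {i // 0 < u.x i} ℝ := P.A.submatrix id Subtype.val with hM
  apply le_antisymm
  · have hinj : Function.Injective M.mulVecLin := by
      rw [injective_iff_map_eq_zero]
      intro f hf
      set f' : Fin n → ℝ := fun i => if hi : 0 < u.x i then f ⟨i, hi⟩ else 0 with hf'
      have h1 : P.A *ᵥ f' = M *ᵥ f := by
        ext i
        simp only [mulVec, dotProduct, hM, submatrix_apply, id]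
        refine (Fintype.sum_of_injective Subtype.val Subtype.val_injective _ _ ?_ ?_).symm
        · intro j hj
          have : ¬ 0 < u.x j := fun hpos => hj ⟨⟨j, hpos⟩, rfl⟩
          simp [hf', this]
        · intro j
          simp [hf', j.2]
      have h2 := h.col_injective (f := f') (by rw [h1]; exact hf) fun i hi => by
        simp [hf', hi]
      ext i
      have h3 := congrFun h2 i
      simpa [hf', i.2] using h3
    have := LinearMap.finrank_le_finrank_of_injective hinj
    simpa using this
  · have hinj : Function.Injective Mᵀ.mulVecLin := by
      rw [injective_iff_map_eq_zero]
      intro g hg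
      exact h.row_injective fun i hi => congrFun hg ⟨i, hi⟩
    have := LinearMap.finrank_le_finrank_of_injective hinj
    simpa using this

end LP.UniqueSolution

/-! ### The termination test -/

theorem LP.mulVec_extend_basis (hmn : m ≤ n) (τ : Equiv.Perm (Fin n)) (f : Fin m → ℝ) :
    P.A *ᵥ (fun j => if h : (τ.symm j : ℕ) < m then f ⟨τ.symm j, h⟩ else 0)
      = P.basisMatrix hmn τ *ᵥ f := by
  ext i
  refine (Fintype.sum_of_injective (fun k : Fin m => τ (Fin.castLE hmn k))
    (τ.injective.comp (Fin.castLE_injective hmn)) _ _ ?_ ?_).symm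
  · intro j hj
    have : ¬ (τ.symm j : ℕ) < m := fun h => hj ⟨⟨τ.symm j, h⟩, by simp⟩
    simp [this]
  · intro k
    simp [LP.basisMatrix]

/-- The candidate satisfies the equations and is complementary by construction; nonnegativity is all
that the test adds. An early success is therefore never wrong. -/
theorem LP.TestSucceeds.isOptimal {hmn : m ≤ n} {τ : Equiv.Perm (Fin n)}
    (h : P.TestSucceeds hmn τ) : P.IsOptimal (P.candidate hmn τ) := by
  obtain ⟨hdet, hx, hs⟩ := h
  refine LP.isOptimal_of_gap_nonpos ⟨?_, hx⟩ ⟨?_, hs⟩ ?_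
  · rw [LP.candidate, LP.mulVec_extend_basis hmn, mulVec_mulVec, mul_nonsing_inv _ hdet, one_mulVec]
  · have hy : (P.basisMatrix hmn τ)ᵀ *ᵥ P.candY hmn τ
        = fun i => P.c (τ (Fin.castLE hmn i)) := by
      rw [LP.candY, mulVec_mulVec, mul_nonsing_inv _ (by rwa [det_transpose]), one_mulVec]
    ext j
    simp only [LP.candidate, Pi.add_apply]
    split_ifs with hj
    · have h1 := congrFun hy ⟨τ.symm j, hj⟩
      have h2 : τ (Fin.castLE hmn ⟨τ.symm j, hj⟩) = j := by simp
      have h3 : ((P.basisMatrix hmn τ)ᵀ *ᵥ P.candY hmn τ) ⟨τ.symm j, hj⟩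
          = (P.Aᵀ *ᵥ P.candY hmn τ) (τ (Fin.castLE hmn ⟨τ.symm j, hj⟩)) := rfl
      rw [h3, h2] at h1
      rw [zero_add, h1]
    · ring
  · refine le_of_eq (Finset.sum_eq_zero fun j _ => ?_)
    simp only [LP.candidate]
    split_ifs <;> simp

/-- When the trial basis is the support of `x*`, the vectors `x*_B` and `y*` solve the square
systems that define the candidate. -/
theorem LP.UniqueSolution.candidate_eq (h : P.UniqueSolution u) {hmn : m ≤ n}
    {τ : Equiv.Perm (Fin n)} (hτ : ∀ k : Fin n, (k : ℕ) < m ↔ 0 < u.x (τ k)) :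
    IsUnit (P.basisMatrix hmn τ).det ∧ P.candidate hmn τ = u := by
  have hB : ∀ j : Fin n, (τ.symm j : ℕ) < m ↔ 0 < u.x j := fun j => by
    rw [hτ, Equiv.apply_symm_apply]
  have hdet : IsUnit (P.basisMatrix hmn τ).det := by
    rw [← det_transpose, ← isUnit_iff_isUnit_det, ← mulVec_injective_iff_isUnit,
      ← coe_mulVecLin, injective_iff_map_eq_zero]
    intro g hg
    refine h.row_injective fun i hi => ?_
    have h1 := congrFun hg ⟨τ.symm i, (hB i).2 hi⟩
    have h2 : τ (Fin.castLE hmn ⟨τ.symm i, (hB i).2 hi⟩) = i := by simp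
    rw [← h2]
    exact h1
  refine ⟨hdet, ?_⟩
  have hzero : ∀ j, ¬ 0 < u.x j → u.x j = 0 := fun j hj =>
    le_antisymm (not_lt.1 hj) (h.optimal.1.2 j)
  have hx : (fun j => if hj : (τ.symm j : ℕ) < m then
      (fun k : Fin m => u.x (τ (Fin.castLE hmn k))) ⟨τ.symm j, hj⟩ else 0) = u.x := by
    ext j
    split_ifs with hj
    · simp
    · exact (hzero j fun hp => hj ((hB j).2 hp)).symm
  have hxB : (P.basisMatrix hmn τ)⁻¹ *ᵥ P.b = fun k : Fin m => u.x (τ (Fin.castLE hmn k)) := by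
    have h1 := LP.mulVec_extend_basis (P := P) hmn τ fun k => u.x (τ (Fin.castLE hmn k))
    rw [hx] at h1
    rw [← h.optimal.1.1, h1, mulVec_mulVec, nonsing_inv_mul _ hdet, one_mulVec]
  have hy : P.candY hmn τ = u.y := by
    have h1 : (fun k : Fin m => P.c (τ (Fin.castLE hmn k)))
        = (P.basisMatrix hmn τ)ᵀ *ᵥ u.y := by
      ext k
      have h2 : 0 < u.x (τ (Fin.castLE hmn k)) := (hτ _).1 k.2
      have h3 := congrFun h.optimal.2.1.1 (τ (Fin.castLE hmn k))
      rcases h.comp (τ (Fin.castLE hmn k)) with ⟨-, hs⟩ | ⟨hx0, -⟩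
      · rw [Pi.add_apply, hs, zero_add] at h3
        exact h3.symm
      · exact absurd h2 (by rw [hx0]; exact lt_irrefl 0)
    rw [LP.candY, h1, mulVec_mulVec, nonsing_inv_mul _ (by rwa [det_transpose]), one_mulVec]
  have hs : (fun j => if (τ.symm j : ℕ) < m then 0 else P.c j - (P.Aᵀ *ᵥ u.y) j) = u.s := by
    ext j
    rcases h.comp j with ⟨hx0, hs0⟩ | ⟨hx0, -⟩
    · rw [if_pos ((hB j).2 hx0), hs0]
    · rw [if_neg (by rw [hB, hx0]; exact lt_irrefl 0), ← h.optimal.2.1.1, Pi.add_apply,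
        add_sub_cancel_right]
  have : P.candidate hmn τ = ⟨u.x, u.s, u.y⟩ := by
    rw [LP.candidate, hxB, hy]
    simp only [hs]
    congr 1
  rw [this]

theorem mem_iff_lt_card_of_isLowerSet {S : Finset (Fin n)}
    (hS : ∀ i j, i ≤ j → j ∈ S → i ∈ S) (k : Fin n) : (k : ℕ) < S.card ↔ k ∈ S := by
  have hsub : ∀ k ∈ S, (k : ℕ) < S.card := by
    intro k hk
    have h1 : Finset.Iic k ⊆ S := fun i hi => hS i k (Finset.mem_Iic.1 hi) hk
    have h2 := Finset.card_le_card h1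
    rw [Fin.card_Iic] at h2
    omega
  refine ⟨fun hk => ?_, hsub k⟩
  by_contra hnot
  have h1 : S ⊆ Finset.Iio k := fun i hi => by
    rw [Finset.mem_Iio]
    by_contra hle
    exact hnot (hS k i (not_lt.1 hle) hi)
  have h2 := Finset.card_le_card h1
  rw [Fin.card_Iio] at h2
  omega

/-- If the indicator separates the optimal basis from the other indices, the test succeeds. -/
theorem LP.UniqueSolution.testSucceeds (h : P.UniqueSolution u) {hmn : m ≤ n}
    {τ : Equiv.Perm (Fin n)} {a : Fin n → ℝ} (hτ : IsDecreasingOrder a τ)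
    (ha : ∀ i j, 0 < u.x i → u.x j = 0 → a j < a i) : P.TestSucceeds hmn τ := by
  classical
  set S : Finset (Fin n) := Finset.univ.filter fun k => 0 < u.x (τ k) with hS
  have hcard : S.card = m := by
    rw [← h.card_basis, Fintype.card_subtype]
    refine Finset.card_bij (fun k _ => τ k) (fun k hk => ?_) (fun k _ l _ hkl => τ.injective hkl)
      fun j hj => ⟨τ.symm j, ?_, by simp⟩
    · simpa [hS] using hk
    · simpa [hS] using hj
  -- Strict separation rules out ties across the two classes, so any admissible ordering puts the
  -- support first.
  have hlow : ∀ i j, i ≤ j → j ∈ S → i ∈ S := by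
    intro i j hij hj
    rw [hS, Finset.mem_filter] at hj ⊢
    refine ⟨Finset.mem_univ _, ?_⟩
    rcases h.comp (τ i) with ⟨hx, -⟩ | ⟨hx, -⟩
    · exact hx
    · exact absurd (ha _ _ hj.2 hx) (not_lt.2 (hτ hij))
  have hk : ∀ k : Fin n, (k : ℕ) < m ↔ 0 < u.x (τ k) := fun k => by
    have h1 := mem_iff_lt_card_of_isLowerSet hlow k
    rw [hcard] at h1
    rw [h1, hS, Finset.mem_filter]
    simp
  obtain ⟨hdet, heq⟩ := h.candidate_eq (hmn := hmn) hk
  refine ⟨hdet, ?_, ?_⟩ <;> rw [heq]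
  · exact h.optimal.1.2
  · exact h.optimal.2.1.2

theorem exists_isDecreasingOrder (a : Fin n → ℝ) : ∃ τ, IsDecreasingOrder a τ := by
  refine ⟨Tuple.sort fun i => -a i, fun i j hij => ?_⟩
  have := Tuple.monotone_sort (fun i => -a i) hij
  simpa using this

theorem minPos_spec {a : Fin n → ℝ} (h : ∃ i, 0 < a i) :
    0 < minPos a ∧ ∀ i, 0 < a i → minPos a ≤ a i := by
  have hfin : {t | ∃ i, 0 < a i ∧ t = a i}.Finite :=
    (Set.finite_range a).subset (by rintro t ⟨i, -, rfl⟩; exact ⟨i, rfl⟩)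
  have hne : {t | ∃ i, 0 < a i ∧ t = a i}.Nonempty := by
    obtain ⟨i, hi⟩ := h
    exact ⟨a i, i, hi, rfl⟩
  refine ⟨?_, fun i hi => csInf_le hfin.bddBelow ⟨i, hi, rfl⟩⟩
  obtain ⟨i, hi, he⟩ := hne.csInf_mem hfin
  rw [minPos, he]
  exact hi

theorem LP.UniqueSolution.exists_basic (h : P.UniqueSolution u) (hm : 0 < m) :
    ∃ i, 0 < u.x i := by
  by_contra! hcon
  have : IsEmpty {i // 0 < u.x i} := ⟨fun i => absurd i.2 (not_lt.2 (hcon i))⟩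
  have := h.card_basis
  simp at this
  omega

theorem LP.UniqueSolution.exists_nonbasic (h : P.UniqueSolution u) (hmn : m < n) :
    ∃ i, 0 < u.s i := by
  by_contra! hcon
  have h1 : ∀ i, 0 < u.x i := fun i => by
    rcases h.comp i with ⟨hx, -⟩ | ⟨-, hs⟩
    · exact hx
    · exact absurd hs (not_lt.2 (hcon i))
  have h2 := h.card_basis
  rw [Fintype.card_subtype, Finset.filter_true_of_mem fun i _ => h1 i] at h2
  simp at h2
  omega

/-- Near the optimal face, all indicators separate the optimal basis from the other indices. -/
theorem LP.UniqueSolution.separation (h : P.UniqueSolution u) (hm : 0 < m) (hmn : m < n)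
    {v : Point m n} (hv : P.StrictlyFeasible v) {R G : ℝ} (hR : ∀ i, R ≤ v.x i * v.s i)
    (hG : v.s ⬝ᵥ v.x ≤ G) (hGR : G ^ 2 < R * (minPos u.x * minPos u.s)) (a : Indicator)
    (i j : Fin n) (hi : 0 < u.x i) (hj : u.x j = 0) : a.vec v j < a.vec v i := by
  obtain ⟨hX, hXle⟩ := minPos_spec (h.exists_basic hm)
  obtain ⟨hS, hSle⟩ := minPos_spec (h.exists_nonbasic hmn)
  obtain ⟨f1, f2, hvx, hvs⟩ := hv
  have hgap0 : u.s ⬝ᵥ u.x = 0 := Finset.sum_eq_zero fun i _ => by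
    rcases h.comp i with ⟨-, hs⟩ | ⟨hx, -⟩
    · rw [hs, zero_mul]
    · rw [hx, mul_zero]
  -- Since the optimal gap is zero, this is `⟨x - x*, s - s*⟩ = 0`; it bounds `s` on the basis and
  -- `x` off it by multiples of the gap.
  have key : ∑ k, (v.s k * u.x k + u.s k * v.x k) = v.s ⬝ᵥ v.x := by
    have h1 := LP.gap_eq f1 f2
    have h2 := LP.gap_eq h.optimal.1.1 h.optimal.2.1.1
    have h3 := LP.gap_eq (u := ⟨u.x, v.s, v.y⟩) h.optimal.1.1 f2
    have h4 := LP.gap_eq (u := ⟨v.x, u.s, u.y⟩) f1 h.optimal.2.1.1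
    simp only at h3 h4
    rw [Finset.sum_add_distrib]
    change v.s ⬝ᵥ u.x + u.s ⬝ᵥ v.x = _
    linarith
  have hnn : ∀ k ∈ Finset.univ, 0 ≤ v.s k * u.x k + u.s k * v.x k := fun k _ =>
    add_nonneg (mul_nonneg (hvs k).le (h.optimal.1.2 k))
      (mul_nonneg (h.optimal.2.1.2 k) (hvx k).le)
  have hle : ∀ k, v.s k * u.x k + u.s k * v.x k ≤ G := fun k =>
    ((Finset.single_le_sum hnn (Finset.mem_univ k)).trans key.le).trans hG
  have hsj : 0 < u.s j := by
    rcases h.comp j with ⟨hx, -⟩ | ⟨-, hs⟩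
    · rw [hj] at hx; exact absurd hx (lt_irrefl 0)
    · exact hs
  have hsi : v.s i * minPos u.x ≤ G := by
    have h1 := mul_le_mul_of_nonneg_left (hXle i hi) (hvs i).le
    have h2 := mul_nonneg (h.optimal.2.1.2 i) (hvx i).le
    linarith [hle i]
  have hxj : v.x j * minPos u.s ≤ G := by
    have h1 := mul_le_mul_of_nonneg_left (hSle j hsj) (hvx j).le
    have h2 := mul_nonneg (hvs j).le (h.optimal.1.2 j)
    linarith [hle j]
  set X := minPos u.x
  set S := minPos u.s
  have hG0 : 0 < G := (mul_pos (hvs i) hX).trans_le hsi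
  -- The chain is `x j ≤ G / S < R X / G ≤ x i`, the middle step being `hGR`.
  have hxlt : v.x j < v.x i := by
    have h1 : R * X ≤ v.x i * G := by
      calc R * X ≤ v.x i * v.s i * X := mul_le_mul_of_nonneg_right (hR i) hX.le
        _ = v.x i * (v.s i * X) := by ring
        _ ≤ v.x i * G := mul_le_mul_of_nonneg_left hsi (hvx i).le
    have h2 : G * (G) < G * (v.x i * S) := by
      have := mul_le_mul_of_nonneg_right h1 hS.le
      nlinarith
    have h3 := lt_of_mul_lt_mul_left h2 hG0.le
    exact lt_of_mul_lt_mul_right (hxj.trans_lt h3) hS.le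
  have hslt : v.s i < v.s j := by
    have h1 : R * S ≤ v.s j * G := by
      calc R * S ≤ v.x j * v.s j * S := mul_le_mul_of_nonneg_right (hR j) hS.le
        _ = v.s j * (v.x j * S) := by ring
        _ ≤ v.s j * G := mul_le_mul_of_nonneg_left hxj (hvs j).le
    have h2 : G * (G) < G * (v.s j * X) := by
      have := mul_le_mul_of_nonneg_right h1 hX.le
      nlinarith
    have h3 := lt_of_mul_lt_mul_left h2 hG0.le
    exact lt_of_mul_lt_mul_right (hsi.trans_lt h3) hX.le
  have hinv : (v.s j)⁻¹ < (v.s i)⁻¹ := by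
    rw [inv_lt_inv₀ (hvs j) (hvs i)]
    exact hslt
  cases a
  · exact hxlt
  · exact hinv
  · exact mul_lt_mul'' hxlt hinv (hvx j).le (inv_pos.2 (hvs j)).le

end Duality

/-! ### Progress of a single iteration -/

/-- The measure of progress `ln (ρ(w) / (v⁰)²)`. -/
noncomputable def Control.progress (w : Control n) : ℝ := Real.log (w.rho / w.v0 ^ 2)

/-- The ratio `ρ / (v⁰)²` is multiplied by `(1 + α ‖v‖²/((n+1) ρ)) / (1 - α)`, which is at least `1
+ α v⁰ / ((n+1) ρ)` and so at least `1 + c / √(n+1)`. -/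
theorem Control.progress_scale {w : Control n} (hw : w.InTarget) {c α : ℝ} (hc : 0 ≤ c)
    (hc1 : c ≤ 1) (h0 : 0 < α) (h1 : α < 1)
    (h : c * Real.sqrt (n + 1) * w.rho ≤ α * w.v0) :
    w.progress + c / (2 * Real.sqrt (n + 1)) ≤ (w.scale (1 - α)).progress := by
  have hρ := Control.rho_pos hw
  have hv : 0 < w.v0 := w.sq_nonneg.trans_lt hw.2
  have hq1 := ShortStep.one_le_sqrt (n := n)
  have hq2 := ShortStep.sq_sqrt (n := n)
  set q := Real.sqrt ((n : ℝ) + 1)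
  have hq : 0 < q := by linarith
  set y := c / q with hy
  have hy0 : 0 ≤ y := by positivity
  have hy1 : y ≤ 1 := by
    rw [hy, div_le_one hq]; linarith
  have hlog : c / (2 * q) ≤ Real.log (1 + y) := by
    refine le_trans ?_ (Real.le_log_one_add_of_nonneg hy0)
    have : c / (2 * q) = y / 2 := by rw [hy]; field_simp
    rw [this, div_le_div_iff₀ (by norm_num) (by linarith)]
    nlinarith
  have h2 : 0 < 1 - α := by linarith
  have hg : 0 ≤ α * (w.sq / (n + 1)) :=
    mul_nonneg h0.le (div_nonneg w.sq_nonneg (by positivity))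
  have hkey : w.rho * (1 + y) ≤ (w.rho + α * (w.sq / (n + 1))) / (1 - α) := by
    have e1 : w.rho * y ≤ α * w.rho + α * (w.sq / (n + 1)) := by
      have : α * w.rho + α * (w.sq / (n + 1)) = α * w.v0 / q ^ 2 := by
        rw [w.v0_eq, hq2]
        field_simp
      rw [this, le_div_iff₀ (by positivity)]
      refine le_trans (le_of_eq ?_) h
      rw [hy]
      field_simp
    rw [le_div_iff₀ h2]
    have e2 : w.rho * (1 + y) * (1 - α)
        ≤ (w.rho + (α * w.rho + α * (w.sq / (n + 1)))) * (1 - α) :=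
      mul_le_mul_of_nonneg_right (by linarith) h2.le
    nlinarith [mul_nonneg h0.le hg, mul_nonneg (pow_nonneg h0.le 2) hρ.le]
  have hfrac : w.rho / w.v0 ^ 2 * (1 + y)
      ≤ (w.scale (1 - α)).rho / (w.scale (1 - α)).v0 ^ 2 := by
    have e3 : (w.scale (1 - α)).rho / (w.scale (1 - α)).v0 ^ 2
        = (w.rho + α * (w.sq / (n + 1))) / (1 - α) / w.v0 ^ 2 := by
      rw [Control.rho_scale]
      simp only [Control.scale]
      field_simp
    rw [e3, div_mul_eq_mul_div]
    exact div_le_div_of_nonneg_right hkey (by positivity)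
  have hpos : 0 < w.rho / w.v0 ^ 2 := by positivity
  have := Real.log_le_log (by positivity) hfrac
  rw [Real.log_mul hpos.ne' (by linarith)] at this
  unfold Control.progress
  linarith

theorem Method.Accept.bounds {M : Method} {p : Params} {βk : ℝ} (h : M.Accept p βk)
    (hβ : p.betaLow ≤ betaOf p.r) : p.betaLow ≤ βk ∧ βk ≤ betaOf p.r := by
  cases M
  · exact h
  · have h : βk = betaOf p.r := h
    exact ⟨h ▸ hβ, h.le⟩
  · have h : βk = betaOf p.r := h
    exact ⟨h ▸ hβ, h.le⟩

/-- For `β = r/(2+r)` the bound of `psi_le_of_decrement` is exactly `r² / (2 (4 - r²))`. -/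
theorem LP.Interior.Psi_le_of_delta_le {z : State m n} (hz : P.Interior z) {r : ℝ}
    (hr0 : 0 < r) (hr1 : r < 1) (h : z.delta ≤ betaOf r) : P.Psi z ≤ r ^ 2 / 6 := by
  have hβ : betaOf r < 1 / 2 := by
    rw [betaOf, div_lt_div_iff₀ (by linarith) (by norm_num)]
    linarith
  rw [hz.Psi_eq]
  refine (psi_le_of_decrement hβ hz.nres_pos (State.sum_nres hz.rho_pos)
    (hz.decrement_le h)).trans ?_
  have h2 : 2 + r ≠ 0 := by linarith
  have e : betaOf r ^ 2 / (2 * (1 - 2 * betaOf r)) = r ^ 2 / (2 * ((2 - r) * (2 + r))) := by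
    have h3 : 1 - 2 * betaOf r = (2 - r) / (2 + r) := by
      rw [betaOf]; field_simp; ring
    have h4 : 2 - r ≠ 0 := by linarith
    rw [h3, betaOf]
    field_simp
  rw [e]
  have : (6 : ℝ) ≤ 2 * ((2 - r) * (2 + r)) := by nlinarith
  exact div_le_div_of_nonneg_left (sq_nonneg _) (by norm_num) this

/-- Constants governing the progress of the methods with parameters `p`: along the iterations
the proximity measure is at most `K` and the normalized residuals are at least `κ`; a predictor
step increases the measure of progress by `c / (2 √(n+1))` and a corrector step decreases the
proximity measure by `d`. -/
structure Rates (p : Params) (K κ c d : ℝ) : Prop where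
  K_pos : 0 < K
  κ_pos : 0 < κ
  κ_le : κ ≤ 1
  c_pos : 0 < c
  d_pos : 0 < d
  nres_ge : ∀ {m n : ℕ} {P : LP m n} {z : State m n}, P.Interior z → P.Psi z ≤ K →
    ∀ i, κ ≤ z.nres i
  predictor : ∀ {M : Method} {m n : ℕ} {P : LP m n} {z : State m n} {βk : ℝ}
    {path : ℝ → State m n} {α : ℝ}, P.Interior z → M.Accept p βk → z.delta ≤ βk →
    M.IsPredictorPath P z path → P.ApproxRoot p path α →
    P.Psi (path α) ≤ K ∧
      z.w.progress + c / (2 * Real.sqrt (n + 1)) ≤ (path α).w.progress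
  corrector : ∀ {M : Method} {m n : ℕ} {P : LP m n} {z : State m n} {βk : ℝ}
    {path : ℝ → State m n} {α : ℝ}, P.Interior z → P.Psi z ≤ K → M.Accept p βk →
    ¬ z.delta ≤ βk → P.IsCorrectorPath z path → P.ApproxMin p path α →
    (path α).w = z.w ∧ P.Psi (path α) ≤ P.Psi z - d

theorem exists_rates {p : Params} (hr0 : 0 < p.r) (hr1 : p.r < 1)
    (hβ0 : 0 < p.betaLow) (hβ1 : p.betaLow ≤ betaOf p.r)
    (hη1 : p.eta ≤ 1 / 2) (hθ0 : 0 < p.theta) :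
    ∃ K κ c d : ℝ, Rates p K κ c d := by
  have hω := half_sq_le_omegaStar hr0.le hr1
  have hr2 : 0 < p.r ^ 2 := by positivity
  set ω := omegaStar p.r with hωdef
  have hω0 : 0 < ω := by linarith
  set K := 3 / 2 * ω with hK
  have hK0 : 0 < K := by positivity
  set κ := Real.exp (-(K + 1)) with hκ
  have hκ0 : 0 < κ := Real.exp_pos _
  have hκ1 : κ ≤ 1 := Real.exp_le_one_iff.2 (by linarith)
  set T := 2 * (K + 1) with hT
  have hT0 : 0 < T := by positivity
  set Y := 4 / κ ^ 2 * K with hY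
  have hY0 : 0 < Y := by positivity
  -- A short step would end at `Ψ ≤ r²/6 + r²/24 < r²/4 ≤ ω/2`, below any accepted root.
  obtain ⟨c, hc0, hc1, hc⟩ := exists_short_step_const hK0 (γ := p.r ^ 2 / 24) (by positivity)
  set α₀ := min (κ / 12) (min (1 / (16 * Y)) (κ / (4 * (T * Y)))) with hα₀
  have hα0 : 0 < α₀ := lt_min (by positivity) (lt_min (by positivity) (by positivity))
  have hα1 : 12 * α₀ ≤ κ := by
    have : α₀ ≤ κ / 12 := min_le_left _ _
    linarith
  have hα2 : 16 * (α₀ * Y) ≤ 1 := by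
    have : α₀ ≤ 1 / (16 * Y) := (min_le_right _ _).trans (min_le_left _ _)
    rw [le_div_iff₀ (by positivity)] at this
    linarith
  have hα3 : 4 * (α₀ * (T * Y)) ≤ κ := by
    have : α₀ ≤ κ / (4 * (T * Y)) := (min_le_right _ _).trans (min_le_right _ _)
    rw [le_div_iff₀ (by positivity)] at this
    linarith
  -- Allows the quadratic step-size conditions to be met by the linear bounds built into `α₀ ≤
  -- 1/12`.
  have hαsq : α₀ ^ 2 ≤ α₀ := by nlinarith
  refine ⟨K, κ, c, p.theta * (α₀ / 2 * (p.betaLow ^ 2 / T)), hK0, hκ0, hκ1, hc0, by positivity,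
    ?_, ?_, ?_⟩
  · intro m n P z hz hΨ
    rw [hz.Psi_eq] at hΨ
    exact exp_le_of_psi_le hz.nres_pos (State.sum_nres hz.rho_pos) hΨ
  · intro M m n P z βk path α hz hacc hδ hp hroot
    obtain ⟨hα, hα', hint, habs⟩ := hroot
    have hab := abs_le.1 habs
    have hηω : p.eta * ω ≤ 1 / 2 * ω := mul_le_mul_of_nonneg_right hη1 hω0.le
    have hΨz := hz.Psi_le_of_delta_le hr0 hr1 (hδ.trans (hacc.bounds hβ1).2)
    refine ⟨by linarith, ?_⟩
    have hlong : ¬ α * z.w.v0 ≤ c * Real.sqrt (n + 1) * z.w.rho := fun hshort => by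
      have := hc M m n P z path α hz (by linarith) hp hα.le hshort hint
      linarith
    rw [Method.predictorPath_w hp]
    exact Control.progress_scale hz.2.1 hc0.le (by linarith) hα hα' (not_le.1 hlong).le
  · intro M m n P z βk path α hz hΨ hacc hδ hp hmin
    have hs := State.sum_nres hz.rho_pos
    have hΨ' := hΨ
    rw [hz.Psi_eq] at hΨ'
    have hlow := exp_le_of_psi_le hz.nres_pos hs hΨ'
    have hup := le_of_psi_le hz.nres_pos hs hΨ'
    have hA2 : ∑ i, ((1 - z.nres i) / z.nres i) ^ 2 ≤ Y := by
      refine (sum_sq_one_sub_div_le hκ0 hκ1 hlow hs).trans ?_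
      rw [hY]
      gcongr
    have hA1 : ∑ i, (1 - z.nres i) ^ 2 / z.nres i ≤ T * Y := by
      refine le_trans ?_ (mul_le_mul_of_nonneg_left hA2 hT0.le)
      rw [Finset.mul_sum]
      refine Finset.sum_le_sum fun i _ => ?_
      have : (1 - z.nres i) ^ 2 / z.nres i = z.nres i * ((1 - z.nres i) / z.nres i) ^ 2 := by
        have := (hz.nres_pos i).ne'
        field_simp
      rw [this]
      exact mul_le_mul_of_nonneg_right (hup i) (sq_nonneg _)
    have hδ' : ¬ z.delta ≤ p.betaLow := fun h => hδ (h.trans (hacc.bounds hβ1).1)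
    have hA1low := sq_div_le_of_lt_decrement hβ0 hT0 hz.nres_pos hup
      (hz.lt_decrement hβ0.le hδ')
    obtain ⟨hw, hdec⟩ := hz.corrector_step hθ0.le hp hmin hκ0 hlow hα0.le hα1 (by
        have := mul_le_mul hαsq hA2 (Finset.sum_nonneg fun _ _ => sq_nonneg _) hα0.le
        linarith) (by
        have := mul_le_mul hαsq hA1 (Finset.sum_nonneg fun i _ =>
          div_nonneg (sq_nonneg _) (hz.nres_pos i).le) hα0.le
        linarith)
    refine ⟨hw, hdec.trans ?_⟩
    gcongr

/-! ### The initial point -/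

theorem Point.sigma_spec {u : Point m n} (hn : 0 < n) (hx : ∀ i, 0 < u.x i)
    (hs : ∀ i, 0 < u.s i) : 0 < u.sigma ∧ ∀ i, u.sigma ≤ u.x i * u.s i := by
  have : Nonempty (Fin n) := ⟨⟨0, hn⟩⟩
  refine ⟨?_, fun i => ciInf_le (Set.finite_range _).bddBelow i⟩
  obtain ⟨i, hi⟩ := exists_eq_ciInf_of_finite (f := fun i => u.x i * u.s i)
  rw [Point.sigma, ← hi]
  exact mul_pos (hx i) (hs i)

/-- The starting control is built so that all residuals equal `σ`: the start is perfectly centered.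
-/
theorem LP.StrictlyFeasible.initial {u : Point m n} (hn : 0 < n) (hu : P.StrictlyFeasible u) :
    P.Interior ⟨u, u.startControl⟩ ∧ P.Psi ⟨u, u.startControl⟩ = 0 ∧
      u.startControl.rho = u.sigma := by
  obtain ⟨f1, f2, hx, hs⟩ := hu
  obtain ⟨hσ, hσle⟩ := Point.sigma_spec hn hx hs
  have hres : ∀ i, State.res ⟨u, u.startControl⟩ i = u.sigma := by
    intro i
    refine Fin.cases ?_ (fun i => ?_) i
    · rw [State.res_zero, Point.startControl]
      ring
    · rw [State.res_succ, Point.startControl]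
      simp only
      rw [Real.sq_sqrt (sub_nonneg.2 (hσle i))]
      ring
  have hρ : u.startControl.rho = u.sigma := by
    have h := State.sum_res ⟨u, u.startControl⟩
    simp only [hres, Finset.sum_const, Finset.card_univ, Fintype.card_fin, nsmul_eq_mul] at h
    push_cast at h
    have h0 : (n + 1 : ℝ) ≠ 0 := by positivity
    exact (mul_left_cancel₀ h0 h).symm
  have hv0 := u.startControl.v0_eq
  have hsq := u.startControl.sq_nonneg
  have hpos : 0 < ((n : ℝ) + 1) * u.startControl.rho := by rw [hρ]; positivity
  have hint : P.Interior ⟨u, u.startControl⟩ :=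
    LP.interior_of_pos f1 f2 ⟨by simp only; linarith, by simp only; linarith⟩ hx hs
      fun i => by rw [hres]; exact hσ
  refine ⟨hint, ?_, hρ⟩
  rw [hint.Psi_eq]
  have : ∀ i, State.nres ⟨u, u.startControl⟩ i = 1 := fun i => by
    rw [State.nres, hres, hρ, div_self hσ.ne']
  simp [psi, this]

/-! ### Complexity of the methods with the termination test -/

/-- The invariant of the iteration: after `k` iterations the method is at an interior point with
bounded proximity measure, and `k` is bounded by a potential. -/
structure Invariant (P : LP m n) (w0 : Control n) (K c d : ℝ) (k : ℕ) (z : State m n) :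
    Prop where
  interior : P.Interior z
  Psi_le : P.Psi z ≤ K
  count : (k : ℝ) ≤ 2 * (1 + K / d) / c * (Real.sqrt (n + 1) * (z.w.progress - w0.progress))
    - P.Psi z / d

section Run

variable {p : Params} {K κ c d : ℝ} {M : Method} {a : Indicator} {hmn : m ≤ n}
  {u0 u : Point m n}

theorem LP.Interior.Psi_nonneg {z : State m n} (hz : P.Interior z) : 0 ≤ P.Psi z := by
  rw [hz.Psi_eq]
  exact psi_nonneg hz.nres_pos (State.sum_nres hz.rho_pos)

theorem Invariant.testSucceeds (hR : Rates p K κ c d) (hu : P.UniqueSolution u) (hm : 0 < m)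
    (hlt : m < n) {w0 : Control n} {k : ℕ} {z : State m n} (hz : Invariant P w0 K c d k z)
    (h : z.w.v0 ^ 2 < κ * z.w.rho * (minPos u.x * minPos u.s)) {τ : Equiv.Perm (Fin n)}
    (hτ : IsDecreasingOrder (a.vec z.u) τ) : P.TestSucceeds hmn τ := by
  have hρ := hz.interior.rho_pos
  refine hu.testSucceeds hτ fun i j hi hj => hu.separation hm hlt hz.interior.1 (fun i => ?_)
    hz.interior.gap_lt.le h a i j hi hj
  have h1 := mul_le_mul_of_nonneg_right (hR.nres_ge hz.interior hz.Psi_le i.succ) hρ.le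
  rw [State.nres_mul hρ, State.res_succ] at h1
  linarith [sq_nonneg (z.w.v i)]

/-- The gain in progress is worth `1 + K/d` iterations: one pays for the predictor itself, `K/d` for
the correctors that the new value of `Ψ` may cause. -/
theorem Invariant.predictor (hR : Rates p K κ c d) {w0 : Control n} {k : ℕ}
    {z z' : State m n} (hz : Invariant P w0 K c d k z) (hz' : P.Interior z')
    (hΨ : P.Psi z' ≤ K)
    (hprog : z.w.progress + c / (2 * Real.sqrt (n + 1)) ≤ z'.w.progress) :
    Invariant P w0 K c d (k + 1) z' := by
  refine ⟨hz', hΨ, ?_⟩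
  have hq1 := ShortStep.one_le_sqrt (n := n)
  have hcount := hz.count
  set q := Real.sqrt ((n : ℝ) + 1)
  have hq : 0 < q := by linarith
  have hc := hR.c_pos
  have hd := hR.d_pos
  have hK := hR.K_pos
  have h1 : 2 * (1 + K / d) / c * (q * (z.w.progress - w0.progress)) + (1 + K / d)
      ≤ 2 * (1 + K / d) / c * (q * (z'.w.progress - w0.progress)) := by
    have h2 : 2 * (1 + K / d) / c * (q * (z.w.progress - w0.progress)) + (1 + K / d)
        = 2 * (1 + K / d) / c * (q * (z.w.progress + c / (2 * q) - w0.progress)) := by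
      field_simp
      ring
    rw [h2]
    gcongr
  have h3 : P.Psi z' / d ≤ K / d := by gcongr
  have h4 : 0 ≤ P.Psi z / d := div_nonneg hz.interior.Psi_nonneg hd.le
  push_cast
  linarith

theorem Invariant.corrector (hR : Rates p K κ c d) {w0 : Control n} {k : ℕ}
    {z z' : State m n} (hz : Invariant P w0 K c d k z) (hz' : P.Interior z')
    (hw : z'.w = z.w) (hΨ : P.Psi z' ≤ P.Psi z - d) :
    Invariant P w0 K c d (k + 1) z' := by
  have hd := hR.d_pos
  refine ⟨hz', by linarith [hz.Psi_le], ?_⟩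
  have hcount := hz.count
  have h3 : P.Psi z' / d ≤ P.Psi z / d - 1 := by
    rw [div_le_iff₀ hd, sub_mul, div_mul_cancel₀ _ hd.ne']
    linarith
  rw [hw]
  push_cast
  linarith

/-- One step of the method: either it stops with the solution, or it continues with the
invariant, and then it is still far from the solution. -/
theorem Invariant.step (hR : Rates p K κ c d) (hr0 : 0 < p.r) (hr1 : p.r < 1)
    (hβ1 : p.betaLow ≤ betaOf p.r) (hη0 : 0 ≤ p.eta) (hu : P.UniqueSolution u) (hm : 0 < m)
    (hlt : m < n) {w0 : Control n} {k : ℕ} {z : State m n} (hz : Invariant P w0 K c d k z)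
    {C : Config m n} (h : Step M p a P hmn (.running z) C) :
    C = .done u ∨ ∃ z', C = .running z' ∧ Invariant P w0 K c d (k + 1) z' ∧
      κ * z.w.rho * (minPos u.x * minPos u.s) ≤ z.w.v0 ^ 2 := by
  cases h with
  | terminate _ τ hτ htest => exact Or.inl (by rw [hu.unique _ htest.isOptimal])
  | proceed _ τ _ hτ htest hit =>
    -- The test just failed, so the iterate cannot be in the region where success is certain.
    have hfar : κ * z.w.rho * (minPos u.x * minPos u.s) ≤ z.w.v0 ^ 2 := by
      by_contra! hcon
      exact htest (hz.testSucceeds hR hu hm hlt hcon hτ)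
    cases hit with
    | predictor βk path α hacc hδ hp hroot =>
      obtain ⟨h1, h2⟩ := hR.predictor hz.interior hacc hδ hp hroot
      exact Or.inr ⟨_, rfl, hz.predictor hR hroot.2.2.1 h1 h2, hfar⟩
    | fullStep βk path hacc hδ hp hroot =>
      left
      have hω := half_sq_le_omegaStar hr0.le hr1
      have hr2 : 0 < p.r ^ 2 := by positivity
      have hΨ := hz.interior.Psi_le_of_delta_le hr0 hr1 (hδ.trans (hacc.bounds hβ1).2)
      rw [hu.unique _ (hz.interior.fullStep_isOptimal hη0 (by linarith) (by linarith) hp hroot)]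
    | corrector βk path α hacc hδ hp hmin =>
      obtain ⟨h1, h2⟩ := hR.corrector hz.interior hz.Psi_le hacc hδ hp hmin
      exact Or.inr ⟨_, rfl, hz.corrector hR hmin.2.1 h1 h2, hfar⟩

theorem Method.exists_predictorPath (M : Method) (hinj : ∀ g, P.Aᵀ *ᵥ g = 0 → g = 0)
    {z : State m n} (hx : ∀ i, 0 < z.u.x i) (hs : ∀ i, 0 < z.u.s i) :
    ∃ path, M.IsPredictorPath P z path := by
  have hex := fun d => LP.exists_isTangent hinj hx hs d
  cases M
  · obtain ⟨D, hD⟩ := hex z.rhsTangential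
    exact ⟨_, D, hD, fun _ => rfl⟩
  · obtain ⟨D, hD⟩ := hex z.rhsAuto
    exact ⟨_, D, hD, fun _ => rfl⟩
  · obtain ⟨D, hD⟩ := hex z.rhsAuto
    obtain ⟨E, hE⟩ := hex (z.rhsSecond D)
    exact ⟨_, D, E, hD, hE, fun _ => rfl⟩

theorem Method.accept_betaOf (M : Method) (hβ1 : p.betaLow ≤ betaOf p.r) :
    M.Accept p (betaOf p.r) := by
  cases M
  · exact ⟨hβ1, le_rfl⟩
  · rfl
  · rfl

/-- At an interior point a step of the method is possible. -/
theorem LP.Interior.exists_step (hβ0 : 0 < p.betaLow) (hβ1 : p.betaLow ≤ betaOf p.r)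
    (hθ0 : 0 ≤ p.theta) (hθ1 : p.theta ≤ 1) (hinj : ∀ g, P.Aᵀ *ᵥ g = 0 → g = 0)
    {z : State m n} (hz : P.Interior z) : ∃ C, Step M p a P hmn (.running z) C := by
  obtain ⟨τ, hτ⟩ := exists_isDecreasingOrder (a.vec z.u)
  have hx := hz.1.2.2.1
  have hs := hz.1.2.2.2
  have hacc := M.accept_betaOf hβ1
  by_cases htest : P.TestSucceeds hmn τ
  · exact ⟨_, .terminate z τ hτ htest⟩
  by_cases hδ : z.delta ≤ betaOf p.r
  · obtain ⟨path, hp⟩ := M.exists_predictorPath hinj hx hs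
    by_cases hroot : ∃ α, P.ApproxRoot p path α
    · obtain ⟨α, hα⟩ := hroot
      exact ⟨_, .proceed z τ _ hτ htest (.predictor _ path α hacc hδ hp hα)⟩
    · exact ⟨_, .proceed z τ _ hτ htest (.fullStep _ path hacc hδ hp (not_exists.1 hroot))⟩
  · obtain ⟨D, hD⟩ := LP.exists_isTangent hinj hx hs z.rhsCorrector
    have hp : P.IsCorrectorPath z fun α => ⟨z.u.move α D, z.w⟩ := ⟨D, hD, fun _ => rfl⟩
    obtain ⟨α, hα⟩ := hz.exists_approxMin hθ0 hθ1 (hβ0.le.trans hβ1) hδ hp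
    exact ⟨_, .proceed z τ _ hτ htest (.corrector _ _ α hacc hδ hp hα)⟩

theorem Invariant.initial (hR : Rates p K κ c d) (hn : 0 < n) (hu0 : P.StrictlyFeasible u0) :
    Invariant P u0.startControl K c d 0 ⟨u0, u0.startControl⟩ := by
  obtain ⟨h1, h2, -⟩ := hu0.initial hn
  refine ⟨h1, by rw [h2]; exact hR.K_pos.le, ?_⟩
  rw [h2]
  simp

/-- The number of iterations made far from the solution. -/
theorem Invariant.count_le (hR : Rates p K κ c d) (hu : P.UniqueSolution u) (hm : 0 < m)
    (hlt : m < n) (hu0 : P.StrictlyFeasible u0) {k : ℕ} {z : State m n}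
    (hz : Invariant P u0.startControl K c d k z)
    (hfar : κ * z.w.rho * (minPos u.x * minPos u.s) ≤ z.w.v0 ^ 2) :
    (k : ℝ) ≤ 4 * (1 + K / d) / c * (1 + Real.log κ⁻¹) * (Real.sqrt n *
      max 1 (Real.log ((u0.s ⬝ᵥ u0.x + u0.sigma) ^ 2 /
        (minPos u.x * minPos u.s * u0.sigma)))) := by
  have hn : 0 < n := hm.trans hlt
  obtain ⟨hσ, -⟩ := Point.sigma_spec hn hu0.2.2.1 hu0.2.2.2
  obtain ⟨hi0, -, hρ0⟩ := hu0.initial hn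
  have hX := (minPos_spec (hu.exists_basic hm)).1
  have hS := (minPos_spec (hu.exists_nonbasic hlt)).1
  have hρ := hz.interior.rho_pos
  have hv := hz.interior.v0_pos
  have hV : 0 < u0.s ⬝ᵥ u0.x + u0.sigma := hi0.v0_pos
  have hc := hR.c_pos
  have hd := hR.d_pos
  have hK := hR.K_pos
  have hκ := hR.κ_pos
  set L := Real.log ((u0.s ⬝ᵥ u0.x + u0.sigma) ^ 2 / (minPos u.x * minPos u.s * u0.sigma))
    with hL
  have hprog : z.w.progress - u0.startControl.progress ≤ Real.log κ⁻¹ + L := by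
    have h1 : z.w.rho / z.w.v0 ^ 2 ≤ 1 / (κ * (minPos u.x * minPos u.s)) := by
      rw [div_le_div_iff₀ (by positivity) (by positivity)]
      linarith
    have h2 : z.w.progress ≤ Real.log (1 / (κ * (minPos u.x * minPos u.s))) :=
      Real.log_le_log (by positivity) h1
    have h3 : u0.startControl.progress
        = Real.log (u0.sigma / (u0.s ⬝ᵥ u0.x + u0.sigma) ^ 2) := by
      rw [Control.progress, hρ0]
      rfl
    have h4 : Real.log κ⁻¹ + L = Real.log (1 / (κ * (minPos u.x * minPos u.s)))
        - Real.log (u0.sigma / (u0.s ⬝ᵥ u0.x + u0.sigma) ^ 2) := by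
      rw [hL, ← Real.log_mul (by positivity) (by positivity),
        ← Real.log_div (by positivity) (by positivity)]
      congr 1
      field_simp
    linarith
  have hℓ : 0 ≤ Real.log κ⁻¹ := Real.log_nonneg (by
    rw [one_le_inv₀ hκ]
    exact hR.κ_le)
  have hbound : Real.log κ⁻¹ + L ≤ (1 + Real.log κ⁻¹) * max 1 L := by
    have h1 := le_max_left 1 L
    have h2 := le_max_right 1 L
    nlinarith
  have hsqrt : Real.sqrt ((n : ℝ) + 1) ≤ 2 * Real.sqrt n := by
    have h1 : (1 : ℝ) ≤ n := by exact_mod_cast hn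
    rw [Real.sqrt_le_iff]
    refine ⟨by positivity, ?_⟩
    rw [mul_pow, Real.sq_sqrt (by positivity)]
    linarith
  have hm1 : 0 < max 1 L := lt_max_of_lt_left one_pos
  calc (k : ℝ) ≤ 2 * (1 + K / d) / c * (Real.sqrt (n + 1) *
        (z.w.progress - u0.startControl.progress)) - P.Psi z / d := hz.count
    _ ≤ 2 * (1 + K / d) / c * (Real.sqrt (n + 1) *
        (z.w.progress - u0.startControl.progress)) :=
        sub_le_self _ (div_nonneg hz.interior.Psi_nonneg hd.le)
    _ ≤ 2 * (1 + K / d) / c * (Real.sqrt (n + 1) * ((1 + Real.log κ⁻¹) * max 1 L)) := by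
        have := hprog.trans hbound
        gcongr
    _ ≤ 2 * (1 + K / d) / c * (2 * Real.sqrt n * ((1 + Real.log κ⁻¹) * max 1 L)) := by
        gcongr
    _ = _ := by ring

end Run

end PTF

/-! ### The main theorem. -/

theorem mainTheorem9 (p : PTF.Params) (hr0 : 0 < p.r) (hr1 : p.r < 1)
    (hβ0 : 0 < p.betaLow) (hβ1 : p.betaLow ≤ PTF.betaOf p.r)
    (hη0 : 0 ≤ p.eta) (hη1 : p.eta ≤ 1 / 2) (hθ0 : 0 < p.theta) (hθ1 : p.theta ≤ 1) :
    ∃ C : ℝ, 0 < C ∧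
      ∀ (M : PTF.Method) (a : PTF.Indicator) (m n : ℕ) (_hm : 0 < m) (hmn : m < n)
        (P : PTF.LP m n) (u0 ustar : PTF.Point m n),
        P.StrictlyFeasible u0 →
        P.IsOptimal ustar →
        (∀ u, P.IsOptimal u → u = ustar) →
        (∀ i, 0 < ustar.x i + ustar.s i) →
        -- no execution gets stuck
        (∀ κ, Relation.ReflTransGen (PTF.Step M p a P hmn.le) (PTF.initial u0) κ →
          ∃ κ', PTF.Step M p a P hmn.le κ κ') ∧
        -- every execution stops with the exact solution within the stated number of iterations
        (∀ κ : ℕ → PTF.Config m n, κ 0 = PTF.initial u0 →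
          (∀ k, PTF.Step M p a P hmn.le (κ k) (κ (k + 1))) →
          ∃ K : ℕ,
            (K : ℝ) ≤ C * Real.sqrt n * max 1 (Real.log
              ((u0.s ⬝ᵥ u0.x + u0.sigma) ^ 2 /
                (PTF.minPos ustar.x * PTF.minPos ustar.s * u0.sigma))) ∧
            κ K = .done ustar) := by
  obtain ⟨K, κ₀, c, d, hR⟩ := PTF.exists_rates hr0 hr1 hβ0 hβ1 hη1 hθ0
  have hc := hR.c_pos
  have hd := hR.d_pos
  have hK := hR.K_pos
  have hℓ : 0 ≤ Real.log κ₀⁻¹ := Real.log_nonneg (by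
    rw [one_le_inv₀ hR.κ_pos]
    exact hR.κ_le)
  set C₀ := 4 * (1 + K / d) / c * (1 + Real.log κ₀⁻¹) with hC₀
  have hC₀pos : 0 < C₀ := by positivity
  refine ⟨C₀ + 2, by positivity, fun M a m n hm hmn P u0 ustar hu0 hopt huniq hsc => ?_⟩
  have hu := hopt.uniqueSolution hu0 huniq hsc
  have hn : 0 < n := hm.trans hmn
  have hinit := PTF.Invariant.initial hR hn hu0
  have hstep := fun (k : ℕ) (z : PTF.State m n) (C : PTF.Config m n)
    (hz : PTF.Invariant P u0.startControl K c d k z)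
    (h : PTF.Step M p a P hmn.le (.running z) C) =>
      hz.step hR hr0 hr1 hβ1 hη0 hu hm hmn h
  constructor
  · intro κ hκ
    have hinv : κ = .done ustar ∨
        ∃ k z, κ = .running z ∧ PTF.Invariant P u0.startControl K c d k z := by
      induction hκ with
      | refl => exact Or.inr ⟨0, _, rfl, hinit⟩
      | tail _ h ih =>
        rcases ih with rfl | ⟨k, z, rfl, hz⟩
        · cases h
          exact Or.inl rfl
        · rcases hstep k z _ hz h with h1 | ⟨z', h1, h2, -⟩
          · exact Or.inl h1
          · exact Or.inr ⟨k + 1, z', h1, h2⟩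
    rcases hinv with rfl | ⟨k, z, rfl, hz⟩
    · exact ⟨_, .idle ustar⟩
    · exact hz.interior.exists_step hβ0 hβ1 hθ0.le hθ1 (hopt.transpose_injective huniq)
  · intro κ h0 hrun
    have hinv : ∀ k, κ k = .done ustar ∨
        ∃ z, κ k = .running z ∧ PTF.Invariant P u0.startControl K c d k z := by
      intro k
      induction k with
      | zero => exact Or.inr ⟨_, h0, hinit⟩
      | succ k ih =>
        have h := hrun k
        rcases ih with h1 | ⟨z, h1, hz⟩
        · rw [h1] at h
          generalize κ (k + 1) = C at h
          cases h
          exact Or.inl rfl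
        · rw [h1] at h
          rcases hstep k z _ hz h with h2 | ⟨z', h2, h3, -⟩
          · exact Or.inl h2
          · exact Or.inr ⟨z', h2, h3⟩
    set Λ := max 1 (Real.log ((u0.s ⬝ᵥ u0.x + u0.sigma) ^ 2 /
      (PTF.minPos ustar.x * PTF.minPos ustar.s * u0.sigma))) with hΛ
    have hΛ1 : 1 ≤ Λ := le_max_left _ _
    have hsqrt : 1 ≤ Real.sqrt n := Real.one_le_sqrt.2 (by exact_mod_cast hn)
    have hone : 1 ≤ Real.sqrt n * Λ := by nlinarith
    have hB0 : 0 ≤ C₀ * (Real.sqrt n * Λ) := by positivity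
    -- An iterate from which the method continues has index at most `C₀ √n Λ`. So at index `⌊·⌋ + 1`
    -- the method has stopped or stops with its next step; the surplus 2 is absorbed by the constant
    -- since `√n Λ ≥ 1`.
    refine ⟨⌊C₀ * (Real.sqrt n * Λ)⌋₊ + 2, ?_, ?_⟩
    · have := Nat.floor_le hB0
      push_cast
      nlinarith
    · set k := ⌊C₀ * (Real.sqrt n * Λ)⌋₊ + 1 with hk
      have hklt : C₀ * (Real.sqrt n * Λ) < k := by
        rw [hk]
        push_cast
        exact Nat.lt_floor_add_one _
      have h := hrun k
      rcases hinv k with h1 | ⟨z, h1, hz⟩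
      · rw [h1] at h
        generalize κ (k + 1) = C at h
        cases h
        rfl
      · rw [h1] at h
        rcases hstep k z _ hz h with h2 | ⟨z', -, -, hfar⟩
        · exact h2
        · exact absurd (hz.count_le hR hu hm hmn hu0 hfar) (not_le.2 hklt)
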